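/- Let $N\ge 1$, $s\in(0,1)$, $0<\gamma\le\Gamma<\infty$. For nonempty index sets $I,J$ let $\{K_{ij}\}_{i\in I,j\in J}$ be even kernels on $\mathbb R^N\setminus\{0\}$ of the form $K_{ij}(z)=a_{ij}(z/|z|)\,|z|^{-(N+2s)}$, where $a_{ij}:S^{N-1}\to\mathbb R$ is measurable and $\gamma\le a_{ij}\le\Gamma$. For measurable $A\subseteq\mathbb R^N$ put $$L_{ij}[A]v(x)=\mathrm{P.V.}\int_A [v(y)-v(x)]\,K_{ij}(x-y)\,dy ,$$ and let $\mathcal I v=\inf_{i\in I}\sup_{j\in J}L_{ij}[\mathbb R^N]v$. Let $\Omega\subset\mathbb R^N$ be a bounded domain with $C^2$ boundary, and let $d(x)=\mathrm{dist}(x,\partial\Omega)$. Let $u:\mathbb R^N\to\mathbb R$ be a viscosity subsolution of the Dirichlet problem $\mathcal I u=0$ in $\Omega$, $u=0$ in $\mathbb R^N\setminus\overline\Omega$, $\lim_{z\to x,\,z\in\Omega}d(z)^{1-s}u(z)=0$ for $x\in\partial\Omega$. That is: (i) $u\in L^1_{loc}(\mathbb R^N)$, $\int_{\mathbb R^N}|u(y)|(1+|y|)^{-(N+2s)}\,dy<\infty$,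 $u\in L^\infty_{loc}(\Omega)$, and $u$ is upper semicontinuous in $\Omega$; (ii) whenever $x_0\in\Omega$, $\delta>0$, $B_\delta(x_0)\subset\Omega$, and $\varphi\in C^2(B_\delta(x_0))\cap L^1(B_\delta(x_0))$ is such that $x_0$ is a maximum point of $u-\varphi$ in $B_\delta(x_0)$, we have $$\inf_{i\in I}\sup_{j\in J}\big\{L_{ij}[B_\delta(x_0)]\varphi(x_0)+L_{ij}[\mathbb R^N\setminus B_\delta(x_0)]u(x_0)\big\}\ \ge\ 0;$$ (iii) $u\le 0$ in $\mathbb R^N\setminus\overline\Omega$; (iv) $\limsup_{z\to x,\,z\in\Omega}d(z)^{1-s}u(z)\le 0$ for every $x\in\partial\Omega$. Then $u\le 0$ in $\Omega$. -/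

import Mathlib

open Set Filter Topology MeasureTheory

noncomputable section

namespace FracHarm

/-- `Ω ⊆ ℝ^N` has `C²` boundary: near each boundary point, `Ω` is the positivity set of a `C²`
function whose gradient does not vanish. -/
def HasC2Boundary {N : ℕ} (Ω : Set (EuclideanSpace ℝ (Fin N))) : Prop :=
  ∀ x ∈ frontier Ω, ∃ (U : Set (EuclideanSpace ℝ (Fin N))) (ψ : EuclideanSpace ℝ (Fin N) → ℝ),
    IsOpen U ∧ x ∈ U ∧ ContDiffOn ℝ 2 ψ U ∧ (∀ y ∈ U, fderiv ℝ ψ y ≠ 0) ∧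
      ∀ y ∈ U, (y ∈ Ω ↔ 0 < ψ y)

/-- A bounded domain (open, connected, nonempty set) of `ℝ^N` with `C²` boundary. -/
structure IsBoundedC2Domain {N : ℕ} (Ω : Set (EuclideanSpace ℝ (Fin N))) : Prop where
  isOpen : IsOpen Ω
  isConnected : IsConnected Ω
  isBounded : Bornology.IsBounded Ω
  boundary : HasC2Boundary Ω

/-- The class `𝒦` of even kernels `K(z) = a(z/|z|) |z|^{-(N+2s)}`, `z ≠ 0`, with `a` a measurable
function on the unit sphere such that `γ ≤ a ≤ Γ`. The value of `K` at `0` plays no role. -/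
structure IsStableKernel {N : ℕ} (s γ Γ : ℝ) (K : EuclideanSpace ℝ (Fin N) → ℝ) : Prop where
  even : ∀ z, z ≠ 0 → K (-z) = K z
  stable : ∃ a : Metric.sphere (0 : EuclideanSpace ℝ (Fin N)) 1 → ℝ,
    Measurable a ∧ (∀ θ, γ ≤ a θ ∧ a θ ≤ Γ) ∧
      ∀ (θ : Metric.sphere (0 : EuclideanSpace ℝ (Fin N)) 1) (r : ℝ), 0 < r →
        K (r • (θ : EuclideanSpace ℝ (Fin N))) = a θ / r ^ ((N : ℝ) + 2 * s)

/-- The distance `d(x)` to the boundary of `Ω`. -/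
def bdist {N : ℕ} (Ω : Set (EuclideanSpace ℝ (Fin N))) (x : EuclideanSpace ℝ (Fin N)) : ℝ :=
  Metric.infDist x (frontier Ω)

/-- `u ∈ L¹_ω(ℝ^N)`, with the weight `ω(y) = (1 + |y|)^{-(N+2s)}`. -/
def MemL1Weight {N : ℕ} (s : ℝ) (u : EuclideanSpace ℝ (Fin N) → ℝ) : Prop :=
  LocallyIntegrable u volume ∧
    Integrable (fun y => |u y| * (1 / (1 + ‖y‖) ^ ((N : ℝ) + 2 * s))) volume

/-- `u ∈ L^∞_loc(Ω)`: `u` is essentially bounded on each compact subset of `Ω`. -/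
def MemLinftyLoc {N : ℕ} (Ω : Set (EuclideanSpace ℝ (Fin N)))
    (u : EuclideanSpace ℝ (Fin N) → ℝ) : Prop :=
  ∀ C : Set (EuclideanSpace ℝ (Fin N)), IsCompact C → C ⊆ Ω → MemLp u ⊤ (volume.restrict C)

/-- `L_K[A]v(x) = P.V. ∫_A (v(y) - v(x)) K(x - y) dy`, that is, the limit as `ε → 0⁺` of the
integrals over `A \ B_ε(x)`. The limit exists for `K` in the class `𝒦` if `A` is a ball centred
at `x` and `v` is `C²` and integrable on it, and if `A` is the complement of such a ball and
`v ∈ L¹_ω(ℝ^N)`; it is used in these two cases only. -/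
def pvOp {N : ℕ} (K : EuclideanSpace ℝ (Fin N) → ℝ) (A : Set (EuclideanSpace ℝ (Fin N)))
    (v : EuclideanSpace ℝ (Fin N) → ℝ) (x : EuclideanSpace ℝ (Fin N)) : ℝ :=
  limUnder (𝓝[>] (0 : ℝ)) fun ε => ∫ y in A \ Metric.ball x ε, (v y - v x) * K (x - y)

/-- `𝓘_δ(u, φ, x) = inf_i sup_j { L_ij[B_δ(x)] φ(x) + L_ij[B_δ(x)ᶜ] u(x) }`, with the infimum and
the supremum taken in the extended reals. -/
def isaacsDelta {N : ℕ} {I J : Type*} (K : I → J → EuclideanSpace ℝ (Fin N) → ℝ) (δ : ℝ)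
    (u φ : EuclideanSpace ℝ (Fin N) → ℝ) (x : EuclideanSpace ℝ (Fin N)) : EReal :=
  ⨅ i, ⨆ j, ((pvOp (K i j) (Metric.ball x δ) φ x +
    pvOp (K i j) (Metric.ball x δ)ᶜ u x : ℝ) : EReal)

/-- Viscosity subsolutions of `𝓘u = f` in `Ω`, where `𝓘 = inf_i sup_j L_{K_ij}`. The test
functions `φ` are integrable on the ball on which they are `C²`, so that `L_ij[B_δ(x₀)]φ(x₀)` is
well defined. -/
structure IsViscositySubsolution {N : ℕ} {I J : Type*} (s : ℝ)
    (K : I → J → EuclideanSpace ℝ (Fin N) → ℝ) (Ω : Set (EuclideanSpace ℝ (Fin N)))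
    (f u : EuclideanSpace ℝ (Fin N) → ℝ) : Prop where
  memL1Weight : MemL1Weight s u
  memLinftyLoc : MemLinftyLoc Ω u
  usc : UpperSemicontinuousOn u Ω
  viscosity : ∀ x₀ ∈ Ω, ∀ δ : ℝ, 0 < δ → Metric.ball x₀ δ ⊆ Ω →
    ∀ φ : EuclideanSpace ℝ (Fin N) → ℝ, ContDiffOn ℝ 2 φ (Metric.ball x₀ δ) →
      IntegrableOn φ (Metric.ball x₀ δ) volume →
      IsMaxOn (fun y => u y - φ y) (Metric.ball x₀ δ) x₀ →
      ((f x₀ : ℝ) : EReal) ≤ isaacsDelta K δ u φ x₀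

/-- Viscosity subsolutions of the Dirichlet problem `𝓘u = f` in `Ω`, `u = g` outside the closure
of `Ω`, `lim_{z → x, z ∈ Ω} d(z)^{1-s} u(z) = h(x)` for `x ∈ ∂Ω`. The upper limit is taken in the
extended reals. -/
structure IsDirichletSubsolution {N : ℕ} {I J : Type*} (s : ℝ)
    (K : I → J → EuclideanSpace ℝ (Fin N) → ℝ) (Ω : Set (EuclideanSpace ℝ (Fin N)))
    (f g h u : EuclideanSpace ℝ (Fin N) → ℝ) : Prop where
  subsolution : IsViscositySubsolution s K Ω f u
  exterior : ∀ x ∉ closure Ω, u x ≤ g x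
  boundary : ∀ x ∈ frontier Ω,
    limsup (fun z => ((bdist Ω z ^ (1 - s) * u z : ℝ) : EReal)) (𝓝[Ω] x) ≤ ((h x : ℝ) : EReal)

end FracHarm

end

/-! The proof compares `u` with small multiples of a barrier. The barrier is a function `w` that
vanishes outside `Ω`, is at least `ρ ^ (s - 1)` inside, where `ρ` is a `C²` defining function of
`Ω`, and satisfies `∫ secondDiff w x z * K z ≤ -1` at every point of `Ω` for every kernel of the
class at once (`exists_barrier`). Since `ρ ≤ L d`, the weighted boundary condition puts `u` strictly
below `ε w` near `∂Ω` for every `ε > 0`. If `u` were positive somewhere, then for a small `ε` the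
function `u - ε w` would have a positive maximum at an interior point `x₀`. The exterior condition,
and the nullity of `∂Ω`, make this a global maximum up to a null set. So `ε w` is a test function
for which replacing `u` by `ε w` outside the ball only increases the operator, and the viscosity
inequality gives `0 ≤ -ε / 2`. As the barrier serves all kernels, the inf-sup plays no further role.

The barrier is `ρ_+^(s-1) + ρ_+^τ + M 1_Ω` with `τ` slightly larger than `s - 1`. If `ρ` were affine
with gradient `p`, polar coordinates would factor the integral for a homogeneous kernel into an
angular moment of `|⟨p, θ⟩|^(2s)` and the one-dimensional constant `rpowConst s σ`
(`integrable_comp_inner_mul_kernel`). The sign is therefore the same for all kernels: `rpowConst` is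
nonpositive at `σ = s - 1` and negative slightly above it (`rpowConst_nonpos`, `rpowConst_neg`). The
power `s - 1` supplies the boundary growth and the power `τ` a strictly negative term of order `ρ ^
(τ - 2 * s)`.

For curved `ρ`, the error of linearization is `O(ρ ^ (σ + α - 2 * s))` for some `α > τ - (s - 1)`
(`exists_lintegral_linError_le`), which the negative term absorbs near `∂Ω`. The estimate rests on
the growth of the mass of `ρ^(-β)`, `β < 1`, on balls. Away from `∂Ω` all errors are bounded and `M
1_Ω` absorbs them, since the operator is uniformly negative on an indicator function. -/

noncomputable section

namespace FracHarm

open scoped ENNReal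

local notation "𝔼" N:max => EuclideanSpace ℝ (Fin N)

/-! ### Taylor estimates -/

/-- First order Taylor expansion of a function with Lipschitz derivative on a convex set. -/
theorem abs_sub_fderiv_le_of_lipschitzOn {E : Type*} [NormedAddCommGroup E] [NormedSpace ℝ E]
    {φ : E → ℝ} {B : Set E} (hB : Convex ℝ B) {C : ℝ}
    (hd : ∀ y ∈ B, DifferentiableAt ℝ φ y)
    {x : E} (hx : x ∈ B) (hL : ∀ y ∈ B, ‖fderiv ℝ φ y - fderiv ℝ φ x‖ ≤ C * ‖y - x‖)
    {y : E} (hy : y ∈ B) (hC : 0 ≤ C) :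
    |φ y - φ x - fderiv ℝ φ x (y - x)| ≤ C * ‖y - x‖ ^ 2 := by
  have h := (hB.inter (convex_closedBall x ‖y - x‖)).norm_image_sub_le_of_norm_hasFDerivWithin_le'
    (f := φ) (f' := fderiv ℝ φ) (φ := fderiv ℝ φ x) (C := C * ‖y - x‖) (x := x) (y := y)
    (fun z hz => (hd z hz.1).hasFDerivAt.hasFDerivWithinAt)
    (fun z hz => (hL z hz.1).trans (by
      have := hz.2
      rw [mem_closedBall_iff_norm] at this
      gcongr))
    ⟨hx, by simp⟩ ⟨hy, by simp [dist_eq_norm]⟩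
  rw [Real.norm_eq_abs] at h
  calc _ ≤ _ := h
    _ = _ := by ring

/-- The first order terms at `z` and `-z` cancel, leaving two quadratic remainders. This is the
bound that makes second differences integrable against the singular kernel. -/
theorem exists_abs_secondDiff_le {E : Type*} [NormedAddCommGroup E] [NormedSpace ℝ E]
    {φ : E → ℝ} {x : E} (h : ContDiffAt ℝ 2 φ x) :
    ∃ C : ℝ, 0 ≤ C ∧ ∃ r : ℝ, 0 < r ∧ ∀ z, ‖z‖ < r →
      |φ (x + z) + φ (x - z) - 2 * φ x| ≤ C * ‖z‖ ^ 2 := by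
  have h1 : ContDiffAt ℝ 1 (fderiv ℝ φ) x := h.fderiv_right (m := 1) (by norm_num)
  obtain ⟨K, t, ht, hK⟩ := h1.exists_lipschitzOnWith
  have h2 : ∀ᶠ y in 𝓝 x, ContDiffAt ℝ 2 φ y := h.eventually (by simp)
  obtain ⟨r, hr, hrt⟩ := Metric.mem_nhds_iff.1 (inter_mem ht h2)
  refine ⟨2 * K, by positivity, r, hr, fun z hz => ?_⟩
  have key : ∀ w : E, ‖w‖ < r → |φ (x + w) - φ x - fderiv ℝ φ x w| ≤ K * ‖w‖ ^ 2 := by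
    intro w hw
    have := abs_sub_fderiv_le_of_lipschitzOn (φ := φ) (convex_ball x r) (C := K)
      (fun y hy => ContDiffAt.differentiableAt (n := 2) (hrt hy).2 (by norm_num))
      (Metric.mem_ball_self hr)
      (fun y hy => by
        have := hK.dist_le_mul y (hrt hy).1 x (hrt (Metric.mem_ball_self hr)).1
        rwa [dist_eq_norm, dist_eq_norm] at this)
      (y := x + w) (by simpa using hw) (by positivity)
    simpa using this
  have a := key z hz
  have b := key (-z) (by simpa using hz)
  rw [norm_neg, map_neg, ← sub_eq_add_neg] at b
  rw [abs_le] at a b ⊢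
  constructor <;> linarith [a.1, a.2, b.1, b.2]

/-! ### The one-dimensional operator on powers -/

/-- The power `t ↦ t_+^σ`, with value `0` for `t ≤ 0` whatever the exponent. -/
def posRpow (σ t : ℝ) : ℝ := if 0 < t then t ^ σ else 0

theorem posRpow_of_pos {σ t : ℝ} (ht : 0 < t) : posRpow σ t = t ^ σ := if_pos ht

theorem posRpow_of_nonpos {σ t : ℝ} (ht : t ≤ 0) : posRpow σ t = 0 := if_neg ht.not_gt

theorem posRpow_nonneg (σ t : ℝ) : 0 ≤ posRpow σ t := by
  unfold posRpow; split_ifs with h <;> positivity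

theorem measurable_posRpow (σ : ℝ) : Measurable (posRpow σ) :=
  Measurable.ite measurableSet_Ioi (by fun_prop) measurable_const

/-- The second difference at distance `r` of `t ↦ t_+^σ` at `t = 1`. -/
def rpowSecondDiff (σ r : ℝ) : ℝ := posRpow σ (1 + r) + posRpow σ (1 - r) - 2

theorem measurable_rpowSecondDiff (σ : ℝ) : Measurable (rpowSecondDiff σ) := by
  unfold rpowSecondDiff
  have := measurable_posRpow σ
  fun_prop

theorem rpowSecondDiff_zero (σ : ℝ) : rpowSecondDiff σ 0 = 0 := by
  simp [rpowSecondDiff, posRpow]; norm_num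

theorem rpowSecondDiff_of_pos {σ r : ℝ} (hr : 0 ≤ r) :
    rpowSecondDiff σ r = (1 + r) ^ σ + posRpow σ (1 - r) - 2 := by
  rw [rpowSecondDiff, posRpow_of_pos (by linarith)]

theorem integrableOn_one_add_rpow_mul {s σ ε : ℝ} (hs : 0 < s) (hσ : σ ≤ 0) (hε : 0 < ε) :
    IntegrableOn (fun r => (1 + r) ^ σ * r ^ (-1 - 2 * s)) (Ioi ε) := by
  refine (integrableOn_Ioi_rpow_of_lt (a := -1 - 2 * s) (by linarith) hε).mono'
    (by fun_prop) ?_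
  filter_upwards [ae_restrict_mem measurableSet_Ioi] with r hr
  have hr : 0 < r := hε.trans hr
  rw [Real.norm_of_nonneg (by positivity)]
  exact mul_le_of_le_one_left (by positivity)
    (Real.rpow_le_one_of_one_le_of_nonpos (by linarith) hσ)

theorem integrableOn_posRpow_one_sub_mul {s σ ε : ℝ} (hσ : -1 < σ) (hε : 0 < ε) :
    IntegrableOn (fun r => posRpow σ (1 - r) * r ^ (-1 - 2 * s)) (Ioi ε) := by
  have h1 : IntegrableOn (fun r : ℝ => (1 - r) ^ σ) (Icc ε (max 1 ε)) := by
    have := (intervalIntegral.intervalIntegrable_rpow' (a := 1 - ε) (b := 1 - (max 1 ε)) hσ).comp_sub_left 1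
    simp only [sub_sub_cancel] at this
    rwa [intervalIntegrable_iff_integrableOn_Icc_of_le (le_max_right _ _)] at this
  have h2 : IntegrableOn (fun r : ℝ => (1 - r) ^ σ * r ^ (-1 - 2 * s)) (Icc ε (max 1 ε)) :=
    h1.mul_continuousOn (fun r hr => ContinuousAt.continuousWithinAt
      (Real.continuousAt_rpow_const _ _ (Or.inl (hε.trans_le hr.1).ne'))) isCompact_Icc
  have h3 : IntegrableOn (fun r => posRpow σ (1 - r) * r ^ (-1 - 2 * s)) (Icc ε (max 1 ε)) := by
    refine Integrable.mono h2 ?_ (Eventually.of_forall fun r => ?_)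
    · have := measurable_posRpow σ
      fun_prop
    · rw [norm_mul, norm_mul]
      gcongr
      unfold posRpow
      split_ifs <;> simp
  refine h3.of_forall_sdiff_eq_zero measurableSet_Ioi fun r hr => ?_
  have : 1 < r := by
    by_contra hh
    exact hr.2 ⟨(mem_Ioi.1 hr.1).le, (not_lt.1 hh).trans (le_max_left _ _)⟩
  rw [posRpow_of_nonpos (by linarith), zero_mul]

/-- The substitution `r = q / (1 - q)` keeps the factor `r ^ (-1 - 2 * s)` up to powers of `1 - q`
and folds the half-line onto the unit interval. It turns the exponent `σ` into its dual `2 * s - 1 -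
σ`, so both halves of the second difference become powers of `1 - q`. -/
theorem integral_one_add_rpow_mul {s σ ε : ℝ} (hε : 0 < ε) :
    ∫ r in Ioi ε, (1 + r) ^ σ * r ^ (-1 - 2 * s) =
      ∫ q in Ioi (ε / (1 + ε)), posRpow (2 * s - 1 - σ) (1 - q) * q ^ (-1 - 2 * s) := by
  have himg : (fun q : ℝ => q / (1 - q)) '' Ioo (ε / (1 + ε)) 1 = Ioi ε := by
    ext r
    constructor
    · rintro ⟨q, ⟨h1, h2⟩, rfl⟩
      have : 0 < 1 - q := by linarith
      rw [div_lt_iff₀ (by positivity)] at h1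
      rw [mem_Ioi, lt_div_iff₀ this]
      nlinarith
    · intro hr
      have hr0 : ε < r := hr
      have : 0 < 1 + r := by linarith
      refine ⟨r / (1 + r), ⟨?_, ?_⟩, ?_⟩
      · rw [div_lt_div_iff₀ (by positivity) this]; nlinarith
      · rw [div_lt_one this]; linarith
      · simp only; field_simp; ring
  rw [← himg, integral_image_eq_integral_abs_deriv_smul (f' := fun q => 1 / (1 - q) ^ 2)
    measurableSet_Ioo]
  · have hsub : Ioo (ε / (1 + ε)) 1 ⊆ Ioi (ε / (1 + ε)) := fun x hx => hx.1
    rw [setIntegral_eq_of_subset_of_forall_sdiff_eq_zero (t := Ioi (ε / (1 + ε)))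
      measurableSet_Ioi hsub]
    · refine setIntegral_congr_fun measurableSet_Ioo fun q hq => ?_
      have hq0 : 0 < q := lt_trans (by positivity) hq.1
      have h1 : 0 < 1 - q := by linarith [hq.2]
      simp only [smul_eq_mul]
      rw [posRpow_of_pos h1, abs_of_nonneg (by positivity),
        show 1 + q / (1 - q) = (1 - q)⁻¹ by field_simp; ring,
        Real.div_rpow hq0.le h1.le, Real.inv_rpow h1.le, ← Real.rpow_neg h1.le,
        div_eq_mul_inv _ ((1 - q) ^ (-1 - 2 * s)), ← Real.rpow_neg h1.le, one_div,
        ← Real.rpow_natCast, ← Real.rpow_neg h1.le]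
      rw [show (1 - q) ^ (-((2:ℕ):ℝ)) * ((1 - q) ^ (-σ) * (q ^ (-1 - 2 * s) * (1 - q) ^ (-(-1 - 2 * s))))
        = ((1 - q) ^ (-((2:ℕ):ℝ)) * (1 - q) ^ (-σ) * (1 - q) ^ (-(-1 - 2 * s))) * q ^ (-1 - 2 * s) by ring,
        ← Real.rpow_add h1, ← Real.rpow_add h1]
      congr 2
      push_cast; ring
    · intro q hq
      have : 1 ≤ q := by
        by_contra hh
        exact hq.2 ⟨hq.1, not_le.1 hh⟩
      rw [posRpow_of_nonpos (by linarith), zero_mul]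
  · intro q hq
    have h1 : 1 - q ≠ 0 := by linarith [hq.2]
    have := (hasDerivAt_id q).div ((hasDerivAt_id q).const_sub 1) h1
    refine (this.congr_deriv ?_).hasDerivWithinAt
    simp
  · intro a ha b hb hab
    have h1 : 1 - a ≠ 0 := by linarith [ha.2]
    have h2 : 1 - b ≠ 0 := by linarith [hb.2]
    have hab : a / (1 - a) = b / (1 - b) := hab
    rw [div_eq_div_iff h1 h2] at hab
    linarith

/-- The exponents `s - 1` and `s` form a dual pair whose sum is an exact derivative: the integrand
on `(ε, 1)` is the derivative of `-(1 / s) * (1 - r) ^ s * r ^ (-2 * s)`. This is the explicit case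
with which the other exponents are compared. -/
theorem integral_posRpow_one_sub_add {s ε : ℝ} (hs : 0 < s) (hε : 0 < ε) (hε1 : ε < 1) :
    ∫ r in Ioi ε, (posRpow (s - 1) (1 - r) + posRpow s (1 - r)) * r ^ (-1 - 2 * s) =
      (1 / s) * ((1 - ε) ^ s * ε ^ (-2 * s)) := by
  have hi : IntegrableOn (fun r => (posRpow (s - 1) (1 - r) + posRpow s (1 - r)) * r ^ (-1 - 2 * s))
      (Ioi ε) := by
    simp_rw [add_mul]
    exact (integrableOn_posRpow_one_sub_mul (by linarith) hε).add
      (integrableOn_posRpow_one_sub_mul (by linarith) hε)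
  rw [setIntegral_eq_of_subset_of_forall_sdiff_eq_zero (s := Ioc ε 1) (t := Ioi ε)
    measurableSet_Ioi (fun x hx => hx.1), ← intervalIntegral.integral_of_le hε1.le,
    intervalIntegral.integral_eq_sub_of_hasDerivAt_of_le hε1.le
    (f := fun r => -(1 / s) * ((1 - r) ^ s * r ^ (-2 * s)))]
  · simp [Real.zero_rpow hs.ne']
  · refine ContinuousOn.mul continuousOn_const (ContinuousOn.mul ?_ ?_)
    · exact (Continuous.rpow_const (by fun_prop) fun _ => Or.inr hs.le).continuousOn
    · exact fun r hr => (Real.continuousAt_rpow_const _ _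
        (Or.inl (hε.trans_le hr.1).ne')).continuousWithinAt
  · intro r hr
    have hr0 : 0 < r := hε.trans hr.1
    have h1 : 0 < 1 - r := by linarith [hr.2]
    have d1 : HasDerivAt (fun r : ℝ => (1 - r) ^ s) (-1 * s * (1 - r) ^ (s - 1)) r :=
      ((hasDerivAt_id r).const_sub 1).rpow_const (Or.inl h1.ne')
    have d2 := (Real.hasDerivAt_rpow_const (x := r) (p := -2 * s) (Or.inl hr0.ne'))
    refine ((d1.mul d2).const_mul (-(1 / s))).congr_deriv ?_
    rw [posRpow_of_pos h1, posRpow_of_pos h1]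
    have e1 : (1 - r) ^ s = (1 - r) ^ (s - 1) * (1 - r) := by
      rw [← Real.rpow_add_one h1.ne']; congr 1; ring
    have e2 : r ^ (-2 * s) = r ^ (-1 - 2 * s) * r := by
      rw [← Real.rpow_add_one hr0.ne']; congr 1; ring
    have e3 : r ^ (-2 * s - 1) = r ^ (-1 - 2 * s) := by congr 1; ring
    rw [e1, e2, e3]
    field_simp
    ring
  · rw [intervalIntegrable_iff_integrableOn_Ioc_of_le hε1.le]
    exact hi.mono_set fun x hx => hx.1
  · intro r hr
    have : 1 < r := by
      by_contra hh
      exact hr.2 ⟨hr.1, not_lt.1 hh⟩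
    rw [posRpow_of_nonpos (by linarith), posRpow_of_nonpos (by linarith), add_zero, zero_mul]

/-- The gap between the powers of exponents `s - 1`, `s` and those of intermediate exponents. -/
def rpowGap (s η t : ℝ) : ℝ :=
  posRpow (s - 1) t + posRpow s t - posRpow (s - 1 + η) t - posRpow (s - η) t

/-- Two pairs of exponents with the same sum are compared. The product form shows that on `(0, 1)`
the outer pair is larger, as convexity in the exponent predicts. -/
theorem rpowGap_eq {s η t : ℝ} (ht : 0 < t) :
    rpowGap s η t = (t ^ (s - 1) - t ^ (s - η)) * (1 - t ^ η) := by
  have e1 : t ^ (s - 1 + η) = t ^ (s - 1) * t ^ η := Real.rpow_add ht _ _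
  have e2 : t ^ s = t ^ (s - η) * t ^ η := by rw [← Real.rpow_add ht]; congr 1; ring
  simp only [rpowGap, posRpow_of_pos ht]
  rw [e1, e2]; ring

theorem rpowGap_nonneg {s η t : ℝ} (h0 : 0 ≤ η) (h1 : η ≤ 1) (ht : t ≤ 1) : 0 ≤ rpowGap s η t := by
  rcases le_or_gt t 0 with h | h
  · simp [rpowGap, posRpow_of_nonpos h]
  · rw [rpowGap_eq h]
    refine mul_nonneg (sub_nonneg.2 ?_) (sub_nonneg.2 (Real.rpow_le_one h.le ht h0))
    exact Real.rpow_le_rpow_of_exponent_ge h ht (by linarith)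

theorem rpowGap_pos {s η t : ℝ} (h0 : 0 < η) (h1 : η < 1) (h : 0 < t) (ht : t < 1) :
    0 < rpowGap s η t := by
  rw [rpowGap_eq h]
  refine mul_pos (sub_pos.2 ?_) (sub_pos.2 (Real.rpow_lt_one h.le ht h0))
  exact Real.rpow_lt_rpow_of_exponent_gt h ht (by linarith)

theorem integrableOn_rpowGap {s η ε : ℝ} (hs : 0 < s) (h0 : 0 ≤ η) (h1 : η < s) (hε : 0 < ε) :
    IntegrableOn (fun r => rpowGap s η (1 - r) * r ^ (-1 - 2 * s)) (Ioi ε) := by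
  have h : ∀ σ : ℝ, -1 < σ → _ := fun σ hσ =>
    integrableOn_posRpow_one_sub_mul (s := s) (σ := σ) hσ hε
  simp only [rpowGap, sub_mul, add_mul]
  exact (((h _ (by linarith)).add (h _ (by linarith))).sub (h _ (by linarith))).sub
    (h _ (by linarith))

theorem integrableOn_rpowSecondDiff_mul_Ioi {s σ ε : ℝ} (hs : 0 < s) (hσ : -1 < σ) (hσ0 : σ ≤ 0)
    (hε : 0 < ε) : IntegrableOn (fun r => rpowSecondDiff σ r * r ^ (-1 - 2 * s)) (Ioi ε) := by
  have h := ((integrableOn_one_add_rpow_mul hs hσ0 hε).add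
    (integrableOn_posRpow_one_sub_mul (s := s) hσ hε)).sub
    ((integrableOn_Ioi_rpow_of_lt (a := -1 - 2 * s) (by linarith) hε).const_mul 2)
  refine h.congr_fun (fun r hr => ?_) measurableSet_Ioi
  simp only [Pi.sub_apply, Pi.add_apply]
  rw [rpowSecondDiff_of_pos (hε.trans hr).le]
  ring

theorem integrableOn_rpowSecondDiff_mul {s σ : ℝ} (hs : 0 < s) (hs1 : s < 1) (hσ : -1 < σ)
    (hσ0 : σ ≤ 0) : IntegrableOn (fun r => rpowSecondDiff σ r * r ^ (-1 - 2 * s)) (Ioi 0) := by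
  obtain ⟨C, hC, r₀, hr₀, h⟩ := exists_abs_secondDiff_le (φ := fun t : ℝ => t ^ σ) (x := 1)
    (Real.contDiffAt_rpow_const_of_ne one_ne_zero)
  set ρ := min (r₀ / 2) (1 / 2)
  have hρ : 0 < ρ := by positivity
  have hρ0 : ρ < r₀ := (min_le_left _ _).trans_lt (by linarith)
  have hρ1 : ρ < 1 := (min_le_right _ _).trans_lt (by norm_num)
  rw [← Ioc_union_Ioi_eq_Ioi hρ.le]
  refine IntegrableOn.union ?_ (integrableOn_rpowSecondDiff_mul_Ioi hs hσ hσ0 hρ)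
  have hI : IntegrableOn (fun r : ℝ => C * r ^ (1 - 2 * s)) (Ioc 0 ρ) := by
    have := (intervalIntegral.intervalIntegrable_rpow' (r := 1 - 2 * s) (a := 0) (b := ρ)
      (by linarith)).const_mul C
    rwa [intervalIntegrable_iff_integrableOn_Ioc_of_le hρ.le] at this
  refine hI.mono' ?_ ?_
  · have := measurable_rpowSecondDiff σ
    fun_prop
  · filter_upwards [ae_restrict_mem measurableSet_Ioc] with r hr
    have hr1 : r < 1 := hr.2.trans_lt hρ1
    have := h r (by rw [Real.norm_of_nonneg hr.1.le]; exact hr.2.trans_lt hρ0)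
    rw [rpowSecondDiff, posRpow_of_pos (by linarith [hr.1]), posRpow_of_pos (by linarith), norm_mul,
      Real.norm_of_nonneg (Real.rpow_nonneg hr.1.le _), Real.norm_eq_abs]
    rw [Real.one_rpow, mul_one, Real.norm_of_nonneg hr.1.le] at this
    calc _ ≤ C * r ^ 2 * r ^ (-1 - 2 * s) := by
          gcongr
          exact Real.rpow_nonneg hr.1.le _
      _ = _ := by
          rw [mul_assoc, ← Real.rpow_natCast, ← Real.rpow_add hr.1]
          congr 2; push_cast; ring

/-- After folding, the two powers have exponents `s - 1 + η` and `s - η`, hence equal the explicit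
pair `s - 1`, `s` minus the gap. Folding moves the cutoff from `ε` to `ε / (1 + ε)`; the extra piece
is bounded by replacing the power of `1 - q` by `1`. The terms of order `ε ^ (-2 * s)` and `ε ^ (1 -
2 * s)` cancel, so that the excess tends to zero with `ε`. -/
theorem integral_rpowSecondDiff_Ioi_le {s η ε : ℝ} (hs : 0 < s) (hs1 : s < 1) (h0 : 0 ≤ η)
    (h1 : η < s) (h2 : η < 1 - s) (hε : 0 < ε) (hε1 : ε < 1) :
    ∫ r in Ioi ε, rpowSecondDiff (s - 1 + η) r * r ^ (-1 - 2 * s) ≤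
      s / 2 * ε ^ (2 - 2 * s) - ∫ r in Ioi ε, rpowGap s η (1 - r) * r ^ (-1 - 2 * s) := by
  set σ := s - 1 + η with hσ
  have hσ0 : σ ≤ 0 := by linarith
  have hσ1 : -1 < σ := by linarith
  set ε' := ε / (1 + ε) with hε'
  have hε'0 : 0 < ε' := by positivity
  have hε'ε : ε' ≤ ε := div_le_self hε.le (by linarith)
  have hA := integrableOn_one_add_rpow_mul hs hσ0 hε
  have hB := integrableOn_posRpow_one_sub_mul (s := s) hσ1 hε
  have hC := integrableOn_Ioi_rpow_of_lt (a := -1 - 2 * s) (by linarith) hε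
  have hE := integrableOn_posRpow_one_sub_mul (s := s) (σ := s - η) (by linarith) hε'0
  have hEε := integrableOn_posRpow_one_sub_mul (s := s) (σ := s - η) (by linarith) hε
  have hD := integrableOn_rpowGap hs h0 h1 hε
  have e1 : ∫ r in Ioi ε, rpowSecondDiff σ r * r ^ (-1 - 2 * s) =
      (∫ r in Ioi ε, (1 + r) ^ σ * r ^ (-1 - 2 * s)) +
      (∫ r in Ioi ε, posRpow σ (1 - r) * r ^ (-1 - 2 * s)) -
      2 * ∫ r in Ioi ε, r ^ (-1 - 2 * s) := by
    rw [← integral_const_mul, ← integral_add hA hB, ← integral_sub ?_ (hC.const_mul 2)]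
    swap
    · exact hA.add hB
    refine setIntegral_congr_fun measurableSet_Ioi fun r hr => ?_
    rw [rpowSecondDiff_of_pos (hε.trans hr).le]
    ring
  have e2 : ∫ r in Ioi ε, (1 + r) ^ σ * r ^ (-1 - 2 * s) =
      (∫ q in Ioc ε' ε, posRpow (s - η) (1 - q) * q ^ (-1 - 2 * s)) +
      ∫ q in Ioi ε, posRpow (s - η) (1 - q) * q ^ (-1 - 2 * s) := by
    rw [integral_one_add_rpow_mul hε, ← setIntegral_union (Ioc_disjoint_Ioi le_rfl)
      measurableSet_Ioi (hE.mono_set fun x hx => hx.1) hEε, Ioc_union_Ioi_eq_Ioi hε'ε]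
    rw [show 2 * s - 1 - σ = s - η by rw [hσ]; ring]
  have e3 : ∫ q in Ioc ε' ε, posRpow (s - η) (1 - q) * q ^ (-1 - 2 * s) ≤
      ((1 + ε) ^ (2 * s) - 1) * ε ^ (-2 * s) / (2 * s) := by
    have hi : IntegrableOn (fun q : ℝ => q ^ (-1 - 2 * s)) (Ioc ε' ε) :=
      (integrableOn_Ioi_rpow_of_lt (a := -1 - 2 * s) (by linarith) hε'0).mono_set fun x hx => hx.1
    calc _ ≤ ∫ q in Ioc ε' ε, q ^ (-1 - 2 * s) := by
          refine setIntegral_mono_on (hE.mono_set fun x hx => hx.1) hi measurableSet_Ioc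
            fun q hq => ?_
          have hq0 : 0 < q := hε'0.trans hq.1
          have : posRpow (s - η) (1 - q) ≤ 1 := by
            rw [posRpow_of_pos (by linarith [hq.2])]
            exact Real.rpow_le_one (by linarith [hq.2]) (by linarith) (by linarith)
          exact mul_le_of_le_one_left (by positivity) this
      _ = (ε' ^ (-2 * s) - ε ^ (-2 * s)) / (2 * s) := by
          rw [← intervalIntegral.integral_of_le hε'ε, integral_rpow]
          · rw [show -1 - 2 * s + 1 = -2 * s by ring]
            field_simp
            ring
          · right
            refine ⟨by linarith, ?_⟩
            rw [uIcc_of_le hε'ε]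
            exact fun h => absurd h.1 (by linarith)
      _ = _ := by
          rw [hε', Real.div_rpow hε.le (by linarith), show -2 * s = -(2 * s) by ring,
            Real.rpow_neg (by linarith : 0 ≤ 1 + ε), div_inv_eq_mul]
          ring
  have e4 := integral_Ioi_rpow_of_lt (a := -1 - 2 * s) (by linarith) hε
  rw [show -1 - 2 * s + 1 = -2 * s by ring] at e4
  have e5 : (∫ r in Ioi ε, posRpow σ (1 - r) * r ^ (-1 - 2 * s)) +
      (∫ q in Ioi ε, posRpow (s - η) (1 - q) * q ^ (-1 - 2 * s)) =
      (1 / s) * ((1 - ε) ^ s * ε ^ (-2 * s)) -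
        ∫ r in Ioi ε, rpowGap s η (1 - r) * r ^ (-1 - 2 * s) := by
    have hi : IntegrableOn
        (fun r => (posRpow (s - 1) (1 - r) + posRpow s (1 - r)) * r ^ (-1 - 2 * s)) (Ioi ε) := by
      simp_rw [add_mul]
      exact (integrableOn_posRpow_one_sub_mul (by linarith) hε).add
        (integrableOn_posRpow_one_sub_mul (by linarith) hε)
    rw [← integral_posRpow_one_sub_add hs hε hε1, ← integral_add hB hEε, ← integral_sub hi hD]
    congr 1
    ext r
    simp only [rpowGap, ← hσ]
    ring
  have hp : 0 < ε ^ (-2 * s) := by positivity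
  have b1 : (1 - ε) ^ s ≤ 1 - s * ε := by
    have := rpow_one_add_le_one_add_mul_self (s := -ε) (p := s) (by linarith) hs.le hs1.le
    rw [← sub_eq_add_neg] at this
    linarith
  have b2 : (1 + ε) ^ (2 * s) ≤ (1 + s * ε) ^ 2 := by
    have := rpow_one_add_le_one_add_mul_self (s := ε) (p := s) (by linarith) hs.le hs1.le
    rw [mul_comm, Real.rpow_mul (by linarith), Real.rpow_two]
    gcongr
  have b3 : ε ^ (2 - 2 * s) = ε ^ 2 * ε ^ (-2 * s) := by
    rw [← Real.rpow_natCast, ← Real.rpow_add hε]; congr 1; push_cast; ring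
  rw [e1, e2, e4, b3]
  -- By the Bernoulli bounds `b1` and `b2` the bracket is at most `-s ε + (s ε + s² ε² / 2)`, which
  -- leaves only the quadratic term.
  have b4 : (1 / s) * ((1 - ε) ^ s * ε ^ (-2 * s)) +
      ((1 + ε) ^ (2 * s) - 1) * ε ^ (-2 * s) / (2 * s) - 2 * (-ε ^ (-2 * s) / (-2 * s)) ≤
      s / 2 * (ε ^ 2 * ε ^ (-2 * s)) := by
    have : (1 / s) * ((1 - ε) ^ s * ε ^ (-2 * s)) +
      ((1 + ε) ^ (2 * s) - 1) * ε ^ (-2 * s) / (2 * s) - 2 * (-ε ^ (-2 * s) / (-2 * s)) =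
      (ε ^ (-2 * s) / s) * ((1 - ε) ^ s + ((1 + ε) ^ (2 * s) - 1) / 2 - 1) := by
      field_simp
    rw [this]
    calc _ ≤ (ε ^ (-2 * s) / s) * ((1 - s * ε) + ((1 + s * ε) ^ 2 - 1) / 2 - 1) := by
          gcongr
      _ = _ := by field_simp; ring
  linarith

/-- The one-dimensional fractional Laplacian of `t ↦ t_+^σ` at `t = 1`, up to a factor. -/
def rpowConst (s σ : ℝ) : ℝ := ∫ r in Ioi (0 : ℝ), rpowSecondDiff σ r * r ^ (-1 - 2 * s)

/-- Let the cutoff tend to zero. Since the gap is nonnegative, its integral may be frozen at a fixed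
`δ`, which avoids discussing its integrability at the origin. -/
theorem rpowConst_le_of_gap {s η : ℝ} (hs : 0 < s) (hs1 : s < 1) (h0 : 0 ≤ η)
    (h1 : η < s) (h2 : η < 1 - s) {δ : ℝ} (hδ : 0 < δ) (hδ1 : δ < 1) :
    rpowConst s (s - 1 + η) ≤ -∫ r in Ioi δ, rpowGap s η (1 - r) * r ^ (-1 - 2 * s) := by
  have hlim : Tendsto (fun ε : ℝ => ε) (𝓝[>] 0) (𝓝 0) := tendsto_id.mono_left nhdsWithin_le_nhds
  have hint := integrableOn_rpowSecondDiff_mul (s := s) (σ := s - 1 + η) hs hs1 (by linarith)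
    (by linarith)
  have hT := (aecover_Ioi_of_Ioi (μ := volume) hlim).integral_tendsto_of_countably_generated hint
  have hev : ∀ᶠ ε in 𝓝[>] (0 : ℝ), ε ∈ Ioo 0 δ := Ioo_mem_nhdsGT hδ
  have hT2 : Tendsto (fun ε : ℝ => s / 2 * ε ^ (2 - 2 * s) -
      ∫ r in Ioi δ, rpowGap s η (1 - r) * r ^ (-1 - 2 * s)) (𝓝[>] 0)
      (𝓝 (s / 2 * 0 ^ (2 - 2 * s) - ∫ r in Ioi δ, rpowGap s η (1 - r) * r ^ (-1 - 2 * s))) := by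
    refine Tendsto.sub_const (Tendsto.const_mul _ ?_) _
    exact ((Real.continuousAt_rpow_const 0 (2 - 2 * s) (Or.inr (by linarith))).tendsto).comp hlim
  rw [Real.zero_rpow (by linarith), mul_zero, zero_sub] at hT2
  refine le_of_tendsto_of_tendsto hT hT2 ?_
  filter_upwards [hev] with ε hε
  rw [Measure.restrict_restrict measurableSet_Ioi, Ioi_inter_Ioi, max_eq_left hε.1.le]
  refine (integral_rpowSecondDiff_Ioi_le hs hs1 h0 h1 h2 hε.1 (hε.2.trans hδ1)).trans ?_
  gcongr 1
  refine setIntegral_mono_set (integrableOn_rpowGap hs h0 h1 hε.1) ?_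
    (Ioi_subset_Ioi hε.2.le).eventuallyLE
  filter_upwards [ae_restrict_mem measurableSet_Ioi] with r hr
  have : 0 < r := hε.1.trans hr
  exact mul_nonneg (rpowGap_nonneg h0 (by linarith) (by linarith)) (by positivity)

/-- For `η = 0` the two pairs of exponents coincide and the gap vanishes identically. -/
theorem rpowConst_nonpos {s : ℝ} (hs : 0 < s) (hs1 : s < 1) : rpowConst s (s - 1) ≤ 0 := by
  have := rpowConst_le_of_gap (η := 0) hs hs1 le_rfl hs (by linarith)
    (δ := 1 / 2) (by norm_num) (by norm_num)
  simp only [add_zero, rpowGap, sub_zero] at this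
  simpa using this

theorem rpowConst_neg {s η : ℝ} (hs : 0 < s) (hs1 : s < 1) (h0 : 0 < η)
    (h1 : η < s) (h2 : η < 1 - s) : rpowConst s (s - 1 + η) < 0 := by
  refine (rpowConst_le_of_gap hs hs1 h0.le h1 h2 (δ := 1 / 2) (by norm_num)
    (by norm_num)).trans_lt ?_
  rw [neg_lt_zero, setIntegral_pos_iff_support_of_nonneg_ae]
  · have : Ioo (1 / 2 : ℝ) 1 ⊆ Function.support (fun r => rpowGap s η (1 - r) * r ^ (-1 - 2 * s)) ∩
        Ioi (1 / 2) := by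
      intro r hr
      have hr0 : 0 < r := lt_trans (by norm_num) hr.1
      refine ⟨(mul_pos (rpowGap_pos h0 (by linarith) (by linarith [hr.2]) (by linarith))
        (by positivity)).ne', hr.1⟩
    refine lt_of_lt_of_le ?_ (measure_mono this)
    rw [Real.volume_Ioo]; norm_num
  · filter_upwards [ae_restrict_mem measurableSet_Ioi] with r hr
    have : 0 < r := lt_trans (by norm_num) (mem_Ioi.1 hr)
    exact mul_nonneg (rpowGap_nonneg h0.le (by linarith) (by linarith)) (by positivity)
  · exact integrableOn_rpowGap hs h0.le h1 (by norm_num)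

/-! ### Polar coordinates and homogeneous kernels -/

open Measure in
theorem integrable_iff_integrable_polar {E : Type*} [NormedAddCommGroup E] [NormedSpace ℝ E]
    [MeasurableSpace E] [BorelSpace E] [FiniteDimensional ℝ E] [Nontrivial E] (μ : Measure E)
    [μ.IsAddHaarMeasure] (f : E → ℝ) :
    Integrable f μ ↔ Integrable
      (fun q : Metric.sphere (0 : E) 1 × Ioi (0 : ℝ) => f (q.2.1 • q.1.1))
      (μ.toSphere.prod (volumeIoiPow (Module.finrank ℝ E - 1))) := by
  have := μ.measurePreserving_homeomorphUnitSphereProd.integrable_comp_emb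
    (g := fun q : Metric.sphere (0 : E) 1 × Ioi (0 : ℝ) => f (q.2.1 • q.1.1))
    (Homeomorph.measurableEmbedding _)
  have h0 : Integrable f μ ↔ IntegrableOn f {0}ᶜ μ := by
    rw [IntegrableOn, restrict_compl_singleton]
  rw [← this, h0, integrableOn_iff_comap_subtypeVal (by measurability)]
  refine integrable_congr (.of_forall fun x => ?_)
  have hx : ‖(x : E)‖ ≠ 0 := norm_ne_zero_iff.2 x.2
  simp [smul_smul, hx]

open Measure in
theorem integral_eq_integral_polar {E : Type*} [NormedAddCommGroup E] [NormedSpace ℝ E]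
    [MeasurableSpace E] [BorelSpace E] [FiniteDimensional ℝ E] [Nontrivial E] (μ : Measure E)
    [μ.IsAddHaarMeasure] (f : E → ℝ) :
    ∫ x, f x ∂μ = ∫ q : Metric.sphere (0 : E) 1 × Ioi (0 : ℝ), f (q.2.1 • q.1.1)
      ∂(μ.toSphere.prod (volumeIoiPow (Module.finrank ℝ E - 1))) := by
  have := μ.measurePreserving_homeomorphUnitSphereProd.integral_comp
    (Homeomorph.measurableEmbedding _)
    (fun q : Metric.sphere (0 : E) 1 × Ioi (0 : ℝ) => f (q.2.1 • q.1.1))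
  rw [← this]
  calc _ = ∫ x : ({(0 : E)}ᶜ : Set E), f x ∂(μ.comap (↑)) := by
        rw [integral_subtype_comap (measurableSet_singleton _).compl, restrict_compl_singleton]
    _ = _ := by
        refine integral_congr_ae (.of_forall fun x => ?_)
        have hx : ‖(x : E)‖ ≠ 0 := norm_ne_zero_iff.2 x.2
        simp [smul_smul, hx]

theorem integrable_volumeIoiPow_iff (n : ℕ) (h : ℝ → ℝ) :
    Integrable (fun r : Ioi (0 : ℝ) => h r) (Measure.volumeIoiPow n) ↔
      IntegrableOn (fun r => r ^ n * h r) (Ioi 0) := by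
  rw [integrableOn_iff_comap_subtypeVal measurableSet_Ioi, Measure.volumeIoiPow,
    integrable_withDensity_iff_integrable_smul' (by fun_prop) (by simp)]
  refine integrable_congr (.of_forall ?_)
  rintro ⟨x, hx : 0 < x⟩
  simp (disch := positivity) [ENNReal.toReal_ofReal]

theorem integral_volumeIoiPow (n : ℕ) (h : ℝ → ℝ) :
    ∫ r : Ioi (0 : ℝ), h r ∂(Measure.volumeIoiPow n) = ∫ r in Ioi (0 : ℝ), r ^ n * h r := by
  simp only [Measure.volumeIoiPow, ENNReal.ofReal]
  rw [integral_withDensity_eq_integral_smul,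
    integral_subtype_comap measurableSet_Ioi fun a ↦ Real.toNNReal (a ^ n) • h a,
    setIntegral_congr_fun measurableSet_Ioi fun x hx ↦ ?_]
  · simp only [NNReal.smul_def, Real.coe_toNNReal _ (pow_nonneg (le_of_lt hx) _), smul_eq_mul]
  · exact (measurable_subtype_coe.pow_const _).real_toNNReal

theorem integrableOn_comp_mul_rpow {G : ℝ → ℝ} {s : ℝ}
    (hG : IntegrableOn (fun r => G r * r ^ (-1 - 2 * s)) (Ioi 0)) {c : ℝ} (hc : 0 < c) :
    IntegrableOn (fun r => G (c * r) * r ^ (-1 - 2 * s)) (Ioi 0) := by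
  have h := (integrableOn_Ioi_comp_mul_left_iff (fun r => G r * r ^ (-1 - 2 * s)) 0 hc).2
    (by simpa using hG)
  refine IntegrableOn.congr_fun (h.const_mul (c ^ (1 + 2 * s))) (fun r hr => ?_) measurableSet_Ioi
  have hr : 0 < r := hr
  rw [Real.mul_rpow hc.le hr.le, show c ^ (1 + 2 * s) * (G (c * r) * (c ^ (-1 - 2 * s) *
    r ^ (-1 - 2 * s))) = (c ^ (1 + 2 * s) * c ^ (-1 - 2 * s)) * (G (c * r) * r ^ (-1 - 2 * s)) by ring,
    ← Real.rpow_add hc]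
  norm_num

theorem integral_comp_mul_rpow (G : ℝ → ℝ) (s : ℝ) {c : ℝ} (hc : 0 < c) :
    ∫ r in Ioi (0 : ℝ), G (c * r) * r ^ (-1 - 2 * s) =
      c ^ (2 * s) * ∫ r in Ioi (0 : ℝ), G r * r ^ (-1 - 2 * s) := by
  have h := integral_comp_mul_left_Ioi (fun r => G r * r ^ (-1 - 2 * s)) 0 hc
  rw [mul_zero, smul_eq_mul] at h
  have h2 : ∫ r in Ioi (0 : ℝ), G (c * r) * r ^ (-1 - 2 * s) =
      c ^ (1 + 2 * s) * ∫ r in Ioi (0 : ℝ), G (c * r) * (c * r) ^ (-1 - 2 * s) := by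
    rw [← integral_const_mul]
    refine setIntegral_congr_fun measurableSet_Ioi fun r hr => ?_
    have hr : 0 < r := hr
    rw [Real.mul_rpow hc.le hr.le, show c ^ (1 + 2 * s) * (G (c * r) * (c ^ (-1 - 2 * s) *
      r ^ (-1 - 2 * s))) = (c ^ (1 + 2 * s) * c ^ (-1 - 2 * s)) * (G (c * r) * r ^ (-1 - 2 * s)) by
      ring, ← Real.rpow_add hc]
    norm_num
  rw [h2, h, ← mul_assoc]
  congr 1
  rw [← Real.rpow_neg_one, ← Real.rpow_add hc]
  congr 1; ring

/-- Along a ray the integrand is `G (|⟨p, θ⟩| r)` times `a θ * r ^ (-1 - 2 * s)`, so scaling in `r`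
extracts `|⟨p, θ⟩| ^ (2 * s)` and leaves a radial integral free of `θ`. This is where the
homogeneity of the kernel is essential. -/
theorem integrable_comp_inner_mul_kernel {N : ℕ} (hN : 1 ≤ N) {s : ℝ} (hs : 0 < s)
    {a : Metric.sphere (0 : 𝔼 N) 1 → ℝ} (ha : Measurable a) {Γ : ℝ} (haΓ : ∀ θ, |a θ| ≤ Γ)
    {K : 𝔼 N → ℝ} (hK : ∀ (θ : Metric.sphere (0 : 𝔼 N) 1) (r : ℝ), 0 < r →
        K (r • (θ : 𝔼 N)) = a θ / r ^ ((N : ℝ) + 2 * s))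
    {G : ℝ → ℝ} (hGm : Measurable G) (hG0 : G 0 = 0)
    (hG : IntegrableOn (fun r => G r * r ^ (-1 - 2 * s)) (Ioi 0)) (p : 𝔼 N) :
    Integrable (fun z => G |inner ℝ p z| * K z) ∧
    ∫ z, G |inner ℝ p z| * K z =
      (∫ θ, a θ * |inner ℝ p (θ : 𝔼 N)| ^ (2 * s) ∂(volume : Measure (𝔼 N)).toSphere) *
        ∫ r in Ioi (0 : ℝ), G r * r ^ (-1 - 2 * s) := by
  have : NeZero N := ⟨by omega⟩
  have : Nonempty (Fin N) := ⟨0⟩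
  have hfr : Module.finrank ℝ (𝔼 N) = N := finrank_euclideanSpace_fin
  set J := ∫ r in Ioi (0 : ℝ), G r * r ^ (-1 - 2 * s) with hJ
  have hform : ∀ q : Metric.sphere (0 : 𝔼 N) 1 × Ioi (0 : ℝ),
      G |inner ℝ p (q.2.1 • q.1.1)| * K (q.2.1 • q.1.1) =
        G (|inner ℝ p q.1.1| * q.2.1) * (a q.1 / q.2.1 ^ ((N : ℝ) + 2 * s)) := by
    rintro ⟨θ, r, hr⟩
    have hr : 0 < r := hr
    simp only
    rw [hK θ r hr, inner_smul_right, abs_mul, abs_of_pos hr, mul_comm r]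
  have hpow : ∀ (θ : Metric.sphere (0 : 𝔼 N) 1) (r : ℝ), r ∈ Ioi (0 : ℝ) →
      r ^ (N - 1) * (G (|inner ℝ p (θ : 𝔼 N)| * r) * (a θ / r ^ ((N : ℝ) + 2 * s))) =
      a θ * (G (|inner ℝ p (θ : 𝔼 N)| * r) * r ^ (-1 - 2 * s)) := by
    intro θ r hr
    have hr : 0 < r := hr
    rw [div_eq_mul_inv, ← Real.rpow_neg hr.le, ← Real.rpow_natCast,
      show r ^ (((N - 1 : ℕ) : ℝ)) * (G (|inner ℝ p (θ : 𝔼 N)| * r) * (a θ * r ^ (-((N : ℝ) + 2 * s)))) =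
      a θ * (G (|inner ℝ p (θ : 𝔼 N)| * r) * (r ^ (((N - 1 : ℕ) : ℝ)) * r ^ (-((N : ℝ) + 2 * s)))) by ring,
      ← Real.rpow_add hr]
    congr 3
    push_cast [Nat.cast_sub hN]; ring
  have hInt : ∀ θ : Metric.sphere (0 : 𝔼 N) 1,
      IntegrableOn (fun r => G (|inner ℝ p (θ : 𝔼 N)| * r) * r ^ (-1 - 2 * s)) (Ioi 0) := by
    intro θ
    -- Directions orthogonal to `p` cannot be rescaled; there the integrand vanishes because `G 0 =
    -- 0`.
    rcases eq_or_lt_of_le (abs_nonneg (inner ℝ p (θ : 𝔼 N))) with h | h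
    · rw [← h]; simp only [zero_mul, hG0]; exact integrableOn_zero
    · exact integrableOn_comp_mul_rpow hG h
  have hval : ∀ (G : ℝ → ℝ), G 0 = 0 → ∀ θ : Metric.sphere (0 : 𝔼 N) 1,
      ∫ r in Ioi (0 : ℝ), G (|inner ℝ p (θ : 𝔼 N)| * r) * r ^ (-1 - 2 * s) =
      |inner ℝ p (θ : 𝔼 N)| ^ (2 * s) * ∫ r in Ioi (0 : ℝ), G r * r ^ (-1 - 2 * s) := by
    intro G hG0 θ
    rcases eq_or_lt_of_le (abs_nonneg (inner ℝ p (θ : 𝔼 N))) with h | h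
    · rw [← h]; simp [hG0, Real.zero_rpow (by positivity : 2 * s ≠ 0)]
    · exact integral_comp_mul_rpow G s h
  have hmeas : AEStronglyMeasurable (fun q : Metric.sphere (0 : 𝔼 N) 1 × Ioi (0 : ℝ) =>
      G (|inner ℝ p q.1.1| * q.2.1) * (a q.1 / q.2.1 ^ ((N : ℝ) + 2 * s)))
      ((volume : Measure (𝔼 N)).toSphere.prod (Measure.volumeIoiPow (N - 1))) :=
    (by fun_prop : Measurable _).aestronglyMeasurable
  have hint : Integrable (fun q : Metric.sphere (0 : 𝔼 N) 1 × Ioi (0 : ℝ) =>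
      G (|inner ℝ p q.1.1| * q.2.1) * (a q.1 / q.2.1 ^ ((N : ℝ) + 2 * s)))
      ((volume : Measure (𝔼 N)).toSphere.prod (Measure.volumeIoiPow (N - 1))) := by
    rw [integrable_prod_iff hmeas]
    constructor
    · refine .of_forall fun θ => ?_
      rw [integrable_volumeIoiPow_iff (N - 1)
        (fun r => G (|inner ℝ p (θ : 𝔼 N)| * r) * (a θ / r ^ ((N : ℝ) + 2 * s)))]
      exact IntegrableOn.congr_fun ((hInt θ).const_mul (a θ)) (fun r hr => (hpow θ r hr).symm) measurableSet_Ioi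
    · have hc : ∀ θ : Metric.sphere (0 : 𝔼 N) 1,
          ∫ r : Ioi (0 : ℝ), ‖G (|inner ℝ p (θ : 𝔼 N)| * r.1) * (a θ / r.1 ^ ((N : ℝ) + 2 * s))‖
            ∂(Measure.volumeIoiPow (N - 1)) = |a θ| * (|inner ℝ p (θ : 𝔼 N)| ^ (2 * s) *
            ∫ r in Ioi (0 : ℝ), |G r| * r ^ (-1 - 2 * s)) := by
        intro θ
        rw [integral_volumeIoiPow (N - 1)
          (fun r => ‖G (|inner ℝ p (θ : 𝔼 N)| * r) * (a θ / r ^ ((N : ℝ) + 2 * s))‖),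
          ← hval (fun r => |G r|) (by simp [hG0]) θ, ← integral_const_mul]
        refine setIntegral_congr_fun measurableSet_Ioi fun r hr => ?_
        have h := congrArg abs (hpow θ r hr)
        have hr : 0 < r := hr
        rw [abs_mul, abs_of_pos (by positivity : 0 < r ^ (N - 1)), abs_mul (a θ), abs_mul (G _) (r ^ _),
          abs_of_pos (by positivity : 0 < r ^ (-1 - 2 * s))] at h
        rw [Real.norm_eq_abs]
        exact h
      simp only [hc]
      have hΓ : Integrable (fun _ : Metric.sphere (0 : 𝔼 N) 1 => Γ * (‖p‖ ^ (2 * s) *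
          ∫ r in Ioi (0 : ℝ), |G r| * r ^ (-1 - 2 * s))) (volume : Measure (𝔼 N)).toSphere :=
        integrable_const _
      refine hΓ.mono' (by fun_prop : Measurable _).aestronglyMeasurable (.of_forall fun θ => ?_)
      have hnn : 0 ≤ ∫ r in Ioi (0 : ℝ), |G r| * r ^ (-1 - 2 * s) :=
        setIntegral_nonneg measurableSet_Ioi fun r hr =>
          mul_nonneg (abs_nonneg _) (Real.rpow_nonneg (le_of_lt hr) _)
      have hle : |inner ℝ p (θ : 𝔼 N)| ≤ ‖p‖ := by
        have := abs_real_inner_le_norm p (θ : 𝔼 N)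
        simpa using this
      rw [Real.norm_of_nonneg (by positivity)]
      have := (abs_nonneg _).trans (haΓ θ)
      gcongr
      exact haΓ θ
  constructor
  · rw [integrable_iff_integrable_polar, hfr]
    simp only [hform]
    exact hint
  · rw [integral_eq_integral_polar, hfr]
    simp only [hform]
    rw [integral_prod _ hint, ← integral_mul_const]
    congr 1
    ext θ
    rw [integral_volumeIoiPow (N - 1)
        (fun r => G (|inner ℝ p (θ : 𝔼 N)| * r) * (a θ / r ^ ((N : ℝ) + 2 * s))),
      setIntegral_congr_fun measurableSet_Ioi (hpow θ), integral_const_mul, hval G hG0 θ]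
    ring

/-- On the cap of directions at distance less than `1` from `p / ‖p‖` the inner product exceeds `‖p‖
/ 2`, and the measure of such a cap is bounded below independently of its centre. -/
theorem exists_le_integral_abs_inner_rpow {N : ℕ} {s : ℝ} (hs : 0 < s) :
    ∃ c : ℝ, 0 < c ∧ ∀ p : 𝔼 N, c * ‖p‖ ^ (2 * s) ≤
      ∫ θ, |inner ℝ p (θ : 𝔼 N)| ^ (2 * s) ∂(volume : Measure (𝔼 N)).toSphere := by
  set μ := (volume : Measure (𝔼 N)).toSphere
  set b : ℝ := Measure.toSphereBallBound (Module.finrank ℝ (𝔼 N)) 1 *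
    (volume : Measure (𝔼 N)).real (Metric.ball 0 1) with hb
  have hb0 : 0 < b := by
    refine mul_pos (NNReal.coe_pos.2 (Measure.toSphereBallBound_pos _ _)) ?_
    exact ENNReal.toReal_pos (Metric.measure_ball_pos _ _ one_pos).ne' measure_ball_lt_top.ne
  refine ⟨(1 / 2) ^ (2 * s) * b, by positivity, fun p => ?_⟩
  rcases eq_or_ne p 0 with rfl | hp
  · rw [norm_zero, Real.zero_rpow (by positivity), mul_zero]
    exact integral_nonneg fun θ => by positivity
  have hp0 : 0 < ‖p‖ := norm_pos_iff.2 hp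
  set e : Metric.sphere (0 : 𝔼 N) 1 := ⟨‖p‖⁻¹ • p, by simp [norm_smul, hp0.ne']⟩ with he
  have hle : ∀ θ ∈ Metric.ball e 1, (1 / 2 * ‖p‖) ^ (2 * s) ≤ |inner ℝ p (θ : 𝔼 N)| ^ (2 * s) := by
    intro θ hθ
    have h1 : ‖(θ : 𝔼 N) - ‖p‖⁻¹ • p‖ < 1 := by
      have : dist θ e < 1 := hθ
      rwa [Subtype.dist_eq, dist_eq_norm] at this
    have h2 := norm_sub_sq_real (θ : 𝔼 N) (‖p‖⁻¹ • p)
    have hθ1 : ‖(θ : 𝔼 N)‖ = 1 := by simp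
    have he1 : ‖‖p‖⁻¹ • p‖ = 1 := by simp [norm_smul, hp0.ne']
    rw [hθ1, he1, inner_smul_right, real_inner_comm] at h2
    have h3 : 1 / 2 < ‖p‖⁻¹ * inner ℝ p (θ : 𝔼 N) := by
      have : ‖(θ : 𝔼 N) - ‖p‖⁻¹ • p‖ ^ 2 < 1 := by
        rw [sq_lt_one_iff₀ (norm_nonneg _)]; exact h1
      linarith
    have h4 : 1 / 2 * ‖p‖ ≤ inner ℝ p (θ : 𝔼 N) := by
      rw [inv_mul_eq_div, lt_div_iff₀ hp0] at h3
      exact h3.le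
    gcongr
    exact h4.trans (le_abs_self _)
  have hint : Integrable (fun θ : Metric.sphere (0 : 𝔼 N) 1 =>
      |inner ℝ p (θ : 𝔼 N)| ^ (2 * s)) μ := by
    refine (integrable_const (‖p‖ ^ (2 * s))).mono' (by fun_prop : Measurable _).aestronglyMeasurable
      (.of_forall fun θ => ?_)
    rw [Real.norm_of_nonneg (by positivity)]
    gcongr
    simpa using abs_real_inner_le_norm p (θ : 𝔼 N)
  calc _ = (1 / 2 * ‖p‖) ^ (2 * s) * b := by
        rw [Real.mul_rpow (by norm_num) hp0.le]; ring
    _ ≤ (1 / 2 * ‖p‖) ^ (2 * s) * μ.real (Metric.ball e 1) := by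
        gcongr
        exact Measure.toSphereBallBound_mul_measureReal_unitBall_le_toSphere_ball _ one_pos e
    _ = ∫ θ in Metric.ball e 1, (1 / 2 * ‖p‖) ^ (2 * s) ∂μ := by
        rw [setIntegral_const, smul_eq_mul, mul_comm]
    _ ≤ ∫ θ in Metric.ball e 1, |inner ℝ p (θ : 𝔼 N)| ^ (2 * s) ∂μ :=
        setIntegral_mono_on (integrable_const _).integrableOn hint.integrableOn
          measurableSet_ball hle
    _ ≤ _ := setIntegral_le_integral hint (.of_forall fun θ => by positivity)

/-! ### Powers of the norm and tail integrals -/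

theorem integrableOn_ball_norm_rpow {N : ℕ} (hN : 1 ≤ N) {q : ℝ} (hq : -(N : ℝ) < q) (a : ℝ) :
    IntegrableOn (fun z : 𝔼 N => ‖z‖ ^ q) (Metric.ball 0 a) := by
  have : NeZero N := ⟨by omega⟩
  have : Nonempty (Fin N) := ⟨0⟩
  rw [integrableOn_fun_norm_addHaar volume (f := fun r => r ^ q), finrank_euclideanSpace_fin]
  rcases le_or_gt a 0 with ha | ha
  · simp [Ioo_eq_empty (not_lt.2 ha)]
  have h := intervalIntegral.intervalIntegrable_rpow' (a := 0) (b := a) (r := (N : ℝ) - 1 + q)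
    (by linarith)
  rw [intervalIntegrable_iff_integrableOn_Ioo_of_le ha.le] at h
  refine h.congr_fun (fun r hr => ?_) measurableSet_Ioo
  simp only [smul_eq_mul]
  rw [Real.rpow_add hr.1, ← Real.rpow_natCast, Nat.cast_sub hN, Nat.cast_one]

theorem integral_ball_norm_rpow {N : ℕ} (q : ℝ) {a : ℝ}
    (ha : 0 < a) : ∫ z in Metric.ball (0 : 𝔼 N) a, ‖z‖ ^ q =
      (∫ z in Metric.ball (0 : 𝔼 N) 1, ‖z‖ ^ q) * a ^ ((N : ℝ) + q) := by
  have h := Measure.setIntegral_comp_smul_of_pos (volume : Measure (𝔼 N))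
    (fun z => ‖z‖ ^ q) (Metric.ball 0 1) ha
  rw [smul_unitBall ha.ne', Real.norm_of_nonneg ha.le, finrank_euclideanSpace_fin, smul_eq_mul] at h
  have h2 : ∫ z in Metric.ball (0 : 𝔼 N) 1, ‖a • z‖ ^ q =
      a ^ q * ∫ z in Metric.ball (0 : 𝔼 N) 1, ‖z‖ ^ q := by
    rw [← integral_const_mul]
    congr 1
    ext z
    rw [norm_smul, Real.norm_of_nonneg ha.le, Real.mul_rpow ha.le (norm_nonneg _)]
  rw [h2] at h
  rw [Real.rpow_add ha, Real.rpow_natCast]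
  rw [inv_mul_eq_div, eq_div_iff (by positivity)] at h
  rw [← h]; ring

theorem integrableOn_compl_ball_norm_rpow {N : ℕ} (hN : 1 ≤ N) {q : ℝ} (hq : q < -(N : ℝ)) {a : ℝ}
    (ha : 0 < a) : IntegrableOn (fun z : 𝔼 N => ‖z‖ ^ q) (Metric.ball 0 a)ᶜ := by
  have : NeZero N := ⟨by omega⟩
  have : Nonempty (Fin N) := ⟨0⟩
  rw [← integrable_indicator_iff measurableSet_ball.compl]
  have := (integrable_fun_norm_addHaar (volume : Measure (𝔼 N))
    (f := (Ici a).indicator fun r => r ^ q)).2 ?_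
  · refine this.congr (.of_forall fun z => ?_)
    simp [indicator]
  · rw [finrank_euclideanSpace_fin]
    have h : IntegrableOn (fun r : ℝ => r ^ ((N : ℝ) - 1 + q)) (Ici a) :=
      (integrableOn_Ici_iff_integrableOn_Ioi).2 (integrableOn_Ioi_rpow_of_lt (by linarith) ha)
    rw [← integrable_indicator_iff measurableSet_Ici] at h
    refine h.integrableOn.congr_fun (fun r hr => ?_) measurableSet_Ioi
    simp only [indicator, smul_eq_mul]
    split_ifs
    · rw [Real.rpow_add hr, ← Real.rpow_natCast, Nat.cast_sub hN, Nat.cast_one]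
    · simp

/-- A growth bound for the mass of balls gives decay of the tails of weighted integrals. -/
theorem lintegral_compl_ball_mul_norm_rpow_le {E : Type*} [NormedAddCommGroup E]
    [MeasurableSpace E] [BorelSpace E] (μ : Measure E) [SFinite μ] {F : E → ℝ≥0∞}
    (hF : Measurable F) {a p q : ℝ} (ha : 0 < a) (hq : 0 < q) (hpq : p < q) {C : ℝ≥0∞}
    (h : ∀ R, a < R → ∫⁻ z in Metric.ball 0 R, F z ∂μ ≤ C * ENNReal.ofReal (R ^ p)) :
    ∫⁻ z in (Metric.ball 0 a)ᶜ, F z * ENNReal.ofReal (‖z‖ ^ (-q)) ∂μ ≤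
      C * ENNReal.ofReal (q / (q - p) * a ^ (p - q)) := by
  -- Layer-cake representation: writing the weight as an integral over radii `R > ‖z‖` and
  -- exchanging the integrals reduces the tail to the masses of the balls.
  have h1 : ∀ r : ℝ, 0 < r → ENNReal.ofReal (r ^ (-q)) =
      ∫⁻ R in Ioi r, ENNReal.ofReal (q * R ^ (-q - 1)) := by
    intro r hr
    have hi := (integrableOn_Ioi_rpow_of_lt (a := -q - 1) (by linarith) hr).const_mul q
    rw [← ofReal_integral_eq_lintegral_ofReal hi, integral_const_mul,
      integral_Ioi_rpow_of_lt (by linarith) hr]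
    · congr 1
      rw [show -q - 1 + 1 = -q by ring]
      field_simp
    · filter_upwards [ae_restrict_mem measurableSet_Ioi] with R hR
      have : 0 < R := hr.trans hR
      positivity
  have hset : MeasurableSet {x : E × ℝ | ‖x.1‖ < x.2} :=
    measurableSet_lt (by fun_prop) (by fun_prop)
  have hset2 : MeasurableSet {x : E × ℝ | a ≤ ‖x.1‖} :=
    measurableSet_le (by fun_prop) (by fun_prop)
  set H : E → ℝ → ℝ≥0∞ := fun z R => ({x : E × ℝ | ‖x.1‖ < x.2} ∩ {x : E × ℝ | a ≤ ‖x.1‖}).indicator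
    (fun x => F x.1 * ENNReal.ofReal (q * x.2 ^ (-q - 1))) (z, R) with hH
  have hHm : Measurable (Function.uncurry H) := by
    refine Measurable.indicator ?_ (hset.inter hset2)
    fun_prop
  calc _ = ∫⁻ z, ∫⁻ R, H z R ∂volume ∂μ := by
        rw [← lintegral_indicator measurableSet_ball.compl]
        refine lintegral_congr fun z => ?_
        by_cases hz : a ≤ ‖z‖
        · rw [indicator_of_mem (by simpa using hz), h1 _ (ha.trans_le hz), ← lintegral_const_mul _
            (by fun_prop), ← lintegral_indicator measurableSet_Ioi]
          refine lintegral_congr fun R => ?_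
          simp [hH, indicator, hz]
        · rw [indicator_of_notMem (by simpa using hz)]
          simp [hH, indicator, hz]
    _ = ∫⁻ R, ∫⁻ z, H z R ∂μ ∂volume := lintegral_lintegral_swap hHm.aemeasurable
    _ ≤ ∫⁻ R in Ioi a, C * ENNReal.ofReal (q * R ^ (p - q - 1)) := by
        rw [← lintegral_indicator measurableSet_Ioi]
        refine lintegral_mono fun R => ?_
        by_cases hR : a < R
        · rw [indicator_of_mem (by exact hR)]
          have hR0 : 0 < R := ha.trans hR
          calc _ ≤ ∫⁻ z in Metric.ball 0 R, F z * ENNReal.ofReal (q * R ^ (-q - 1)) ∂μ := by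
                rw [← lintegral_indicator measurableSet_ball]
                refine lintegral_mono fun z => ?_
                simp only [hH, indicator, mem_inter_iff, mem_ofPred_eq, Metric.mem_ball, dist_zero_right]
                split_ifs with h1 h2
                · exact le_rfl
                · exact absurd h1.1 h2
                · exact zero_le
                · exact le_rfl
            _ ≤ C * ENNReal.ofReal (R ^ p) * ENNReal.ofReal (q * R ^ (-q - 1)) := by
                rw [lintegral_mul_const _ hF]
                gcongr
                exact h R hR
            _ = _ := by
                rw [mul_assoc, ← ENNReal.ofReal_mul (by positivity)]
                congr 2
                rw [mul_left_comm, ← Real.rpow_add hR0]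
                congr 2; ring
        · rw [indicator_of_notMem (by exact hR)]
          simp only [hH, nonpos_iff_eq_zero]
          refine (lintegral_congr fun z => ?_).trans lintegral_zero
          simp only [indicator, mem_inter_iff, mem_ofPred_eq]
          rw [if_neg]
          rintro ⟨h2, h3⟩
          linarith
    _ = C * ENNReal.ofReal (q / (q - p) * a ^ (p - q)) := by
        rw [lintegral_const_mul _ (by fun_prop)]
        have hi := (integrableOn_Ioi_rpow_of_lt (a := p - q - 1) (by linarith) ha).const_mul q
        rw [← ofReal_integral_eq_lintegral_ofReal hi, integral_const_mul,
          integral_Ioi_rpow_of_lt (by linarith) ha]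
        · congr 2
          rw [show p - q - 1 + 1 = -(q - p) by ring, show p - q = -(q - p) by ring]
          field_simp
        · filter_upwards [ae_restrict_mem measurableSet_Ioi] with R hR
          have : 0 < R := ha.trans hR
          positivity

/-! ### Global defining functions -/

theorem fderiv_apply_nonneg_of_eventually {E : Type*} [NormedAddCommGroup E] [NormedSpace ℝ E]
    {h : E → ℝ} {y e : E} (hd : DifferentiableAt ℝ h y) (hy : h y = 0)
    (hev : ∀ᶠ t : ℝ in 𝓝[>] 0, 0 ≤ h (y + t • e)) : 0 ≤ fderiv ℝ h y e := by
  have h1 : HasDerivAt (fun t : ℝ => h (y + t • e)) (fderiv ℝ h y e) 0 :=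
    hd.hasFDerivAt.hasLineDerivAt e
  have h2 := h1.tendsto_slope_zero_right
  refine ge_of_tendsto h2 ?_
  filter_upwards [hev, self_mem_nhdsWithin] with t ht ht0
  simp only [zero_add, zero_smul, add_zero, hy, sub_zero, smul_eq_mul]
  exact mul_nonneg (inv_nonneg.2 (le_of_lt ht0)) ht

theorem eventually_pos_of_fderiv_apply_pos {E : Type*} [NormedAddCommGroup E] [NormedSpace ℝ E]
    {h : E → ℝ} {y e : E} (hd : DifferentiableAt ℝ h y) (hy : h y = 0)
    (he : 0 < fderiv ℝ h y e) : ∀ᶠ t : ℝ in 𝓝[>] 0, 0 < h (y + t • e) := by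
  have h1 : HasDerivAt (fun t : ℝ => h (y + t • e)) (fderiv ℝ h y e) 0 :=
    hd.hasFDerivAt.hasLineDerivAt e
  have h2 := h1.tendsto_slope_zero_right
  filter_upwards [h2.eventually (lt_mem_nhds he), self_mem_nhdsWithin] with t ht ht0
  simp only [zero_add, zero_smul, add_zero, hy, sub_zero, smul_eq_mul] at ht
  exact (pos_iff_pos_of_mul_pos ht).1 (inv_pos.2 ht0)

/-- A localized defining function of `Ω` near a boundary point. -/
theorem exists_localized_definingFunction {N : ℕ} {Ω : Set (𝔼 N)} (hΩ : IsOpen Ω)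
    (hb : HasC2Boundary Ω) {x : 𝔼 N} (hx : x ∈ frontier Ω) :
    ∃ (g : 𝔼 N → ℝ) (V : Set (𝔼 N)), V ∈ 𝓝 x ∧ ContDiff ℝ 2 g ∧ HasCompactSupport g ∧
      (∀ y ∈ Ω, 0 ≤ g y) ∧ (∀ y ∉ Ω, g y ≤ 0) ∧ (∀ y ∈ frontier Ω, g y = 0) ∧
      ∀ y ∈ frontier Ω ∩ V, fderiv ℝ g y ≠ 0 := by
  obtain ⟨U, ψ, hU, hxU, hψ, hψ', hψΩ⟩ := hb x hx
  obtain ⟨r, hr, hrU⟩ := Metric.nhds_basis_closedBall.mem_iff.1 (hU.mem_nhds hxU)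
  let χ : ContDiffBump x := ⟨r / 2, r, by positivity, by linarith⟩
  have hχU : tsupport χ ⊆ U := by rw [χ.tsupport_eq]; exact hrU
  have hψ0 : ∀ y ∈ frontier Ω ∩ U, ψ y = 0 := by
    intro y hy
    have hyΩ : y ∉ Ω := by
      have := hy.1.2
      rwa [hΩ.interior_eq] at this
    refine le_antisymm (not_lt.1 fun h => hyΩ ((hψΩ y hy.2).2 h)) ?_
    have hc : ContinuousWithinAt ψ Ω y := ((hψ.continuousOn.continuousAt (hU.mem_nhds hy.2))).continuousWithinAt
    have : (𝓝[Ω] y).NeBot := mem_closure_iff_nhdsWithin_neBot.1 hy.1.1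
    refine ge_of_tendsto hc.tendsto ?_
    filter_upwards [self_mem_nhdsWithin, nhdsWithin_le_nhds (hU.mem_nhds hy.2)] with z hz hzU
    exact ((hψΩ z hzU).1 hz).le
  have hχ0 : ∀ y ∉ U, χ y = 0 := fun y hy => by
    by_contra h
    exact hy (hχU (subset_tsupport _ h))
  refine ⟨fun y => χ y * ψ y, Metric.ball x r, Metric.ball_mem_nhds x hr, ?_, ?_, ?_, ?_, ?_, ?_⟩
  · rw [contDiff_iff_contDiffAt]
    intro y
    by_cases hy : y ∈ U
    · exact χ.contDiffAt.mul (hψ.contDiffAt (hU.mem_nhds hy))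
    · have h0 : (fun y => χ y * ψ y) =ᶠ[𝓝 y] fun _ => 0 := by
        have : (tsupport χ)ᶜ ∈ 𝓝 y :=
          (isClosed_tsupport χ).isOpen_compl.mem_nhds fun h => hy (hχU h)
        filter_upwards [this] with z hz
        rw [image_eq_zero_of_notMem_tsupport hz, zero_mul]
      exact contDiffAt_const.congr_of_eventuallyEq h0
  · exact χ.hasCompactSupport.mul_right
  · intro y hy
    by_cases hyU : y ∈ U
    · exact mul_nonneg χ.nonneg ((hψΩ y hyU).1 hy).le
    · simp [hχ0 y hyU]
  · intro y hy
    by_cases hyU : y ∈ U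
    · exact mul_nonpos_of_nonneg_of_nonpos χ.nonneg
        (not_lt.1 fun h => hy ((hψΩ y hyU).2 h))
    · simp [hχ0 y hyU]
  · intro y hy
    by_cases hyU : y ∈ U
    · simp [hψ0 y ⟨hy, hyU⟩]
    · simp [hχ0 y hyU]
  · intro y hy
    have hyU : y ∈ U := hrU (Metric.ball_subset_closedBall hy.2)
    have hd1 : DifferentiableAt ℝ χ y := (χ.contDiffAt (n := 1)).differentiableAt one_ne_zero
    have hd2 : DifferentiableAt ℝ ψ y :=
      (hψ.contDiffAt (hU.mem_nhds hyU)).differentiableAt two_ne_zero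
    rw [fderiv_fun_mul hd1 hd2, hψ0 y ⟨hy.1, hyU⟩, zero_smul, add_zero]
    exact smul_ne_zero (χ.pos_of_mem_ball hy.2).ne' (hψ' y hyU)

/-- A bounded open set with `C²` boundary has a global `C²` defining function. -/
theorem exists_definingFunction {N : ℕ} {Ω : Set (𝔼 N)} (hΩ : IsOpen Ω)
    (hbd : Bornology.IsBounded Ω) (hb : HasC2Boundary Ω) :
    ∃ ρ : 𝔼 N → ℝ, ContDiff ℝ 2 ρ ∧ HasCompactSupport ρ ∧ (∀ x, x ∈ Ω ↔ 0 < ρ x) ∧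
      ∀ x ∈ frontier Ω, ρ x = 0 ∧ fderiv ℝ ρ x ≠ 0 := by
  have hfc : IsCompact (frontier Ω) :=
    Metric.isCompact_of_isClosed_isBounded isClosed_frontier
      (hbd.closure.subset frontier_subset_closure)
  -- The localized functions may all vanish deep inside `Ω`; a smooth nonnegative `f` supported
  -- exactly on `Ω` restores positivity there.
  obtain ⟨f, hfs, hfd, hfr⟩ := hΩ.exists_contDiff_support_eq (n := 2)
  have hf0 : ∀ y, 0 ≤ f y := fun y => (hfr (mem_range_self y)).1
  have hfΩ : ∀ y, y ∈ Ω ↔ f y ≠ 0 := fun y => by rw [← hfs]; rfl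
  choose! g V hV hg hgc hg1 hg2 hg3 hg4 using
    fun (x : 𝔼 N) (hx : x ∈ frontier Ω) => exists_localized_definingFunction hΩ hb hx
  obtain ⟨t, htf, ht⟩ := hfc.elim_nhds_subcover V hV
  have hfd' : ContDiff ℝ 2 f := by exact_mod_cast hfd
  have hsum : ContDiff ℝ 2 fun y => ∑ x ∈ t, g x y :=
    ContDiff.sum fun x hx => hg x (htf x hx)
  refine ⟨fun y => f y + ∑ x ∈ t, g x y, hfd'.add hsum, ?_, ?_, ?_⟩
  · refine HasCompactSupport.add ?_ ?_
    · refine HasCompactSupport.of_support_subset_isCompact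
        (Metric.isCompact_of_isClosed_isBounded isClosed_closure hbd.closure) ?_
      rw [hfs]; exact subset_closure
    · refine HasCompactSupport.of_support_subset_isCompact
        (K := ⋃ x ∈ t, tsupport (g x)) (t.isCompact_biUnion fun x hx => hgc x (htf x hx)) ?_
      intro y hy
      obtain ⟨x, hx, hxy⟩ := Finset.exists_ne_zero_of_sum_ne_zero hy
      exact mem_biUnion hx (subset_tsupport _ hxy)
  · intro y
    constructor
    · intro hy
      exact add_pos_of_pos_of_nonneg ((hf0 y).lt_of_ne' ((hfΩ y).1 hy))
        (Finset.sum_nonneg fun x hx => hg1 x (htf x hx) y hy)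
    · intro hy
      by_contra hn
      have h1 : f y = 0 := not_not.1 fun h => hn ((hfΩ y).2 h)
      have h2 := Finset.sum_nonpos fun x hx => hg2 x (htf x hx) y hn
      simp only [h1, zero_add] at hy
      exact hy.not_ge h2
  · intro y hy
    have hyΩ : y ∉ Ω := by
      have := hy.2
      rwa [hΩ.interior_eq] at this
    have hfy : f y = 0 := not_not.1 fun h => hyΩ ((hfΩ y).2 h)
    refine ⟨by simp only [hfy, zero_add]; exact Finset.sum_eq_zero fun x hx => hg3 x (htf x hx) y hy, ?_⟩
    obtain ⟨x₁, hx₁, hyV⟩ := mem_iUnion₂.1 (ht hy)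
    have hdg : ∀ x ∈ t, DifferentiableAt ℝ (g x) y := fun x hx =>
      ((hg x (htf x hx)).differentiable two_ne_zero) y
    have hdf : DifferentiableAt ℝ f y := (hfd'.differentiable two_ne_zero) y
    -- A direction in which one localized function increases enters `Ω`. All other summands vanish
    -- at `y` and are nonnegative along it, so no derivative can cancel.
    obtain ⟨e, he⟩ : ∃ e, 0 < fderiv ℝ (g x₁) y e := by
      obtain ⟨e, he⟩ := DFunLike.ne_iff.1 (hg4 x₁ (htf x₁ hx₁) y ⟨hy, hyV⟩)
      rcases lt_or_gt_of_ne he with h | h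
      · exact ⟨-e, by rw [map_neg]; simpa using h⟩
      · exact ⟨e, h⟩
    have hev : ∀ᶠ τ : ℝ in 𝓝[>] 0, y + τ • e ∈ Ω := by
      filter_upwards [eventually_pos_of_fderiv_apply_pos (hdg x₁ hx₁)
        (hg3 x₁ (htf x₁ hx₁) y hy) he] with τ hτ
      by_contra hn
      exact hτ.not_ge (hg2 x₁ (htf x₁ hx₁) _ hn)
    intro h0
    rw [fderiv_fun_add hdf (DifferentiableAt.fun_sum fun x hx => hdg x hx),
      fderiv_fun_sum fun x hx => hdg x hx] at h0
    have h1 := DFunLike.congr_fun h0 e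
    simp only [add_apply, zero_apply,
      sum_apply] at h1
    have h2 : 0 ≤ fderiv ℝ f y e := fderiv_apply_nonneg_of_eventually hdf hfy
      (Eventually.of_forall fun τ => hf0 _)
    have h3 : fderiv ℝ (g x₁) y e ≤ ∑ x ∈ t, fderiv ℝ (g x) y e :=
      Finset.single_le_sum (f := fun x => fderiv ℝ (g x) y e) (fun x hx =>
        fderiv_apply_nonneg_of_eventually (hdg x hx)
          (hg3 x (htf x hx) y hy) (hev.mono fun τ hτ => hg1 x (htf x hx) _ hτ)) hx₁
    linarith

section

/-- A `C²` defining function of a bounded open set, with quantitative bounds: Lipschitz constant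
`L`, quadratic Taylor remainder `C`, upper bound `H`, and, where the function is smaller than `d₀`,
gradient at least `c₀` and increase at rate `c₀` in some direction on balls of radius `r₁`. -/
structure IsQuantDefining {N : ℕ} (Ω : Set (𝔼 N)) (ρ : 𝔼 N → ℝ) (L C H c₀ d₀ r₁ : ℝ) :
    Prop where
  isOpen : IsOpen Ω
  isBounded : Bornology.IsBounded Ω
  contDiff : ContDiff ℝ 2 ρ
  mem_iff : ∀ x, x ∈ Ω ↔ 0 < ρ x
  eq_zero : ∀ x ∈ frontier Ω, ρ x = 0
  L_pos : 0 < L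
  C_pos : 0 < C
  H_pos : 0 < H
  c₀_pos : 0 < c₀
  d₀_pos : 0 < d₀
  r₁_pos : 0 < r₁
  le_H : ∀ x, ρ x ≤ H
  lipschitz : ∀ x y, |ρ x - ρ y| ≤ L * ‖x - y‖
  taylor : ∀ x z, |ρ (x + z) - (ρ x + inner ℝ (gradient ρ x) z)| ≤ C * ‖z‖ ^ 2
  le_gradient : ∀ x ∈ closure Ω, ρ x < d₀ → c₀ ≤ ‖gradient ρ x‖
  increasing : ∀ x ∈ closure Ω, ρ x < d₀ → ∃ e : 𝔼 N, ‖e‖ = 1 ∧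
    ∀ y ∈ Metric.ball x r₁, ∀ t : ℝ, 0 ≤ t → y + t • e ∈ Metric.ball x r₁ →
      ρ y + c₀ * t ≤ ρ (y + t • e)

theorem inner_gradient_eq_fderiv {N : ℕ} (ρ : 𝔼 N → ℝ) (x v : 𝔼 N) :
    inner ℝ (gradient ρ x) v = fderiv ℝ ρ x v := by
  unfold gradient
  rw [InnerProductSpace.toDual_symm_apply]

theorem norm_gradient_eq_norm_fderiv {N : ℕ} (ρ : 𝔼 N → ℝ) (x : 𝔼 N) :
    ‖gradient ρ x‖ = ‖fderiv ℝ ρ x‖ := by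
  unfold gradient
  rw [LinearIsometryEquiv.norm_map]

theorem exists_isQuantDefining {N : ℕ} {Ω : Set (𝔼 N)} (hΩ : IsOpen Ω)
    (hbd : Bornology.IsBounded Ω) (hb : HasC2Boundary Ω) :
    ∃ ρ L C H c₀ d₀ r₁, IsQuantDefining Ω ρ L C H c₀ d₀ r₁ := by
  obtain ⟨ρ, hρ, hρc, hmem, hfr⟩ := exists_definingFunction hΩ hbd hb
  obtain ⟨L, hL⟩ := ContDiff.lipschitzWith_of_hasCompactSupport hρc hρ two_ne_zero
  have hρ' : ContDiff ℝ 1 (fderiv ℝ ρ) := hρ.fderiv_right (by norm_num)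
  obtain ⟨C, hC⟩ := ContDiff.lipschitzWith_of_hasCompactSupport (hρc.fderiv ℝ) hρ' one_ne_zero
  obtain ⟨H, hH⟩ := hρc.exists_bound_of_continuous hρ.continuous
  have hdiff : Differentiable ℝ ρ := hρ.differentiable two_ne_zero
  have hC' : ∀ x y, ‖fderiv ℝ ρ x - fderiv ℝ ρ y‖ ≤ (C + 1) * ‖x - y‖ := fun x y => by
    have := hC.dist_le_mul x y
    rw [dist_eq_norm, dist_eq_norm] at this
    nlinarith [norm_nonneg (x - y)]
  have hclc : IsCompact (closure Ω) :=
    Metric.isCompact_of_isClosed_isBounded isClosed_closure hbd.closure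
  have hfc : IsCompact (frontier Ω) := hclc.of_isClosed_subset isClosed_frontier
    frontier_subset_closure
  have hcont : Continuous fun x => ‖fderiv ℝ ρ x‖ := hρ'.continuous.norm
  obtain ⟨m, hm, hmf⟩ : ∃ m : ℝ, 0 < m ∧ ∀ x ∈ frontier Ω, m ≤ ‖fderiv ℝ ρ x‖ :=
    hfc.exists_forall_le' hcont.continuousOn fun x hx => norm_pos_iff.2 (hfr x hx).2
  set W := {x | m / 2 < ‖fderiv ℝ ρ x‖} with hW
  have hWo : IsOpen W := isOpen_lt continuous_const hcont
  -- The part of the closure where the gradient is at most `m / 2` is compact and misses the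
  -- frontier, so `ρ` has a positive minimum there.
  obtain ⟨d₀, hd₀, hd₀'⟩ : ∃ d₀ : ℝ, 0 < d₀ ∧ ∀ x ∈ closure Ω \ W, d₀ ≤ ρ x := by
    refine (hclc.diff hWo).exists_forall_le' hρ.continuous.continuousOn fun x hx => ?_
    by_contra hn
    have : x ∈ frontier Ω := ⟨hx.1, by rw [hΩ.interior_eq, hmem]; exact hn⟩
    exact hx.2 (lt_of_lt_of_le (by linarith) (hmf x this))
  have hgrad : ∀ x ∈ closure Ω, ρ x < d₀ → m / 2 ≤ ‖fderiv ℝ ρ x‖ := by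
    intro x hx hxd
    by_contra hn
    exact hxd.not_ge (hd₀' x ⟨hx, fun h => hn (le_of_lt h)⟩)
  -- The added ones make the constants positive. On a ball of radius `m / (4 * (C + 1))` the
  -- derivative varies by at most `m / 4`, so in the gradient direction, where the slope at the
  -- centre is at least `m / 2`, a rate `m / 4` remains.
  refine ⟨ρ, L + 1, C + 1, |H| + 1, m / 4, d₀, m / (4 * (C + 1)), hΩ, hbd, hρ, hmem,
    fun x hx => (hfr x hx).1, by positivity, by positivity, by positivity, by positivity, hd₀,
    by positivity, ?_, ?_, ?_, ?_, ?_⟩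
  · intro x
    have := hH x
    rw [Real.norm_eq_abs] at this
    linarith [le_abs_self (ρ x), le_abs_self H]
  · intro x y
    have := hL.dist_le_mul x y
    rw [dist_eq_norm, dist_eq_norm, Real.norm_eq_abs] at this
    nlinarith [norm_nonneg (x - y)]
  · intro x z
    have := abs_sub_fderiv_le_of_lipschitzOn (φ := ρ) convex_univ (C := C + 1) (x := x) (y := x + z)
      (fun y _ => hdiff y) (mem_univ _) (fun y _ => hC' y x) (mem_univ _) (by positivity)
    rw [inner_gradient_eq_fderiv, ← sub_sub]
    simpa using this
  · intro x hx hxd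
    rw [norm_gradient_eq_norm_fderiv]
    linarith [hgrad x hx hxd]
  · intro x hx hxd
    have hg := hgrad x hx hxd
    rw [← norm_gradient_eq_norm_fderiv] at hg
    set p := gradient ρ x with hp
    have hp0 : 0 < ‖p‖ := by linarith
    refine ⟨‖p‖⁻¹ • p, by simp [norm_smul, hp0.ne'], fun y hy t ht hyt => ?_⟩
    have h1 := (convex_ball x (m / (4 * (C + 1)))).norm_image_sub_le_of_norm_hasFDerivWithin_le'
      (f := ρ) (f' := fderiv ℝ ρ) (φ := fderiv ℝ ρ x) (C := m / 4)
      (fun z _ => (hdiff z).hasFDerivAt.hasFDerivWithinAt) (fun z hz => ?_) hy hyt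
    · rw [add_sub_cancel_left, norm_smul, norm_smul, norm_inv, norm_norm,
        inv_mul_cancel₀ hp0.ne', mul_one, Real.norm_of_nonneg ht, ← inner_gradient_eq_fderiv,
        ← hp, inner_smul_right, inner_smul_right, real_inner_self_eq_norm_sq, Real.norm_eq_abs] at h1
      have h2 := (abs_le.1 h1).1
      have h3 : t * (‖p‖⁻¹ * ‖p‖ ^ 2) = t * ‖p‖ := by field_simp
      rw [h3] at h2
      nlinarith
    · have h2 : ‖z - x‖ < m / (4 * (C + 1)) := mem_ball_iff_norm.1 hz
      calc _ ≤ (C + 1) * ‖z - x‖ := hC' z x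
        _ ≤ (C + 1) * (m / (4 * (C + 1))) := by gcongr
        _ = m / 4 := by field_simp

/-! ### Integrability of negative powers of the defining function -/

theorem ennreal_rpow_neg_anti {x y : ℝ≥0∞} (h : x ≤ y) {β : ℝ} (hβ : 0 ≤ β) :
    y ^ (-β) ≤ x ^ (-β) := by
  rw [ENNReal.rpow_neg, ENNReal.rpow_neg]
  exact ENNReal.inv_le_inv.2 (ENNReal.rpow_le_rpow h hβ)

/-- The negative power `t ↦ t^{-β}` on `[0, ∞)`, infinite at `0`, extended by zero. -/
def negPow (β t : ℝ) : ℝ≥0∞ := if 0 ≤ t then ENNReal.ofReal t ^ (-β) else 0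

theorem measurable_negPow (β : ℝ) : Measurable (negPow β) :=
  Measurable.ite measurableSet_Ici (by fun_prop) measurable_const

theorem ofReal_posRpow_le_negPow (β t : ℝ) : ENNReal.ofReal (posRpow (-β) t) ≤ negPow β t := by
  rcases le_or_gt t 0 with h | h
  · simp [posRpow_of_nonpos h]
  · rw [posRpow_of_pos h, negPow, if_pos h.le, ENNReal.ofReal_rpow_of_pos h]

theorem lintegral_Ioc_negPow_le {β c R t₀ : ℝ} (hβ : β < 1) (hc : 0 < c)
    (ht₀ : 0 ≤ t₀) (ht₀R : t₀ ≤ R) :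
    ∫⁻ t in Icc t₀ R, ENNReal.ofReal (c * (t - t₀)) ^ (-β) ≤
      ENNReal.ofReal (c ^ (-β) / (1 - β) * R ^ (1 - β)) := by
  rw [Measure.restrict_congr_set (Ioc_ae_eq_Icc (a := t₀) (b := R) (μ := volume)).symm]
  have hi : IntegrableOn (fun t : ℝ => c ^ (-β) * (t - t₀) ^ (-β)) (Ioc t₀ R) := by
    have := (intervalIntegral.intervalIntegrable_rpow' (a := 0) (b := R - t₀) (r := -β)
      (by linarith)).comp_sub_right t₀
    simp only [zero_add, sub_add_cancel] at this
    rw [intervalIntegrable_iff_integrableOn_Ioc_of_le ht₀R] at this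
    exact this.const_mul _
  calc _ = ∫⁻ t in Ioc t₀ R, ENNReal.ofReal (c ^ (-β) * (t - t₀) ^ (-β)) := by
        refine setLIntegral_congr_fun measurableSet_Ioc fun t ht => ?_
        have : 0 < t - t₀ := by linarith [ht.1]
        rw [ENNReal.ofReal_rpow_of_pos (by positivity), Real.mul_rpow hc.le this.le]
    _ = ENNReal.ofReal (∫ t in Ioc t₀ R, c ^ (-β) * (t - t₀) ^ (-β)) := by
        rw [ofReal_integral_eq_lintegral_ofReal hi]
        filter_upwards [ae_restrict_mem measurableSet_Ioc] with t ht
        have : 0 < t - t₀ := by linarith [ht.1]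
        positivity
    _ = ENNReal.ofReal (c ^ (-β) / (1 - β) * (R - t₀) ^ (1 - β)) := by
        congr 1
        rw [integral_const_mul, ← intervalIntegral.integral_of_le ht₀R,
          intervalIntegral.integral_comp_sub_right (fun t => t ^ (-β)) t₀, sub_self,
          integral_rpow (Or.inl (by linarith)), show -β + 1 = 1 - β by ring,
          Real.zero_rpow (by linarith)]
        field_simp
        ring
    _ ≤ _ := by
        gcongr
        · linarith

/-- Let `t₀` be the infimum of the parameters where the line lies in the ball and `ρ ≥ 0`. Growth at
rate `c` gives `ρ ≥ c (t - t₀)` at all such later parameters, so the integral is at most that of a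
one-dimensional negative power. -/
theorem lintegral_line_negPow_le {E : Type*} [NormedAddCommGroup E] [NormedSpace ℝ E]
    {ρ : E → ℝ} {x e : E} {r c β R : ℝ} (hc : 0 < c) (hβ0 : 0 ≤ β) (hβ : β < 1)
    (hRr : R ≤ r)
    (hmono : ∀ y ∈ Metric.ball x r, ∀ t : ℝ, 0 ≤ t → y + t • e ∈ Metric.ball x r →
      ρ y + c * t ≤ ρ (y + t • e)) (y : E) :
    ∫⁻ t in Icc 0 R, (Metric.ball x R).indicator (fun z => negPow β (ρ z)) (y + t • e) ≤
      ENNReal.ofReal (c ^ (-β) / (1 - β) * R ^ (1 - β)) := by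
  set S := {t : ℝ | t ∈ Icc 0 R ∧ y + t • e ∈ Metric.ball x R ∧ 0 ≤ ρ (y + t • e)} with hS
  have hbS : BddBelow S := ⟨0, fun t ht => ht.1.1⟩
  by_cases hne : S.Nonempty
  · have ht₀ : 0 ≤ sInf S := le_csInf hne fun t ht => ht.1.1
    have ht₀R : sInf S ≤ R := by
      obtain ⟨t, ht⟩ := hne
      exact (csInf_le hbS ht).trans ht.1.2
    refine le_trans ?_ (lintegral_Ioc_negPow_le hβ hc ht₀ ht₀R)
    rw [← lintegral_indicator measurableSet_Icc, ← lintegral_indicator measurableSet_Icc]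
    refine lintegral_mono fun t => ?_
    by_cases ht : t ∈ S
    · have ht0 : sInf S ≤ t := csInf_le hbS ht
      rw [indicator_of_mem ht.1, indicator_of_mem (show t ∈ Icc (sInf S) R from ⟨ht0, ht.1.2⟩),
        indicator_of_mem ht.2.1, negPow, if_pos ht.2.2]
      refine ennreal_rpow_neg_anti (ENNReal.ofReal_le_ofReal ?_) hβ0
      have h1 : t - ρ (y + t • e) / c ≤ sInf S := by
        refine le_csInf hne fun t' ht' => ?_
        rcases le_or_gt t t' with h | h
        · have : 0 ≤ ρ (y + t • e) / c := div_nonneg ht.2.2 hc.le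
          linarith
        · have hsub : Metric.ball x R ⊆ Metric.ball x r := Metric.ball_subset_ball hRr
          have e1 : y + t' • e + (t - t') • e = y + t • e := by
            rw [add_assoc, ← add_smul]; congr 2; ring
          have h2 := hmono (y + t' • e) (hsub ht'.2.1) (t - t') (by linarith)
            (by rw [e1]; exact hsub ht.2.1)
          rw [e1] at h2
          have h3 : t - t' ≤ ρ (y + t • e) / c := by
            rw [le_div_iff₀ hc]
            linarith [ht'.2.2]
          linarith
      have h2 : t - sInf S ≤ ρ (y + t • e) / c := by linarith
      rwa [le_div_iff₀ hc, mul_comm] at h2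
    · have : (Icc 0 R).indicator (fun t => (Metric.ball x R).indicator
          (fun z => negPow β (ρ z)) (y + t • e)) t = 0 := by
        by_cases h1 : t ∈ Icc 0 R
        · rw [indicator_of_mem h1]
          by_cases h2 : y + t • e ∈ Metric.ball x R
          · rw [indicator_of_mem h2, negPow, if_neg]
            exact fun h => ht ⟨h1, h2, h⟩
          · rw [indicator_of_notMem h2]
        · rw [indicator_of_notMem h1]
      rw [this]
      exact zero_le
  · rw [not_nonempty_iff_eq_empty] at hne
    refine le_of_eq_of_le ?_ zero_le
    refine (setLIntegral_congr_fun measurableSet_Icc fun t ht => ?_).trans lintegral_zero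
    by_cases h2 : y + t • e ∈ Metric.ball x R
    · rw [indicator_of_mem h2, negPow, if_neg]
      intro h
      have : t ∈ S := ⟨ht, h2, h⟩
      rw [hne] at this
      exact this
    · exact indicator_of_notMem h2 _

/-- A negative power of a function increasing at a definite rate in one direction is integrable,
with the scaling of the integral of a negative power of a coordinate. -/
theorem lintegral_ball_negPow_le {N : ℕ} {ρ : 𝔼 N → ℝ} (hρ : Measurable ρ) {x e : 𝔼 N}
    (he : ‖e‖ = 1) {r c β R : ℝ} (hc : 0 < c) (hβ0 : 0 ≤ β) (hβ : β < 1) (hR : 0 < R) (hRr : R ≤ r)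
    (hmono : ∀ y ∈ Metric.ball x r, ∀ t : ℝ, 0 ≤ t → y + t • e ∈ Metric.ball x r →
      ρ y + c * t ≤ ρ (y + t • e)) :
    ∫⁻ y in Metric.ball x R, negPow β (ρ y) ≤
      volume (Metric.ball (0 : 𝔼 N) 1) *
        ENNReal.ofReal (c ^ (-β) / (1 - β) * 2 ^ N * R ^ ((N : ℝ) - β)) := by
  set h : 𝔼 N → ℝ≥0∞ := (Metric.ball x R).indicator fun z => negPow β (ρ z) with hh
  have hm : Measurable h := ((measurable_negPow β).comp hρ).indicator measurableSet_ball
  -- Translation invariance replaces the integral by its average over translates along `e`, which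
  -- turns the line estimate into an estimate on the ball without changing coordinates.
  have h1 : ENNReal.ofReal R * ∫⁻ y in Metric.ball x R, negPow β (ρ y) =
      ∫⁻ y, ∫⁻ t in Icc 0 R, h (y + t • e) := by
    rw [lintegral_lintegral_swap (by fun_prop)]
    have : ∀ t : ℝ, ∫⁻ y, h (y + t • e) = ∫⁻ y in Metric.ball x R, negPow β (ρ y) := fun t => by
      rw [lintegral_add_right_eq_self h, hh, lintegral_indicator measurableSet_ball]
    simp only [this]
    rw [setLIntegral_const, Real.volume_Icc, sub_zero, mul_comm]
  have h2 : ∫⁻ y, ∫⁻ t in Icc 0 R, h (y + t • e) ≤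
      ENNReal.ofReal (c ^ (-β) / (1 - β) * R ^ (1 - β)) * volume (Metric.ball x (2 * R)) := by
    rw [← setLIntegral_const, ← lintegral_indicator measurableSet_ball]
    refine lintegral_mono fun y => ?_
    by_cases hy : y ∈ Metric.ball x (2 * R)
    · rw [indicator_of_mem hy]
      exact lintegral_line_negPow_le hc hβ0 hβ hRr hmono y
    · rw [indicator_of_notMem hy]
      refine le_of_eq ((setLIntegral_congr_fun measurableSet_Icc fun t ht => ?_).trans
        lintegral_zero)
      refine indicator_of_notMem (fun hyt => hy ?_) _
      rw [Metric.mem_ball] at hyt ⊢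
      calc dist y x ≤ dist y (y + t • e) + dist (y + t • e) x := dist_triangle _ _ _
        _ < t + R := by
          have : dist y (y + t • e) = t := by
            rw [dist_self_add_right, norm_smul, he, mul_one, Real.norm_of_nonneg ht.1]
          linarith
        _ ≤ 2 * R := by linarith [ht.2]
  rw [← h1] at h2
  have hR' : ENNReal.ofReal R ≠ 0 := by simpa using hR
  rw [← ENNReal.mul_le_mul_iff_right hR' ENNReal.ofReal_ne_top]
  refine h2.trans (le_of_eq ?_)
  rw [Measure.addHaar_ball_of_pos volume x (by positivity : 0 < 2 * R), finrank_euclideanSpace_fin,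
    ← mul_assoc, ← ENNReal.ofReal_mul (by
      have : 0 < 1 - β := by linarith
      positivity), mul_left_comm, mul_comm, ← ENNReal.ofReal_mul hR.le]
  congr 2
  rw [mul_pow, show R ^ ((N : ℝ) - β) = R ^ (-1 : ℝ) * (R ^ (1 - β) * R ^ N) by
    rw [← Real.rpow_natCast, ← Real.rpow_add hR, ← Real.rpow_add hR]; congr 1; ring,
    Real.rpow_neg_one]
  field_simp

variable {N : ℕ} {Ω : Set (EuclideanSpace ℝ (Fin N))} {ρ : EuclideanSpace ℝ (Fin N) → ℝ}
  {L C H c₀ d₀ r₁ : ℝ}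

namespace IsQuantDefining

theorem continuous (h : IsQuantDefining Ω ρ L C H c₀ d₀ r₁) : Continuous ρ := h.contDiff.continuous

theorem lintegral_ball_lt_top (h : IsQuantDefining Ω ρ L C H c₀ d₀ r₁) {β : ℝ} (hβ0 : 0 ≤ β)
    (hβ : β < 1) {x : 𝔼 N} (hx : x ∈ frontier Ω) :
    ∫⁻ y in Metric.ball x r₁, negPow β (ρ y) < ⊤ := by
  obtain ⟨e, he, hinc⟩ := h.increasing x (frontier_subset_closure hx)
    (by rw [h.eq_zero x hx]; exact h.d₀_pos)
  refine (lintegral_ball_negPow_le h.continuous.measurable he h.c₀_pos hβ0 hβ h.r₁_pos le_rfl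
    hinc).trans_lt ?_
  exact ENNReal.mul_lt_top measure_ball_lt_top ENNReal.ofReal_lt_top

/-- The extended power `negPow` is infinite where `ρ = 0`, and its integral on balls about frontier
points is finite. The zero set of `ρ` is therefore locally null near the frontier. -/
theorem volume_frontier (h : IsQuantDefining Ω ρ L C H c₀ d₀ r₁) : volume (frontier Ω) = 0 := by
  refine measure_null_of_locally_null _ fun x hx => ?_
  refine ⟨Metric.ball x r₁ ∩ frontier Ω, inter_mem (mem_nhdsWithin_of_mem_nhds
    (Metric.ball_mem_nhds _ h.r₁_pos)) self_mem_nhdsWithin, ?_⟩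
  have h1 := h.lintegral_ball_lt_top (β := 1 / 2) (by norm_num) (by norm_num) hx
  have h2 := ae_lt_top ((measurable_negPow (1 / 2)).comp h.continuous.measurable) h1.ne
  rw [ae_restrict_iff' measurableSet_ball, ae_iff] at h2
  refine measure_mono_null (fun y hy => ?_) h2
  simp only [mem_ofPred_eq, Classical.not_imp]
  refine ⟨hy.1, ?_⟩
  simp [negPow, h.eq_zero y hy.2]

theorem lintegral_posRpow_lt_top (h : IsQuantDefining Ω ρ L C H c₀ d₀ r₁) {β : ℝ} (hβ0 : 0 ≤ β)
    (hβ : β < 1) : ∫⁻ y, ENNReal.ofReal (posRpow (-β) (ρ y)) < ⊤ := by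
  have hcl : IsCompact (closure Ω) :=
    Metric.isCompact_of_isClosed_isBounded isClosed_closure h.isBounded.closure
  have h1 : ∫⁻ y, ENNReal.ofReal (posRpow (-β) (ρ y)) =
      ∫⁻ y in closure Ω, ENNReal.ofReal (posRpow (-β) (ρ y)) := by
    rw [← lintegral_indicator isClosed_closure.measurableSet]
    refine lintegral_congr fun y => ?_
    by_cases hy : y ∈ closure Ω
    · rw [indicator_of_mem hy]
    · rw [indicator_of_notMem hy, posRpow_of_nonpos, ENNReal.ofReal_zero]
      exact not_lt.1 fun hp => hy (subset_closure ((h.mem_iff y).2 hp))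
  rw [h1]
  refine hcl.induction_on (p := fun s => ∫⁻ y in s, ENNReal.ofReal (posRpow (-β) (ρ y)) < ⊤)
    (by simp) (fun s t hst ht => (lintegral_mono_set hst).trans_lt ht)
    (fun s t hs ht => (lintegral_union_le _ _ _).trans_lt (ENNReal.add_lt_top.2 ⟨hs, ht⟩)) ?_
  intro x hx
  by_cases hxΩ : x ∈ Ω
  · have hx0 := (h.mem_iff x).1 hxΩ
    have hev : ∀ᶠ y in 𝓝 x, ρ x / 2 < ρ y :=
      h.continuous.continuousAt.eventually (lt_mem_nhds (by linarith))
    obtain ⟨r, hr, hrs⟩ := Metric.mem_nhds_iff.1 hev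
    refine ⟨Metric.ball x r, mem_nhdsWithin_of_mem_nhds (Metric.ball_mem_nhds _ hr), ?_⟩
    calc _ ≤ ∫⁻ y in Metric.ball x r, ENNReal.ofReal ((ρ x / 2) ^ (-β)) := by
          refine setLIntegral_mono' measurableSet_ball fun y hy => ENNReal.ofReal_le_ofReal ?_
          have hy : ρ x / 2 < ρ y := hrs hy
          rw [posRpow_of_pos (by linarith)]
          exact Real.rpow_le_rpow_of_nonpos (by linarith) hy.le (by linarith)
      _ < ⊤ := by
          rw [setLIntegral_const]
          exact ENNReal.mul_lt_top ENNReal.ofReal_lt_top measure_ball_lt_top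
  · have hxf : x ∈ frontier Ω := ⟨hx, by rwa [h.isOpen.interior_eq]⟩
    refine ⟨Metric.ball x r₁, mem_nhdsWithin_of_mem_nhds (Metric.ball_mem_nhds _ h.r₁_pos), ?_⟩
    exact (lintegral_mono fun y => ofReal_posRpow_le_negPow β (ρ y)).trans_lt
      (h.lintegral_ball_lt_top hβ0 hβ hxf)

theorem integrable_posRpow (h : IsQuantDefining Ω ρ L C H c₀ d₀ r₁) {σ : ℝ} (hσ : -1 < σ)
    (hσ0 : σ ≤ 0) : Integrable fun y => posRpow σ (ρ y) := by
  refine ⟨((measurable_posRpow σ).comp h.continuous.measurable).aestronglyMeasurable, ?_⟩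
  rw [hasFiniteIntegral_iff_ofReal (.of_forall fun y => posRpow_nonneg _ _)]
  simpa using h.lintegral_posRpow_lt_top (β := -σ) (by linarith) (by linarith)

/-- Growth of the mass of `ρ^{-β}` in balls of radius comparable with `ρ` at the centre or more. -/
theorem exists_growth (h : IsQuantDefining Ω ρ L C H c₀ d₀ r₁) (hN : 1 ≤ N) {β κ : ℝ}
    (hβ0 : 0 ≤ β) (hβ : β < 1) (hκ : 0 < κ) :
    ∃ B : ℝ≥0∞, B ≠ ⊤ ∧ ∀ x ∈ Ω, ∀ R, κ * ρ x < R →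
      ∫⁻ z in Metric.ball 0 R, ENNReal.ofReal (posRpow (-β) (ρ (x + z))) ≤
        B * ENNReal.ofReal (R ^ ((N : ℝ) - β)) := by
  have hN' : (1 : ℝ) ≤ N := by exact_mod_cast hN
  set T := ∫⁻ y, ENNReal.ofReal (posRpow (-β) (ρ y)) with hT
  have hTtop : T ≠ ⊤ := (h.lintegral_posRpow_lt_top hβ0 hβ).ne
  set m := min r₁ (κ * d₀) with hm
  have hm0 : 0 < m := lt_min h.r₁_pos (mul_pos hκ h.d₀_pos)
  set A := volume (Metric.ball (0 : 𝔼 N) 1) * ENNReal.ofReal (c₀ ^ (-β) / (1 - β) * 2 ^ N) with hA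
  have hAtop : A ≠ ⊤ := ENNReal.mul_ne_top measure_ball_lt_top.ne ENNReal.ofReal_ne_top
  refine ⟨A + T * ENNReal.ofReal (m ^ (-((N : ℝ) - β))), ENNReal.add_ne_top.2 ⟨hAtop,
    ENNReal.mul_ne_top hTtop ENNReal.ofReal_ne_top⟩, fun x hx R hR => ?_⟩
  have hx0 := (h.mem_iff x).1 hx
  have hR0 : 0 < R := (mul_pos hκ hx0).trans hR
  have htr : ∫⁻ z in Metric.ball 0 R, ENNReal.ofReal (posRpow (-β) (ρ (x + z))) =
      ∫⁻ y in Metric.ball x R, ENNReal.ofReal (posRpow (-β) (ρ y)) := by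
    rw [← lintegral_indicator measurableSet_ball, ← lintegral_indicator measurableSet_ball]
    conv_rhs => rw [← lintegral_add_left_eq_self _ x]
    refine lintegral_congr fun z => ?_
    simp [indicator]
  rw [htr]
  -- Otherwise `R` is bounded below by `m`, and the finite total mass `T` is already of the required
  -- form.
  by_cases hc : ρ x < d₀ ∧ R ≤ r₁
  · obtain ⟨e, he, hinc⟩ := h.increasing x (subset_closure hx) hc.1
    calc _ ≤ ∫⁻ y in Metric.ball x R, negPow β (ρ y) :=
          lintegral_mono fun y => ofReal_posRpow_le_negPow β (ρ y)
      _ ≤ _ := lintegral_ball_negPow_le h.continuous.measurable he h.c₀_pos hβ0 hβ hR0 hc.2 hinc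
      _ = A * ENNReal.ofReal (R ^ ((N : ℝ) - β)) := by
          have : 0 < 1 - β := by linarith
          have := h.c₀_pos
          rw [ENNReal.ofReal_mul (by positivity), hA, mul_assoc]
      _ ≤ _ := by gcongr; exact le_self_add
  · have hmR : m ≤ R := by
      rw [not_and_or, not_lt, not_le] at hc
      rcases hc with hc | hc
      · exact (min_le_right _ _).trans ((mul_le_mul_of_nonneg_left hc hκ.le).trans hR.le)
      · exact (min_le_left _ _).trans hc.le
    calc _ ≤ T := setLIntegral_le_lintegral _ _
      _ ≤ T * ENNReal.ofReal (m ^ (-((N : ℝ) - β))) * ENNReal.ofReal (R ^ ((N : ℝ) - β)) := by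
          rw [mul_assoc, ← ENNReal.ofReal_mul (by positivity)]
          refine le_mul_of_one_le_right zero_le ?_
          rw [ENNReal.one_le_ofReal, Real.rpow_neg hm0.le, inv_mul_eq_div, one_le_div (by positivity)]
          exact Real.rpow_le_rpow hm0.le hmR (by linarith)
      _ ≤ _ := by gcongr; exact le_add_self

/-- The tails of `ρ^{-β}` integrated against a power of the distance. -/
theorem exists_tail (h : IsQuantDefining Ω ρ L C H c₀ d₀ r₁) (hN : 1 ≤ N) {β κ q : ℝ}
    (hβ0 : 0 ≤ β) (hβ : β < 1) (hκ : 0 < κ) (hq : (N : ℝ) - β < q) :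
    ∃ B : ℝ, 0 ≤ B ∧ ∀ x ∈ Ω,
      ∫⁻ z in (Metric.ball 0 (κ * ρ x))ᶜ,
        ENNReal.ofReal (posRpow (-β) (ρ (x + z))) * ENNReal.ofReal (‖z‖ ^ (-q)) ≤
        ENNReal.ofReal (B * ρ x ^ ((N : ℝ) - β - q)) := by
  have hN' : (1 : ℝ) ≤ N := by exact_mod_cast hN
  obtain ⟨B, hB, hgr⟩ := h.exists_growth hN hβ0 hβ hκ
  have hq0 : 0 < q - (N - β) := by linarith
  have hq1 : 0 < q := by linarith
  refine ⟨B.toReal * (q / (q - (N - β)) * κ ^ ((N : ℝ) - β - q)), by positivity, fun x hx => ?_⟩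
  have hx0 := (h.mem_iff x).1 hx
  have hm : Measurable fun z => ENNReal.ofReal (posRpow (-β) (ρ (x + z))) := by
    have := measurable_posRpow (-β)
    have := h.continuous.measurable
    fun_prop
  refine (lintegral_compl_ball_mul_norm_rpow_le volume hm (mul_pos hκ hx0) hq1 hq
    (hgr x hx)).trans (le_of_eq ?_)
  rw [Real.mul_rpow hκ.le hx0.le, ← mul_assoc, mul_assoc B.toReal, ENNReal.ofReal_mul (p := B.toReal)
    ENNReal.toReal_nonneg, ENNReal.ofReal_toReal hB]

end IsQuantDefining

end

/-! ### Kernels and second differences -/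

namespace IsStableKernel

variable {N : ℕ} {s γ Γ : ℝ} {K : EuclideanSpace ℝ (Fin N) → ℝ}

theorem measurable (hK : IsStableKernel s γ Γ K) : Measurable K := by
  obtain ⟨a, ha, -, haK⟩ := hK.stable
  refine measurable_of_measurable_on_compl_singleton 0 ?_
  have h1 : Measurable fun x : ({0}ᶜ : Set (𝔼 N)) =>
      a (homeomorphUnitSphereProd (𝔼 N) x).1 /
        ((homeomorphUnitSphereProd (𝔼 N) x).2 : ℝ) ^ ((N : ℝ) + 2 * s) := by
    have := (homeomorphUnitSphereProd (𝔼 N)).measurable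
    fun_prop
  have h0 : (fun x : ({0}ᶜ : Set (𝔼 N)) => K x) = fun x : ({0}ᶜ : Set (𝔼 N)) =>
      a (homeomorphUnitSphereProd (𝔼 N) x).1 /
        ((homeomorphUnitSphereProd (𝔼 N) x).2 : ℝ) ^ ((N : ℝ) + 2 * s) := ?_
  · rw [← h0] at h1
    exact h1
  funext x
  have hx : 0 < ‖(x : 𝔼 N)‖ := norm_pos_iff.2 x.2
  have h2 := haK (homeomorphUnitSphereProd (𝔼 N) x).1 ‖(x : 𝔼 N)‖ hx
  simp only [homeomorphUnitSphereProd_apply_snd_coe]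
  rw [← h2]
  simp [smul_smul, hx.ne']

theorem bounds (hK : IsStableKernel s γ Γ K) {z : 𝔼 N} (hz : z ≠ 0) :
    γ * ‖z‖ ^ (-((N : ℝ) + 2 * s)) ≤ K z ∧ K z ≤ Γ * ‖z‖ ^ (-((N : ℝ) + 2 * s)) := by
  obtain ⟨a, -, hab, haK⟩ := hK.stable
  have hz0 : 0 < ‖z‖ := norm_pos_iff.2 hz
  have h2 := haK ⟨‖z‖⁻¹ • z, by simp [norm_smul, hz0.ne']⟩ ‖z‖ hz0
  simp only [smul_smul, mul_inv_cancel₀ hz0.ne', one_smul] at h2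
  rw [h2, div_eq_mul_inv, ← Real.rpow_neg hz0.le]
  exact ⟨mul_le_mul_of_nonneg_right (hab _).1 (by positivity),
    mul_le_mul_of_nonneg_right (hab _).2 (by positivity)⟩

theorem pos (hK : IsStableKernel s γ Γ K) (hγ : 0 < γ) {z : 𝔼 N} (hz : z ≠ 0) : 0 < K z := by
  have : 0 < ‖z‖ := norm_pos_iff.2 hz
  exact lt_of_lt_of_le (by positivity) (hK.bounds hz).1

end IsStableKernel

/-- The second difference `v(x + z) + v(x - z) - 2 v(x)`. -/
def secondDiff {N : ℕ} (v : 𝔼 N → ℝ) (x z : 𝔼 N) : ℝ := v (x + z) + v (x - z) - 2 * v x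

section

variable {N : ℕ} {s γ Γ : ℝ} {K : EuclideanSpace ℝ (Fin N) → ℝ}

theorem integrableOn_kernel_compl_ball (hN : 1 ≤ N) (hs : 0 < s) (hγ : 0 < γ)
    (hK : IsStableKernel s γ Γ K) {r : ℝ} (hr : 0 < r) :
    IntegrableOn K (Metric.ball 0 r)ᶜ := by
  refine ((integrableOn_compl_ball_norm_rpow hN (q := -((N : ℝ) + 2 * s)) (by linarith) hr).const_mul
    Γ).mono' hK.measurable.aestronglyMeasurable ?_
  filter_upwards [ae_restrict_mem measurableSet_ball.compl] with z hz
  have hz0 : z ≠ 0 := fun h => hz (by simpa [h] using hr)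
  rw [Real.norm_of_nonneg (hK.pos hγ hz0).le]
  exact (hK.bounds hz0).2

theorem integrableOn_secondDiff_mul_ball (hN : 1 ≤ N) (hs1 : s < 1)
    (hγ : 0 < γ) (hK : IsStableKernel s γ Γ K) {v : 𝔼 N → ℝ} {x : 𝔼 N} {C r : ℝ} (hC : 0 ≤ C)
    (hm : AEStronglyMeasurable (secondDiff v x) (volume.restrict (Metric.ball 0 r)))
    (hv : ∀ z, ‖z‖ < r → |secondDiff v x z| ≤ C * ‖z‖ ^ 2) :
    IntegrableOn (fun z => secondDiff v x z * K z) (Metric.ball 0 r) := by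
  refine ((integrableOn_ball_norm_rpow hN (q := 2 - ((N : ℝ) + 2 * s)) (by linarith) r).const_mul
    (C * Γ)).mono' (hm.mul hK.measurable.aestronglyMeasurable) ?_
  filter_upwards [ae_restrict_mem measurableSet_ball] with z hz
  rw [mem_ball_zero_iff] at hz
  rcases eq_or_ne z 0 with rfl | hz0
  · have : secondDiff v x 0 = 0 := by simp [secondDiff]; ring
    rw [this, zero_mul, norm_zero, norm_zero]
    have h0 : ∃ w : 𝔼 N, w ≠ 0 := by
      have : Nonempty (Fin N) := ⟨⟨0, hN⟩⟩
      exact exists_ne 0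
    obtain ⟨w, hw⟩ := h0
    have hb := hK.bounds hw
    have hw0 : 0 < ‖w‖ := norm_pos_iff.2 hw
    have hΓ : 0 ≤ Γ := by
      by_contra hn
      have := hK.pos hγ hw
      have : Γ * ‖w‖ ^ (-((N : ℝ) + 2 * s)) ≤ 0 :=
        mul_nonpos_of_nonpos_of_nonneg (not_le.1 hn).le (by positivity)
      linarith
    positivity
  · have hn : 0 < ‖z‖ := norm_pos_iff.2 hz0
    rw [norm_mul, Real.norm_of_nonneg (hK.pos hγ hz0).le, Real.norm_eq_abs]
    calc _ ≤ (C * ‖z‖ ^ 2) * (Γ * ‖z‖ ^ (-((N : ℝ) + 2 * s))) := by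
          gcongr
          · exact (hK.pos hγ hz0).le
          · exact hv z hz
          · exact (hK.bounds hz0).2
      _ = _ := by
          rw [show 2 - ((N : ℝ) + 2 * s) = ((2 : ℕ) : ℝ) + -((N : ℝ) + 2 * s) by push_cast; ring,
            Real.rpow_add hn, Real.rpow_natCast]
          ring

/-- Near the origin the quadratic bound leaves the exponent `2 - N - 2 * s > -N`. Far from it the
kernel is bounded and integrable, and `v` is integrable. -/
theorem integrable_secondDiff_mul (hN : 1 ≤ N) (hs : 0 < s) (hs1 : s < 1) (hγ : 0 < γ)
    (hK : IsStableKernel s γ Γ K) {v : 𝔼 N → ℝ} (hv : Integrable v) {x : 𝔼 N}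
    (hvx : ContDiffAt ℝ 2 v x) : Integrable fun z => secondDiff v x z * K z := by
  obtain ⟨C, hC, r, hr, hCr⟩ := exists_abs_secondDiff_le hvx
  have i1 : Integrable fun z => v (x + z) := hv.comp_add_left x
  have i2 : Integrable fun z => v (x - z) := hv.comp_sub_left x
  have hm : AEStronglyMeasurable (secondDiff v x) volume :=
    (i1.aestronglyMeasurable.add i2.aestronglyMeasurable).sub aestronglyMeasurable_const
  have h1 := integrableOn_secondDiff_mul_ball hN hs1 hγ hK hC hm.restrict hCr
  have hKi := integrableOn_kernel_compl_ball hN hs hγ hK hr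
  have hprod : ∀ f : 𝔼 N → ℝ, Integrable f →
      IntegrableOn (fun z => f z * K z) (Metric.ball 0 r)ᶜ := by
    intro f hf
    refine (hf.norm.const_mul (Γ * r ^ (-((N : ℝ) + 2 * s)))).integrableOn.mono'
      (hf.aestronglyMeasurable.restrict.mul hK.measurable.aestronglyMeasurable) ?_
    filter_upwards [ae_restrict_mem measurableSet_ball.compl] with z hz
    have hz0 : z ≠ 0 := fun h => hz (by simpa [h] using hr)
    have hzr : r ≤ ‖z‖ := by simpa using hz
    have hΓ : 0 ≤ Γ := by
      by_contra hn
      have := hK.pos hγ hz0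
      have : Γ * ‖z‖ ^ (-((N : ℝ) + 2 * s)) ≤ 0 :=
        mul_nonpos_of_nonpos_of_nonneg (not_le.1 hn).le (by positivity)
      linarith [(hK.bounds hz0).2]
    rw [norm_mul, Real.norm_of_nonneg (hK.pos hγ hz0).le, mul_comm]
    gcongr
    refine (hK.bounds hz0).2.trans ?_
    exact mul_le_mul_of_nonneg_left (Real.rpow_le_rpow_of_nonpos hr hzr (by
      have : (0 : ℝ) ≤ N := N.cast_nonneg
      linarith)) hΓ
  have h2 : IntegrableOn (fun z => secondDiff v x z * K z) (Metric.ball 0 r)ᶜ := by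
    have := ((hprod _ i1).add (hprod _ i2)).sub (hKi.const_mul (2 * v x))
    refine this.congr (.of_forall fun z => ?_)
    simp only [secondDiff, Pi.add_apply, Pi.sub_apply]
    ring
  rw [← integrableOn_univ, ← union_compl_self (Metric.ball (0 : 𝔼 N) r)]
  exact h1.union h2

end

/-! ### Linearization of powers of the defining function -/

/-- Comparison of powers of two nearby numbers. -/
theorem posRpow_le_posRpow_add {σ t l Q : ℝ} (hσ : -1 < σ) (hσ0 : σ ≤ 0) (h : |t - l| ≤ Q) :
    posRpow σ t ≤ posRpow σ l + 2 * (posRpow (σ - 1) t * min t Q) := by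
  have hQ : 0 ≤ Q := (abs_nonneg _).trans h
  rcases le_or_gt t 0 with ht | ht
  · rw [posRpow_of_nonpos ht, posRpow_of_nonpos ht, zero_mul, mul_zero, add_zero]
    exact posRpow_nonneg _ _
  have e1 : t ^ σ = t ^ (σ - 1) * t := by
    rw [← Real.rpow_add_one ht.ne']; congr 1; ring
  have hp : 0 < t ^ (σ - 1) := by positivity
  rw [posRpow_of_pos ht, posRpow_of_pos ht]
  -- If `t ≤ 2 * Q`, the error term alone dominates `t ^ σ`. Otherwise `l` is positive and
  -- comparable with `t`, and the two powers can be compared directly.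
  rcases le_or_gt t (2 * Q) with h2 | h2
  · have : t / 2 ≤ min t Q := le_min (by linarith) (by linarith)
    have h3 : t ^ (σ - 1) * (t / 2) ≤ t ^ (σ - 1) * min t Q := by gcongr
    have := posRpow_nonneg σ l
    rw [e1]
    linarith
  · rw [min_eq_right (by linarith)]
    have hl := abs_le.1 h
    have hl0 : 0 < l := by linarith
    rw [posRpow_of_pos hl0]
    rcases le_or_gt l t with hlt | hlt
    · have := Real.rpow_le_rpow_of_nonpos hl0 hlt hσ0
      have : 0 ≤ 2 * (t ^ (σ - 1) * Q) := by positivity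
      linarith
    · have hx : 0 < l / t := by positivity
      -- With `x = l / t > 1`, the bound `σ > -1` gives `x ^ σ ≥ x⁻¹ ≥ 2 - x`, which plays the role
      -- of a tangent-line inequality.
      have h4 : 1 - l / t ≤ (l / t) ^ σ - 1 := by
        have h5 : (l / t) ^ (-σ) ≤ l / t := by
          have : 1 ≤ l / t := by rw [one_le_div ht]; exact hlt.le
          calc (l / t) ^ (-σ) ≤ (l / t) ^ (1 : ℝ) :=
                Real.rpow_le_rpow_of_exponent_le this (by linarith)
            _ = _ := Real.rpow_one _
        have h6 : (l / t)⁻¹ ≤ (l / t) ^ σ := by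
          rw [show σ = -(-σ) by ring, Real.rpow_neg hx.le]
          exact inv_anti₀ (by positivity) h5
        have h7 : 2 - l / t ≤ (l / t)⁻¹ := by
          rw [← sub_nonneg]
          have : (l / t)⁻¹ - (2 - l / t) = (l / t - 1) ^ 2 * (l / t)⁻¹ := by
            field_simp; ring
          rw [this]; positivity
        linarith
      have h5 : l ^ σ = t ^ σ * (l / t) ^ σ := by
        rw [← Real.mul_rpow ht.le hx.le]; congr 1; field_simp
      have h6 : t ^ σ * (1 - l / t) ≤ t ^ σ * ((l / t) ^ σ - 1) := by gcongr
      have h7 : t ^ σ * (1 - l / t) = -(t ^ (σ - 1) * (l - t)) := by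
        rw [e1]; field_simp; ring
      have h8 : t ^ (σ - 1) * (l - t) ≤ t ^ (σ - 1) * Q := by
        gcongr; linarith
      have h9 : 0 ≤ t ^ (σ - 1) * Q := by positivity
      rw [h5]
      linarith

theorem posRpow_mul {σ d t : ℝ} (hd : 0 < d) : posRpow σ (d * t) = d ^ σ * posRpow σ t := by
  rcases le_or_gt t 0 with ht | ht
  · rw [posRpow_of_nonpos ht, posRpow_of_nonpos (mul_nonpos_of_nonneg_of_nonpos hd.le ht), mul_zero]
  · rw [posRpow_of_pos ht, posRpow_of_pos (by positivity), Real.mul_rpow hd.le ht.le]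

theorem posRpow_add_sub {σ d w : ℝ} (hd : 0 < d) :
    posRpow σ (d + w) + posRpow σ (d - w) - 2 * d ^ σ = d ^ σ * rpowSecondDiff σ |d⁻¹ * w| := by
  have h : ∀ w, posRpow σ (d + w) = d ^ σ * posRpow σ (1 + d⁻¹ * w) := fun w => by
    rw [← posRpow_mul hd]; congr 1; field_simp
  have h1 := h w
  have h2 := h (-w)
  rw [← sub_eq_add_neg] at h2
  rw [h1, h2, rpowSecondDiff]
  rcases abs_cases (d⁻¹ * w) with ⟨e, -⟩ | ⟨e, -⟩ <;> rw [e]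
  · rw [show 1 + d⁻¹ * -w = 1 - d⁻¹ * w by ring]; ring
  · rw [show 1 + d⁻¹ * -w = 1 + -(d⁻¹ * w) by ring, sub_neg_eq_add]; ring

/-- The average of `|⟨p, θ⟩|^{2s}` over the unit sphere, up to normalization. -/
def sphereMoment {N : ℕ} (s : ℝ) (p : 𝔼 N) : ℝ :=
  ∫ θ, |inner ℝ p (θ : 𝔼 N)| ^ (2 * s) ∂(volume : Measure (𝔼 N)).toSphere

theorem sphereMoment_nonneg {N : ℕ} (s : ℝ) (p : 𝔼 N) : 0 ≤ sphereMoment s p :=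
  integral_nonneg fun θ => by positivity

/-- The operator applied to the power of an affine function. -/
theorem integral_affine_posRpow_le {N : ℕ} (hN : 1 ≤ N) {s γ Γ σ : ℝ} (hs : 0 < s) (hs1 : s < 1)
    (hγ : 0 < γ) {K : 𝔼 N → ℝ} (hK : IsStableKernel s γ Γ K) (hσ : -1 < σ) (hσ0 : σ ≤ 0)
    (hJ : rpowConst s σ ≤ 0) (p : 𝔼 N) {d : ℝ} (hd : 0 < d) :
    Integrable (fun z => (posRpow σ (d + inner ℝ p z) + posRpow σ (d - inner ℝ p z)
      - 2 * d ^ σ) * K z) ∧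
    ∫ z, (posRpow σ (d + inner ℝ p z) + posRpow σ (d - inner ℝ p z) - 2 * d ^ σ) * K z ≤
      γ * rpowConst s σ * sphereMoment s p * d ^ (σ - 2 * s) := by
  obtain ⟨a, ha, hab, haK⟩ := hK.stable
  have habs : ∀ θ, |a θ| ≤ Γ := fun θ => by
    rw [abs_of_nonneg (hγ.le.trans (hab θ).1)]; exact (hab θ).2
  obtain ⟨h1, h2⟩ := integrable_comp_inner_mul_kernel hN hs ha habs haK
    (measurable_rpowSecondDiff σ) (rpowSecondDiff_zero σ)
    (integrableOn_rpowSecondDiff_mul hs hs1 hσ hσ0) (d⁻¹ • p)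
  have hf : ∀ z, (posRpow σ (d + inner ℝ p z) + posRpow σ (d - inner ℝ p z) - 2 * d ^ σ) * K z =
      d ^ σ * (rpowSecondDiff σ |inner ℝ (d⁻¹ • p) z| * K z) := fun z => by
    rw [posRpow_add_sub hd, real_inner_smul_left, mul_assoc]
  simp only [hf]
  refine ⟨h1.const_mul _, ?_⟩
  rw [integral_const_mul, h2]
  have hi : ∀ p : 𝔼 N, Integrable (fun θ : Metric.sphere (0 : 𝔼 N) 1 =>
      |inner ℝ p (θ : 𝔼 N)| ^ (2 * s)) (volume : Measure (𝔼 N)).toSphere := fun p => by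
    refine (integrable_const (‖p‖ ^ (2 * s))).mono' (by fun_prop : Measurable _).aestronglyMeasurable
      (.of_forall fun θ => ?_)
    rw [Real.norm_of_nonneg (by positivity)]
    gcongr
    simpa using abs_real_inner_le_norm p (θ : 𝔼 N)
  have hge : γ * (d ^ (-(2 * s)) * sphereMoment s p) ≤
      ∫ θ, a θ * |inner ℝ (d⁻¹ • p) (θ : 𝔼 N)| ^ (2 * s) ∂(volume : Measure (𝔼 N)).toSphere := by
    rw [sphereMoment, ← integral_const_mul, ← integral_const_mul]
    refine integral_mono (((hi p).const_mul _).const_mul _) ?_ fun θ => ?_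
    · refine ((hi (d⁻¹ • p)).const_mul Γ).mono' (by fun_prop : Measurable _).aestronglyMeasurable
        (.of_forall fun θ => ?_)
      rw [Real.norm_eq_abs, abs_mul, abs_of_nonneg (a := |_| ^ _) (by positivity)]
      gcongr
      exact habs θ
    · simp only
      rw [real_inner_smul_left, abs_mul, abs_of_pos (inv_pos.2 hd),
        Real.mul_rpow (by positivity) (by positivity), Real.inv_rpow hd.le, ← Real.rpow_neg hd.le]
      exact mul_le_mul_of_nonneg_right (hab θ).1 (by positivity)
  -- Because `rpowConst s σ ≤ 0`, an upper bound for the operator needs the lower bound `a ≥ γ` on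
  -- the angular factor.
  calc _ ≤ d ^ σ * ((γ * (d ^ (-(2 * s)) * sphereMoment s p)) * rpowConst s σ) := by
        exact mul_le_mul_of_nonneg_left (mul_le_mul_of_nonpos_right hge hJ) (by positivity)
    _ = _ := by
        rw [sub_eq_add_neg, Real.rpow_add hd]; ring

namespace IsQuantDefining

variable {N : ℕ} {Ω : Set (EuclideanSpace ℝ (Fin N))} {ρ : EuclideanSpace ℝ (Fin N) → ℝ}
  {L C H c₀ d₀ r₁ : ℝ}

theorem contDiffAt_posRpow (h : IsQuantDefining Ω ρ L C H c₀ d₀ r₁) (σ : ℝ) {x : 𝔼 N}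
    (hx : x ∈ Ω) : ContDiffAt ℝ 2 (fun y => posRpow σ (ρ y)) x := by
  have hx0 := (h.mem_iff x).1 hx
  have h1 : ContDiffAt ℝ 2 (fun y => ρ y ^ σ) x :=
    h.contDiff.contDiffAt.rpow_const_of_ne hx0.ne'
  refine h1.congr_of_eventuallyEq ?_
  filter_upwards [h.isOpen.mem_nhds hx] with y hy
  exact posRpow_of_pos ((h.mem_iff y).1 hy)

/-- The error made in replacing `ρ` by its affine Taylor polynomial. -/
def linError (C σ : ℝ) (ρ : 𝔼 N → ℝ) (x z : 𝔼 N) : ℝ :=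
  2 * (posRpow (σ - 1) (ρ (x + z)) * min (ρ (x + z)) (C * ‖z‖ ^ 2))

theorem linError_nonneg (hC : 0 < C) (σ : ℝ) (ρ : 𝔼 N → ℝ) (x z : 𝔼 N) :
    0 ≤ linError C σ ρ x z := by
  unfold linError
  rcases le_or_gt (ρ (x + z)) 0 with h | h
  · simp [posRpow_of_nonpos h]
  · have := posRpow_nonneg (σ - 1) (ρ (x + z))
    positivity

theorem measurable_linError (h : IsQuantDefining Ω ρ L C H c₀ d₀ r₁) (σ : ℝ) (x : 𝔼 N) :
    Measurable (linError C σ ρ x) := by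
  unfold linError
  have := measurable_posRpow (σ - 1)
  have := h.continuous.measurable
  fun_prop

theorem secondDiff_posRpow_le (h : IsQuantDefining Ω ρ L C H c₀ d₀ r₁) {σ : ℝ} (hσ : -1 < σ)
    (hσ0 : σ ≤ 0) {x : 𝔼 N} (hx : x ∈ Ω) (z : 𝔼 N) :
    secondDiff (fun y => posRpow σ (ρ y)) x z ≤
      (posRpow σ (ρ x + inner ℝ (gradient ρ x) z) + posRpow σ (ρ x - inner ℝ (gradient ρ x) z)
        - 2 * ρ x ^ σ) + (linError C σ ρ x z + linError C σ ρ x (-z)) := by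
  have hx0 := (h.mem_iff x).1 hx
  have h1 := posRpow_le_posRpow_add hσ hσ0 (h.taylor x z)
  have h2 := posRpow_le_posRpow_add hσ hσ0 (h.taylor x (-z))
  rw [inner_neg_right, ← sub_eq_add_neg, ← sub_eq_add_neg] at h2
  simp only [secondDiff, linError]
  rw [posRpow_of_pos hx0]
  rw [← sub_eq_add_neg]
  linarith

/-- The radius is chosen so that the Lipschitz bound keeps `ρ (x + z) ≥ ρ x / 2`: the power is not
singular there and the error is quadratic. -/
theorem linError_near_le (h : IsQuantDefining Ω ρ L C H c₀ d₀ r₁) {σ : ℝ} (hσ0 : σ ≤ 0) {x : 𝔼 N}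
    (hx : x ∈ Ω) {z : 𝔼 N} (hz : ‖z‖ < 1 / (2 * L) * ρ x) :
    linError C σ ρ x z ≤ 2 * (ρ x / 2) ^ (σ - 1) * C * ‖z‖ ^ 2 := by
  have hx0 := (h.mem_iff x).1 hx
  have hL := h.L_pos
  have hC := h.C_pos
  have h1 := h.lipschitz (x + z) x
  rw [add_sub_cancel_left] at h1
  have h2 : L * ‖z‖ ≤ ρ x / 2 := by
    calc L * ‖z‖ ≤ L * (1 / (2 * L) * ρ x) := by gcongr
      _ = ρ x / 2 := by field_simp
  have h3 : ρ x / 2 ≤ ρ (x + z) := by linarith [(abs_le.1 h1).1]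
  have h4 : 0 < ρ (x + z) := by linarith
  rw [linError, posRpow_of_pos h4]
  calc _ ≤ 2 * ((ρ x / 2) ^ (σ - 1) * (C * ‖z‖ ^ 2)) := by
        refine mul_le_mul_of_nonneg_left (mul_le_mul ?_ (min_le_right _ _) ?_ ?_) (by norm_num)
        · exact Real.rpow_le_rpow_of_nonpos (by linarith) h3 (by linarith)
        · exact le_min h4.le (by positivity)
        · positivity
    _ = _ := by ring

/-- Interpolation `min t Q ≤ t ^ (1 - α) * Q ^ α`. The choice `α = 0` would give an error of the
same order as the main term; `α > 0` gains a factor `ρ ^ α`, at the cost of the more singular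
exponent `σ - α`, integrable as long as it exceeds `-1`. -/
theorem linError_far_le (hC : 0 < C) {σ α : ℝ} (hα0 : 0 ≤ α) (hα1 : α ≤ 1) (x z : 𝔼 N) :
    linError C σ ρ x z ≤ 2 * C ^ α * (posRpow (-(α - σ)) (ρ (x + z)) * ‖z‖ ^ (2 * α)) := by
  rcases le_or_gt (ρ (x + z)) 0 with h | h
  · simp [linError, posRpow_of_nonpos h]
  set t := ρ (x + z)
  set Q := C * ‖z‖ ^ 2 with hQ
  have hQ0 : 0 ≤ Q := by positivity
  have h1 : min t Q ≤ t ^ (1 - α) * Q ^ α := by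
    have hm : 0 ≤ min t Q := le_min h.le hQ0
    calc min t Q = (min t Q) ^ (1 - α) * (min t Q) ^ α := by
          rw [← Real.rpow_add_of_nonneg hm (by linarith) hα0]; simp
      _ ≤ _ := by
          exact mul_le_mul (Real.rpow_le_rpow hm (min_le_left _ _) (by linarith))
            (Real.rpow_le_rpow hm (min_le_right _ _) hα0) (by positivity) (by positivity)
  have h2 : Q ^ α = C ^ α * ‖z‖ ^ (2 * α) := by
    rw [hQ, Real.mul_rpow hC.le (by positivity), ← Real.rpow_natCast, ← Real.rpow_mul (norm_nonneg z)]
    norm_num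
  have h3 : t ^ (σ - 1) * t ^ (1 - α) = t ^ (-(α - σ)) := by
    rw [← Real.rpow_add h]; congr 1; ring
  rw [linError, posRpow_of_pos h, posRpow_of_pos h, ← h3]
  calc _ ≤ 2 * (t ^ (σ - 1) * (t ^ (1 - α) * Q ^ α)) := by gcongr
    _ = _ := by rw [h2]; ring

/-- The error in the linearization, integrated against the kernel, is of lower order. -/
theorem exists_lintegral_linError_le (h : IsQuantDefining Ω ρ L C H c₀ d₀ r₁) (hN : 1 ≤ N)
    {s σ α : ℝ} (hs1 : s < 1) (hσ0 : σ ≤ 0) (hα0 : 0 ≤ α) (hα : α < 1 + σ)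
    (hασ : α + σ < 2 * s) :
    ∃ B : ℝ, 0 ≤ B ∧ ∀ x ∈ Ω,
      ∫⁻ z, ENNReal.ofReal (linError C σ ρ x z * ‖z‖ ^ (-((N : ℝ) + 2 * s))) ≤
        ENNReal.ofReal (B * ρ x ^ (σ + α - 2 * s)) := by
  have hL := h.L_pos
  have hC := h.C_pos
  have hH := h.H_pos
  set κ := 1 / (2 * L) with hκ
  have hκ0 : 0 < κ := by positivity
  obtain ⟨B, hB, htail⟩ := h.exists_tail hN (β := α - σ) (κ := κ) (q := N + 2 * s - 2 * α)
    (by linarith) (by linarith) hκ0 (by linarith)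
  set A := ∫ z in Metric.ball (0 : 𝔼 N) 1, ‖z‖ ^ (2 - ((N : ℝ) + 2 * s)) with hA
  have hA0 : 0 ≤ A := integral_nonneg fun z => by positivity
  set B₁ := 2 * (1 / 2) ^ (σ - 1) * C * (A * κ ^ (2 - 2 * s)) * H ^ (1 - α) with hB₁
  have hB₁0 : 0 ≤ B₁ := by positivity
  refine ⟨B₁ + 2 * C ^ α * B, by positivity, fun x hx => ?_⟩
  have hx0 := (h.mem_iff x).1 hx
  set d := ρ x with hd
  have hnear : ∫⁻ z in Metric.ball 0 (κ * d),
      ENNReal.ofReal (linError C σ ρ x z * ‖z‖ ^ (-((N : ℝ) + 2 * s))) ≤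
      ENNReal.ofReal (B₁ * d ^ (σ + α - 2 * s)) := by
    have hi := (integrableOn_ball_norm_rpow hN (q := 2 - ((N : ℝ) + 2 * s)) (by linarith)
      (κ * d)).const_mul (2 * (d / 2) ^ (σ - 1) * C)
    calc _ ≤ ∫⁻ z : 𝔼 N in Metric.ball 0 (κ * d), ENNReal.ofReal (2 * (d / 2) ^ (σ - 1) * C *
            ‖z‖ ^ (2 - ((N : ℝ) + 2 * s))) := by
          refine setLIntegral_mono_ae' measurableSet_ball ?_
          have hne : ∀ᵐ z : 𝔼 N, z ≠ 0 := by
            have : Nonempty (Fin N) := ⟨⟨0, hN⟩⟩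
            exact Measure.ae_ne volume 0
          filter_upwards [hne] with z hz0 hz
          have hz1 : 0 < ‖z‖ := norm_pos_iff.2 hz0
          refine ENNReal.ofReal_le_ofReal ?_
          rw [show 2 - ((N : ℝ) + 2 * s) = ((2 : ℕ) : ℝ) + -((N : ℝ) + 2 * s) by push_cast; ring,
            Real.rpow_add hz1, Real.rpow_natCast, ← mul_assoc]
          gcongr
          exact h.linError_near_le hσ0 hx (mem_ball_zero_iff.1 hz)
      _ = ENNReal.ofReal (2 * (d / 2) ^ (σ - 1) * C * (A * (κ * d) ^ (2 - 2 * s))) := by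
          rw [← ofReal_integral_eq_lintegral_ofReal hi (.of_forall fun z => by positivity),
            integral_const_mul, integral_ball_norm_rpow _ (by positivity)]
          congr 4
          ring
      _ ≤ _ := by
          refine ENNReal.ofReal_le_ofReal ?_
          rw [Real.mul_rpow hκ0.le hx0.le, show d / 2 = d * (1 / 2) by ring,
            Real.mul_rpow hx0.le (by norm_num)]
          -- The near part is of order `d ^ (σ + 1 - 2 * s)`, better than needed; the surplus `d ^
          -- (1 - α)` is absorbed by the upper bound `H`.
          have e1 : d ^ (σ - 1) * d ^ (2 - 2 * s) = d ^ (1 - α) * d ^ (σ + α - 2 * s) := by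
            rw [← Real.rpow_add hx0, ← Real.rpow_add hx0]; congr 1; ring
          have e2 : d ^ (1 - α) ≤ H ^ (1 - α) := Real.rpow_le_rpow hx0.le (h.le_H x) (by linarith)
          calc _ = 2 * (1 / 2) ^ (σ - 1) * C * (A * κ ^ (2 - 2 * s)) *
                (d ^ (σ - 1) * d ^ (2 - 2 * s)) := by ring
            _ = 2 * (1 / 2) ^ (σ - 1) * C * (A * κ ^ (2 - 2 * s)) * d ^ (1 - α) *
                d ^ (σ + α - 2 * s) := by rw [e1]; ring
            _ ≤ _ := by rw [hB₁]; gcongr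
  have hfar : ∫⁻ z in (Metric.ball 0 (κ * d))ᶜ,
      ENNReal.ofReal (linError C σ ρ x z * ‖z‖ ^ (-((N : ℝ) + 2 * s))) ≤
      ENNReal.ofReal (2 * C ^ α * B * d ^ (σ + α - 2 * s)) := by
    calc _ ≤ ∫⁻ z in (Metric.ball 0 (κ * d))ᶜ, ENNReal.ofReal (2 * C ^ α) *
            (ENNReal.ofReal (posRpow (-(α - σ)) (ρ (x + z))) *
              ENNReal.ofReal (‖z‖ ^ (-((N : ℝ) + 2 * s - 2 * α)))) := by
          refine setLIntegral_mono' measurableSet_ball.compl fun z hz => ?_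
          have hz1 : 0 < ‖z‖ := by
            have : κ * d ≤ ‖z‖ := by simpa using hz
            exact lt_of_lt_of_le (by positivity) this
          rw [← ENNReal.ofReal_mul (posRpow_nonneg _ _), ← ENNReal.ofReal_mul (by positivity)]
          refine ENNReal.ofReal_le_ofReal ?_
          rw [show -((N : ℝ) + 2 * s - 2 * α) = 2 * α + -((N : ℝ) + 2 * s) by ring,
            Real.rpow_add hz1, ← mul_assoc (posRpow _ _), ← mul_assoc (2 * C ^ α)]
          gcongr
          exact linError_far_le hC hα0 (by linarith) x z
      _ ≤ ENNReal.ofReal (2 * C ^ α) * ENNReal.ofReal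
            (B * d ^ ((N : ℝ) - (α - σ) - (N + 2 * s - 2 * α))) := by
          rw [lintegral_const_mul' _ _ ENNReal.ofReal_ne_top]
          gcongr
          exact htail x hx
      _ = _ := by
          rw [← ENNReal.ofReal_mul (by positivity), ← mul_assoc]
          congr 3
          ring
  rw [← lintegral_add_compl _ (measurableSet_ball (x := (0 : 𝔼 N)) (ε := κ * d)), add_mul,
    ENNReal.ofReal_add (by positivity) (by positivity)]
  exact add_le_add hnear hfar

/-- The operator applied to a power of the defining function. -/
theorem exists_integral_secondDiff_posRpow_le (h : IsQuantDefining Ω ρ L C H c₀ d₀ r₁)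
    (hN : 1 ≤ N) {s γ Γ σ α : ℝ} (hs : 0 < s) (hs1 : s < 1) (hγ : 0 < γ) (hγΓ : γ ≤ Γ)
    (hσ0 : σ ≤ 0) (hα0 : 0 ≤ α) (hα : α < 1 + σ)
    (hασ : α + σ < 2 * s) (hJ : rpowConst s σ ≤ 0) :
    ∃ B : ℝ, 0 ≤ B ∧ ∀ K : 𝔼 N → ℝ, IsStableKernel s γ Γ K → ∀ x ∈ Ω,
      ∫ z, secondDiff (fun y => posRpow σ (ρ y)) x z * K z ≤
        γ * rpowConst s σ * sphereMoment s (gradient ρ x) * ρ x ^ (σ - 2 * s) +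
          B * ρ x ^ (σ + α - 2 * s) := by
  have hσ : -1 < σ := by linarith
  obtain ⟨B, hB, hBx⟩ := h.exists_lintegral_linError_le hN hs1 hσ0 hα0 hα hασ
  refine ⟨2 * Γ * B, by have := hγ.trans_le hγΓ; positivity, fun K hK x hx => ?_⟩
  have hΓ : 0 < Γ := hγ.trans_le hγΓ
  have hx0 := (h.mem_iff x).1 hx
  have hne : ∀ᵐ z : 𝔼 N, z ≠ 0 := by
    have : Nonempty (Fin N) := ⟨⟨0, hN⟩⟩
    exact Measure.ae_ne volume 0
  have hE0 : ∀ z, 0 ≤ linError C σ ρ x z * ‖z‖ ^ (-((N : ℝ) + 2 * s)) := fun z =>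
    mul_nonneg (linError_nonneg h.C_pos σ ρ x z) (by positivity)
  have hEm : Measurable fun z => linError C σ ρ x z * ‖z‖ ^ (-((N : ℝ) + 2 * s)) := by
    have := h.measurable_linError σ x
    fun_prop
  have hEi : Integrable fun z => linError C σ ρ x z * ‖z‖ ^ (-((N : ℝ) + 2 * s)) := by
    refine ⟨hEm.aestronglyMeasurable, ?_⟩
    rw [hasFiniteIntegral_iff_ofReal (.of_forall hE0)]
    exact (hBx x hx).trans_lt ENNReal.ofReal_lt_top
  have hEB : ∫ z, linError C σ ρ x z * ‖z‖ ^ (-((N : ℝ) + 2 * s)) ≤ B * ρ x ^ (σ + α - 2 * s) := by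
    rw [integral_eq_lintegral_of_nonneg_ae (.of_forall hE0) hEm.aestronglyMeasurable]
    exact ENNReal.toReal_le_of_le_ofReal (by positivity) (hBx x hx)
  have hEi' : Integrable fun z => linError C σ ρ x (-z) * ‖z‖ ^ (-((N : ℝ) + 2 * s)) := by
    simpa using hEi.comp_neg
  have hEB' : ∫ z, linError C σ ρ x (-z) * ‖z‖ ^ (-((N : ℝ) + 2 * s)) ≤
      B * ρ x ^ (σ + α - 2 * s) := by
    refine le_of_eq_of_le ?_ hEB
    have := integral_neg_eq_self
      (fun z => linError C σ ρ x z * ‖z‖ ^ (-((N : ℝ) + 2 * s))) volume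
    simpa using this
  obtain ⟨hAi, hA⟩ := integral_affine_posRpow_le hN hs hs1 hγ hK hσ hσ0 hJ (gradient ρ x) hx0
  have hSi := integrable_secondDiff_mul hN hs hs1 hγ hK (h.integrable_posRpow hσ hσ0)
    (h.contDiffAt_posRpow σ hx)
  calc _ ≤ ∫ z, ((posRpow σ (ρ x + inner ℝ (gradient ρ x) z) +
          posRpow σ (ρ x - inner ℝ (gradient ρ x) z) - 2 * ρ x ^ σ) * K z +
          Γ * (linError C σ ρ x z * ‖z‖ ^ (-((N : ℝ) + 2 * s)) +
            linError C σ ρ x (-z) * ‖z‖ ^ (-((N : ℝ) + 2 * s)))) := by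
        refine integral_mono_ae hSi (hAi.add ((hEi.add hEi').const_mul Γ)) ?_
        filter_upwards [hne] with z hz
        have h1 := h.secondDiff_posRpow_le hσ hσ0 hx z
        have hKp := hK.pos hγ hz
        have h2 := mul_le_mul_of_nonneg_right h1 hKp.le
        have h3 : (linError C σ ρ x z + linError C σ ρ x (-z)) * K z ≤
            (linError C σ ρ x z + linError C σ ρ x (-z)) *
              (Γ * ‖z‖ ^ (-((N : ℝ) + 2 * s))) :=
          mul_le_mul_of_nonneg_left (hK.bounds hz).2
            (add_nonneg (linError_nonneg h.C_pos _ _ _ _) (linError_nonneg h.C_pos _ _ _ _))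
        rw [add_mul] at h2
        linarith
    _ ≤ _ := by
        have hsum : Integrable fun z => Γ * (linError C σ ρ x z * ‖z‖ ^ (-((N : ℝ) + 2 * s)) +
            linError C σ ρ x (-z) * ‖z‖ ^ (-((N : ℝ) + 2 * s))) := (hEi.add hEi').const_mul Γ
        rw [integral_add hAi hsum, integral_const_mul, integral_add hEi hEi']
        have : Γ * (∫ z, linError C σ ρ x z * ‖z‖ ^ (-((N : ℝ) + 2 * s))) ≤
          Γ * (B * ρ x ^ (σ + α - 2 * s)) := by gcongr
        have : Γ * (∫ z, linError C σ ρ x (-z) * ‖z‖ ^ (-((N : ℝ) + 2 * s))) ≤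
          Γ * (B * ρ x ^ (σ + α - 2 * s)) := by gcongr
        linarith

end IsQuantDefining

/-! ### The barrier -/

theorem contDiffAt_indicator_one {N : ℕ} {Ω : Set (𝔼 N)} (hΩ : IsOpen Ω) {x : 𝔼 N} (hx : x ∈ Ω) :
    ContDiffAt ℝ 2 (Ω.indicator fun _ => (1 : ℝ)) x := by
  refine (contDiffAt_const (c := (1 : ℝ))).congr_of_eventuallyEq ?_
  filter_upwards [hΩ.mem_nhds hx] with y hy
  exact indicator_of_mem hy _

theorem integrable_indicator_one {N : ℕ} {Ω : Set (𝔼 N)} (hΩ : IsOpen Ω)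
    (hb : Bornology.IsBounded Ω) : Integrable (Ω.indicator fun _ => (1 : ℝ)) := by
  rw [integrable_indicator_iff hΩ.measurableSet]
  exact integrableOn_const hb.measure_lt_top.ne

/-- The operator is negative on the indicator function of a bounded open set. -/
theorem exists_integral_secondDiff_indicator_le {N : ℕ} (hN : 1 ≤ N) {s γ Γ : ℝ} (hs : 0 < s)
    (hs1 : s < 1) (hγ : 0 < γ) {Ω : Set (𝔼 N)} (hΩ : IsOpen Ω) (hb : Bornology.IsBounded Ω) :
    ∃ c : ℝ, 0 < c ∧ ∀ K : 𝔼 N → ℝ, IsStableKernel s γ Γ K → ∀ x ∈ Ω,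
      ∫ z, secondDiff (Ω.indicator fun _ => (1 : ℝ)) x z * K z ≤ -c := by
  have : Nonempty (Fin N) := ⟨⟨0, hN⟩⟩
  obtain ⟨R, hR, hΩR⟩ := hb.subset_ball_lt 0 0
  -- For `x` in `Ω` and `z` in this shell both `x + z` and `x - z` leave `Ω`, so the second
  -- difference is `-2`; elsewhere it is nonpositive.
  set A := Metric.ball (0 : 𝔼 N) (3 * R) \ Metric.closedBall 0 (2 * R) with hA
  have hAo : IsOpen A := Metric.isOpen_ball.sdiff Metric.isClosed_closedBall
  have hAm : MeasurableSet A := hAo.measurableSet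
  have hAne : A.Nonempty := by
    obtain ⟨e, he⟩ := exists_norm_eq (𝔼 N) (c := 5 / 2 * R) (by positivity)
    refine ⟨e, by rw [mem_ball_zero_iff, he]; linarith, ?_⟩
    rw [mem_closedBall_zero_iff, he]; linarith
  have hA0 : 0 < volume.real A :=
    ENNReal.toReal_pos (hAo.measure_pos _ hAne).ne'
      ((measure_mono sdiff_subset).trans_lt measure_ball_lt_top).ne
  set k := γ * (3 * R) ^ (-((N : ℝ) + 2 * s)) with hk
  have hk0 : 0 < k := by positivity
  refine ⟨2 * k * volume.real A, by positivity, fun K hK x hx => ?_⟩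
  have hint := integrable_secondDiff_mul hN hs hs1 hγ hK (integrable_indicator_one hΩ hb)
    (contDiffAt_indicator_one hΩ hx)
  have hAi : Integrable (A.indicator fun _ => -(2 * k)) := by
    rw [integrable_indicator_iff hAm]
    exact integrableOn_const ((measure_mono sdiff_subset).trans_lt measure_ball_lt_top).ne
  have hle1 : ∀ y, Ω.indicator (fun _ => (1 : ℝ)) y ≤ 1 := fun y =>
    indicator_le_self' (fun _ _ => zero_le_one) y
  calc _ ≤ ∫ z, A.indicator (fun _ => -(2 * k)) z := by
        refine integral_mono_ae hint hAi ?_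
        filter_upwards [Measure.ae_ne volume (0 : 𝔼 N)] with z hz
        have hKp := hK.pos hγ hz
        have hx1 : Ω.indicator (fun _ => (1 : ℝ)) x = 1 := indicator_of_mem hx _
        by_cases hzA : z ∈ A
        · have hz1 : 2 * R < ‖z‖ := by simpa using hzA.2
          have hz2 : ‖z‖ < 3 * R := by simpa using hzA.1
          have hxR : ‖x‖ < R := by simpa using hΩR hx
          have h1 : x + z ∉ Ω := fun h => by
            have h2 : ‖x + z‖ < R := by simpa using hΩR h
            have : ‖z‖ ≤ ‖x + z‖ + ‖x‖ := by
              calc ‖z‖ = ‖(x + z) - x‖ := by congr 1; abel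
                _ ≤ _ := norm_sub_le _ _
            linarith
          have h2 : x - z ∉ Ω := fun h => by
            have h2 : ‖x - z‖ < R := by simpa using hΩR h
            have : ‖z‖ ≤ ‖x‖ + ‖x - z‖ := by
              calc ‖z‖ = ‖x - (x - z)‖ := by congr 1; abel
                _ ≤ _ := norm_sub_le _ _
            linarith
          rw [indicator_of_mem hzA, secondDiff, indicator_of_notMem h1, indicator_of_notMem h2, hx1]
          have h3 : k ≤ K z := by
            refine le_trans ?_ (hK.bounds hz).1
            exact mul_le_mul_of_nonneg_left (Real.rpow_le_rpow_of_nonpos (norm_pos_iff.2 hz) hz2.le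
              (by linarith [(N.cast_nonneg : (0 : ℝ) ≤ N)])) hγ.le
          linarith
        · rw [indicator_of_notMem hzA]
          refine mul_nonpos_of_nonpos_of_nonneg ?_ hKp.le
          rw [secondDiff, hx1]
          linarith [hle1 (x + z), hle1 (x - z)]
    _ = _ := by
        rw [integral_indicator hAm, setIntegral_const, smul_eq_mul]; ring

theorem secondDiff_add {N : ℕ} (v w : 𝔼 N → ℝ) (x z : 𝔼 N) :
    secondDiff (fun y => v y + w y) x z = secondDiff v x z + secondDiff w x z := by
  simp only [secondDiff]; ring

theorem secondDiff_const_mul {N : ℕ} (c : ℝ) (v : 𝔼 N → ℝ) (x z : 𝔼 N) :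
    secondDiff (fun y => c * v y) x z = c * secondDiff v x z := by
  simp only [secondDiff]; ring

/-- A strict supersolution for all the kernels of the class, blowing up at the boundary like the
power `s - 1` of the distance. -/
theorem exists_barrier {N : ℕ} (hN : 1 ≤ N) {s γ Γ : ℝ} (hs : 0 < s)
    (hs1 : s < 1) (hγ : 0 < γ) (hγΓ : γ ≤ Γ) {Ω : Set (𝔼 N)} {ρ : 𝔼 N → ℝ}
    {L C H c₀ d₀ r₁ : ℝ} (h : IsQuantDefining Ω ρ L C H c₀ d₀ r₁) :
    ∃ w : 𝔼 N → ℝ, Integrable w ∧ (∀ x ∈ Ω, ContDiffAt ℝ 2 w x) ∧ (∀ x ∉ Ω, w x = 0) ∧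
      (∀ x ∈ Ω, ρ x ^ (s - 1) ≤ w x) ∧
      ∀ K : 𝔼 N → ℝ, IsStableKernel s γ Γ K → ∀ x ∈ Ω, ∫ z, secondDiff w x z * K z ≤ -1 := by
  -- The value of `α` lies below both `s` and `1 - s`, as needed for `α < 1 + σ` at both exponents
  -- and for `τ < 0`. With `η = α / 2 < α`, the error of the power `s - 1` is smaller than the main
  -- term of the power `τ`.
  set η := s * (1 - s) / 2 with hη
  set α := s * (1 - s) with hα
  have h1s : 0 < 1 - s := by linarith
  have hα0 : 0 < α := mul_pos hs h1s
  have hη0 : 0 < η := by linarith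
  have hαs : α < s := by rw [hα]; nlinarith
  have hα1 : α < 1 - s := by rw [hα]; nlinarith
  have hηs : η < s := by linarith
  have hη1 : η < 1 - s := by linarith
  set τ := s - 1 + η with hτ
  have hJ0 := rpowConst_nonpos hs hs1
  have hJτ : rpowConst s τ < 0 := rpowConst_neg hs hs1 hη0 hηs hη1
  obtain ⟨B₁, hB₁, hI₁⟩ := h.exists_integral_secondDiff_posRpow_le hN hs hs1 hγ hγΓ
    (σ := s - 1) (α := α) (by linarith) hα0.le (by linarith) (by linarith) hJ0
  obtain ⟨B₂, hB₂, hI₂⟩ := h.exists_integral_secondDiff_posRpow_le hN hs hs1 hγ hγΓ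
    (σ := τ) (α := α) (by linarith) hα0.le (by linarith) (by linarith) hJτ.le
  obtain ⟨c, hc, hI₃⟩ := exists_integral_secondDiff_indicator_le (Γ := Γ) hN hs hs1 hγ h.isOpen
    h.isBounded
  obtain ⟨cS, hcS, hS⟩ := exists_le_integral_abs_inner_rpow (N := N) hs
  set m := γ * (-rpowConst s τ) * (cS * c₀ ^ (2 * s)) with hm
  have hm0 : 0 < m := by
    have := h.c₀_pos
    have : 0 < -rpowConst s τ := by linarith
    positivity
  -- After division by `d ^ (τ - 2 * s)`, both linearization errors tend to zero at the boundary,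
  -- whereas the main term stays below `-m`.
  obtain ⟨d₁, hd₁, hd₁'⟩ : ∃ d₁ : ℝ, 0 < d₁ ∧ ∀ d, 0 < d → d < d₁ →
      B₁ * d ^ (α - η) + B₂ * d ^ α < m := by
    have ht : Tendsto (fun d : ℝ => B₁ * d ^ (α - η) + B₂ * d ^ α) (𝓝 0)
        (𝓝 (B₁ * 0 ^ (α - η) + B₂ * 0 ^ α)) := by
      refine Tendsto.add (Tendsto.const_mul _ ?_) (Tendsto.const_mul _ ?_)
      · exact (Real.continuousAt_rpow_const 0 (α - η) (Or.inr (by linarith))).tendsto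
      · exact (Real.continuousAt_rpow_const 0 α (Or.inr hα0.le)).tendsto
    rw [Real.zero_rpow (by linarith), Real.zero_rpow hα0.ne', mul_zero, mul_zero, add_zero] at ht
    obtain ⟨ε, hε, hball⟩ := Metric.eventually_nhds_iff.1 (ht.eventually (gt_mem_nhds hm0))
    exact ⟨ε, hε, fun d hd hdε => hball (by rwa [Real.dist_0_eq_abs, abs_of_pos hd])⟩
  set d₂ := min d₀ d₁ with hd₂
  have hd₂0 : 0 < d₂ := lt_min h.d₀_pos hd₁
  -- Both exponents are negative, so `P` bounds the errors wherever `ρ x ≥ d₂`; `M` makes the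
  -- indicator contribute at most `-(P + 1)`.
  set P := B₁ * d₂ ^ (s - 1 + α - 2 * s) + B₂ * d₂ ^ (τ + α - 2 * s) with hP
  have hP0 : 0 ≤ P := by positivity
  set M := (P + 1) / c with hM
  have hM0 : 0 < M := by positivity
  set v₁ := fun y => posRpow (s - 1) (ρ y)
  set v₂ := fun y => posRpow τ (ρ y)
  set v₃ := Ω.indicator fun _ => (1 : ℝ)
  have i₁ : Integrable v₁ := h.integrable_posRpow (by linarith) (by linarith)
  have i₂ : Integrable v₂ := h.integrable_posRpow (by linarith) (by linarith)
  have i₃ : Integrable v₃ := integrable_indicator_one h.isOpen h.isBounded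
  have s₁ : ∀ x ∈ Ω, ContDiffAt ℝ 2 v₁ x := fun x hx => h.contDiffAt_posRpow _ hx
  have s₂ : ∀ x ∈ Ω, ContDiffAt ℝ 2 v₂ x := fun x hx => h.contDiffAt_posRpow _ hx
  have s₃ : ∀ x ∈ Ω, ContDiffAt ℝ 2 v₃ x := fun x hx => contDiffAt_indicator_one h.isOpen hx
  refine ⟨fun y => (v₁ y + v₂ y) + M * v₃ y, (i₁.add i₂).add (i₃.const_mul M),
    fun x hx => ((s₁ x hx).add (s₂ x hx)).add (contDiffAt_const.mul (s₃ x hx)), ?_, ?_, ?_⟩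
  · intro x hx
    have hx0 : ρ x ≤ 0 := not_lt.1 fun hp => hx ((h.mem_iff x).2 hp)
    simp [v₁, v₂, v₃, posRpow_of_nonpos hx0, hx]
  · intro x hx
    have e1 : v₁ x = ρ x ^ (s - 1) := posRpow_of_pos ((h.mem_iff x).1 hx)
    have e2 : 0 ≤ v₂ x := posRpow_nonneg _ _
    have e3 : v₃ x = 1 := indicator_of_mem hx _
    simp only [e1, e3]
    linarith
  · intro K hK x hx
    have j₁ := integrable_secondDiff_mul hN hs hs1 hγ hK i₁ (s₁ x hx)
    have j₂ := integrable_secondDiff_mul hN hs hs1 hγ hK i₂ (s₂ x hx)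
    have j₃ := integrable_secondDiff_mul hN hs hs1 hγ hK i₃ (s₃ x hx)
    have hsplit : ∫ z, secondDiff (fun y => (v₁ y + v₂ y) + M * v₃ y) x z * K z =
        (∫ z, secondDiff v₁ x z * K z) + (∫ z, secondDiff v₂ x z * K z) +
          M * ∫ z, secondDiff v₃ x z * K z := by
      have j₁₂ : Integrable fun z => secondDiff v₁ x z * K z + secondDiff v₂ x z * K z := j₁.add j₂
      rw [← integral_add j₁ j₂, ← integral_const_mul, ← integral_add j₁₂ (j₃.const_mul M)]
      congr 1
      ext z
      rw [secondDiff_add, secondDiff_add, secondDiff_const_mul]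
      ring
    rw [hsplit]
    have hx0 := (h.mem_iff x).1 hx
    have b₁ := hI₁ K hK x hx
    have b₂ := hI₂ K hK x hx
    have b₃ : M * ∫ z, secondDiff v₃ x z * K z ≤ -(P + 1) := by
      calc _ ≤ M * -c := mul_le_mul_of_nonneg_left (hI₃ K hK x hx) hM0.le
        _ = _ := by rw [hM]; field_simp
    have hSn := sphereMoment_nonneg s (gradient ρ x)
    have n₁ : γ * rpowConst s (s - 1) * sphereMoment s (gradient ρ x) * ρ x ^ (s - 1 - 2 * s) ≤ 0 := by
      refine mul_nonpos_of_nonpos_of_nonneg (mul_nonpos_of_nonpos_of_nonneg ?_ hSn) (by positivity)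
      exact mul_nonpos_of_nonneg_of_nonpos hγ.le hJ0
    rcases lt_or_ge (ρ x) d₂ with hlt | hge
    · have hg := h.le_gradient x (subset_closure hx) (hlt.trans_le (min_le_left _ _))
      have hSg : cS * c₀ ^ (2 * s) ≤ sphereMoment s (gradient ρ x) := by
        refine le_trans ?_ (hS (gradient ρ x))
        have := h.c₀_pos
        gcongr
      have n₂ : γ * rpowConst s τ * sphereMoment s (gradient ρ x) * ρ x ^ (τ - 2 * s) ≤
          -m * ρ x ^ (τ - 2 * s) := by
        refine mul_le_mul_of_nonneg_right ?_ (by positivity)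
        have : γ * (-rpowConst s τ) * (cS * c₀ ^ (2 * s)) ≤
            γ * (-rpowConst s τ) * sphereMoment s (gradient ρ x) := by
          have : 0 < -rpowConst s τ := by linarith
          gcongr
        linarith
      have hd := hd₁' (ρ x) hx0 (hlt.trans_le (min_le_right _ _))
      have e1 : ρ x ^ (s - 1 + α - 2 * s) = ρ x ^ (α - η) * ρ x ^ (τ - 2 * s) := by
        rw [← Real.rpow_add hx0]; congr 1; rw [hτ]; ring
      have e2 : ρ x ^ (τ + α - 2 * s) = ρ x ^ α * ρ x ^ (τ - 2 * s) := by
        rw [← Real.rpow_add hx0]; congr 1; ring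
      rw [e1] at b₁
      rw [e2] at b₂
      have hp : 0 < ρ x ^ (τ - 2 * s) := by positivity
      have := mul_lt_mul_of_pos_right hd hp
      linarith
    · have n₂ : γ * rpowConst s τ * sphereMoment s (gradient ρ x) * ρ x ^ (τ - 2 * s) ≤ 0 := by
        refine mul_nonpos_of_nonpos_of_nonneg (mul_nonpos_of_nonpos_of_nonneg ?_ hSn)
          (by positivity)
        exact mul_nonpos_of_nonneg_of_nonpos hγ.le hJτ.le
      have p₁ : B₁ * ρ x ^ (s - 1 + α - 2 * s) ≤ B₁ * d₂ ^ (s - 1 + α - 2 * s) :=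
        mul_le_mul_of_nonneg_left (Real.rpow_le_rpow_of_nonpos hd₂0 hge (by linarith)) hB₁
      have p₂ : B₂ * ρ x ^ (τ + α - 2 * s) ≤ B₂ * d₂ ^ (τ + α - 2 * s) :=
        mul_le_mul_of_nonneg_left (Real.rpow_le_rpow_of_nonpos hd₂0 hge (by linarith)) hB₂
      linarith

/-! ### Principal values and touching test functions -/

section

variable {N : ℕ} {s γ Γ : ℝ} {K : EuclideanSpace ℝ (Fin N) → ℝ}

theorem integrableOn_mul_kernel_compl_ball (hs : 0 < s) (hγ : 0 < γ)
    (hK : IsStableKernel s γ Γ K) {r : ℝ} (hr : 0 < r) {f : 𝔼 N → ℝ} (hf : Integrable f) :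
    IntegrableOn (fun z => f z * K z) (Metric.ball 0 r)ᶜ := by
  refine (hf.norm.const_mul (|Γ| * r ^ (-((N : ℝ) + 2 * s)))).integrableOn.mono'
    (hf.aestronglyMeasurable.restrict.mul hK.measurable.aestronglyMeasurable) ?_
  filter_upwards [ae_restrict_mem measurableSet_ball.compl] with z hz
  have hz0 : z ≠ 0 := fun h => hz (by simpa [h] using hr)
  have hzr : r ≤ ‖z‖ := by simpa using hz
  have hKle : K z ≤ |Γ| * r ^ (-((N : ℝ) + 2 * s)) := by
    refine (hK.bounds hz0).2.trans ?_
    exact mul_le_mul (le_abs_self Γ) (Real.rpow_le_rpow_of_nonpos hr hzr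
      (by linarith [(N.cast_nonneg : (0 : ℝ) ≤ N)])) (by positivity) (abs_nonneg _)
  rw [norm_mul, Real.norm_of_nonneg (hK.pos hγ hz0).le, mul_comm]
  exact mul_le_mul_of_nonneg_right hKle (norm_nonneg _)

/-- Symmetrization of the integral defining the operator, away from the singularity. -/
theorem setIntegral_sub_mul_kernel_eq (hN : 1 ≤ N) (hs : 0 < s) (hγ : 0 < γ)
    (hK : IsStableKernel s γ Γ K) {φ : 𝔼 N → ℝ} (hφ : Integrable φ) (x : 𝔼 N) {A : Set (𝔼 N)}
    (hA : MeasurableSet A) (hsymm : ∀ z, -z ∈ A ↔ z ∈ A) {r : ℝ} (hr : 0 < r)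
    (hAr : A ⊆ (Metric.ball 0 r)ᶜ) :
    IntegrableOn (fun y => (φ y - φ x) * K (x - y)) {y | y - x ∈ A} ∧
    ∫ y in {y | y - x ∈ A}, (φ y - φ x) * K (x - y) =
      1 / 2 * ∫ z in A, secondDiff φ x z * K z := by
  set f : 𝔼 N → ℝ := A.indicator fun z => (φ (x + z) - φ x) * K z with hf
  have hne : ∀ z ∈ A, z ≠ 0 := fun z hz h => hAr hz (by simpa [h] using hr)
  have hfi : Integrable f := by
    rw [hf, integrable_indicator_iff hA]
    have h1 := (integrableOn_mul_kernel_compl_ball hs hγ hK hr (hφ.comp_add_left x)).sub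
      ((integrableOn_kernel_compl_ball hN hs hγ hK hr).const_mul (φ x))
    refine IntegrableOn.mono_set (h1.congr (.of_forall fun z => ?_)) hAr
    simp only [Pi.sub_apply]; ring
  have hB : MeasurableSet {y | y - x ∈ A} := hA.preimage (by fun_prop)
  have hfy : ∀ y, {y | y - x ∈ A}.indicator (fun y => (φ y - φ x) * K (x - y)) y = f (y - x) := by
    intro y
    by_cases hy : y - x ∈ A
    · rw [indicator_of_mem (by exact hy), hf, indicator_of_mem hy, ← hK.even _ (hne _ hy),
        add_sub_cancel, neg_sub]
    · rw [indicator_of_notMem (by exact hy), hf, indicator_of_notMem hy]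
  constructor
  · rw [← integrable_indicator_iff hB]
    exact (hfi.comp_sub_right x).congr (.of_forall fun y => (hfy y).symm)
  · rw [← integral_indicator hB, ← integral_indicator hA]
    simp only [hfy]
    rw [integral_sub_right_eq_self f x]
    have h2 : ∫ z, A.indicator (fun z => secondDiff φ x z * K z) z = ∫ z, (f z + f (-z)) := by
      congr 1
      ext z
      by_cases hz : z ∈ A
      · rw [indicator_of_mem hz, hf, indicator_of_mem hz, indicator_of_mem ((hsymm z).2 hz),
          hK.even z (hne z hz), secondDiff, sub_eq_add_neg x z]
        ring
      · rw [indicator_of_notMem hz, hf, indicator_of_notMem hz,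
          indicator_of_notMem fun h => hz ((hsymm z).1 h), add_zero]
    rw [h2, integral_add hfi hfi.comp_neg, integral_neg_eq_self]
    ring

/-- Evenness of the kernel symmetrizes the truncated integrals into second differences, which are
absolutely integrable; the truncated integrals then converge, so that `limUnder` is their true
limit. -/
theorem pvOp_ball_eq (hN : 1 ≤ N) (hs : 0 < s) (hs1 : s < 1) (hγ : 0 < γ)
    (hK : IsStableKernel s γ Γ K) {φ : 𝔼 N → ℝ} (hφ : Integrable φ) {x : 𝔼 N}
    (hφx : ContDiffAt ℝ 2 φ x) (δ : ℝ) :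
    pvOp K (Metric.ball x δ) φ x = 1 / 2 * ∫ z in Metric.ball 0 δ, secondDiff φ x z * K z := by
  have : Nonempty (Fin N) := ⟨⟨0, hN⟩⟩
  have hint := integrable_secondDiff_mul hN hs hs1 hγ hK hφ hφx
  have hcov : AECover (volume.restrict (Metric.ball (0 : 𝔼 N) δ)) (𝓝[>] (0 : ℝ))
      fun ε => (Metric.ball (0 : 𝔼 N) ε)ᶜ := by
    refine ⟨ae_restrict_of_ae ?_, fun ε => measurableSet_ball.compl⟩
    filter_upwards [Measure.ae_ne volume (0 : 𝔼 N)] with z hz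
    filter_upwards [Ioo_mem_nhdsGT (norm_pos_iff.2 hz)] with ε hε
    simpa using hε.2.le
  have hT := (hcov.integral_tendsto_of_countably_generated hint.integrableOn).const_mul (1 / 2)
  refine Tendsto.limUnder_eq (hT.congr' ?_)
  filter_upwards [self_mem_nhdsWithin] with ε hε
  have hε : 0 < ε := hε
  have hset : Metric.ball x δ \ Metric.ball x ε =
      {y | y - x ∈ (Metric.ball (0 : 𝔼 N) ε)ᶜ ∩ Metric.ball 0 δ} := by
    ext y
    simp only [Set.mem_sdiff, Metric.mem_ball, dist_eq_norm, mem_inter_iff, mem_compl_iff, mem_ofPred_eq,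
      sub_zero]
    tauto
  rw [hset, (setIntegral_sub_mul_kernel_eq hN hs hγ hK hφ x
    (measurableSet_ball.compl.inter measurableSet_ball) (fun z => by simp) hε inter_subset_left).2,
    Measure.restrict_restrict measurableSet_ball.compl]

theorem pvOp_compl_ball_eq (v : 𝔼 N → ℝ) (x : 𝔼 N) {δ : ℝ} (hδ : 0 < δ) :
    pvOp K (Metric.ball x δ)ᶜ v x = ∫ y in (Metric.ball x δ)ᶜ, (v y - v x) * K (x - y) := by
  refine Tendsto.limUnder_eq (tendsto_const_nhds.congr' ?_)
  filter_upwards [Ioo_mem_nhdsGT hδ] with ε hε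
  have : (Metric.ball x δ)ᶜ \ Metric.ball x ε = (Metric.ball x δ)ᶜ := by
    rw [sdiff_eq_left]
    exact disjoint_compl_left.mono_right (Metric.ball_subset_ball hε.2.le)
  rw [this]

/-- Off the ball, `‖x - y‖` is at least a fixed multiple of `1 + ‖y‖`, so the kernel is controlled
by the weight in `MemL1Weight`. -/
theorem integrableOn_sub_mul_kernel_of_memL1Weight (hN : 1 ≤ N) (hs : 0 < s) (hγ : 0 < γ)
    (hK : IsStableKernel s γ Γ K) {u : 𝔼 N → ℝ} (hu : MemL1Weight s u) (x : 𝔼 N) {δ : ℝ}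
    (hδ : 0 < δ) :
    IntegrableOn (fun y => (u y - u x) * K (x - y)) (Metric.ball x δ)ᶜ := by
  have hq : 0 ≤ (N : ℝ) + 2 * s := by positivity
  have hKm : Measurable fun y => K (x - y) := hK.measurable.comp (by fun_prop)
  set a := (1 + ‖x‖) / δ + 1 with ha
  have ha0 : 0 < a := by positivity
  have h1 : IntegrableOn (fun y => u y * K (x - y)) (Metric.ball x δ)ᶜ := by
    refine (hu.2.const_mul (|Γ| * a ^ ((N : ℝ) + 2 * s))).integrableOn.mono'
      (hu.1.aestronglyMeasurable.restrict.mul hKm.aestronglyMeasurable) ?_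
    filter_upwards [ae_restrict_mem measurableSet_ball.compl] with y hy
    have hy1 : δ ≤ ‖x - y‖ := by
      have : δ ≤ dist y x := by simpa using hy
      rwa [dist_comm, dist_eq_norm] at this
    have hn : 0 < ‖x - y‖ := hδ.trans_le hy1
    have hz : x - y ≠ 0 := norm_pos_iff.1 hn
    have h2 : 1 + ‖y‖ ≤ a * ‖x - y‖ := by
      have h3 : ‖y‖ ≤ ‖x‖ + ‖x - y‖ := by
        calc ‖y‖ = ‖x - (x - y)‖ := by congr 1; abel
          _ ≤ _ := norm_sub_le _ _
      have h4 : 1 + ‖x‖ ≤ (1 + ‖x‖) / δ * ‖x - y‖ := by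
        rw [div_mul_eq_mul_div, le_div_iff₀ hδ]
        gcongr
      rw [ha, add_mul, one_mul]
      linarith
    have h5 : (1 + ‖y‖) ^ ((N : ℝ) + 2 * s) ≤ a ^ ((N : ℝ) + 2 * s) * ‖x - y‖ ^ ((N : ℝ) + 2 * s) := by
      rw [← Real.mul_rpow ha0.le hn.le]
      exact Real.rpow_le_rpow (by positivity) h2 hq
    have h6 : ‖x - y‖ ^ (-((N : ℝ) + 2 * s)) ≤
        a ^ ((N : ℝ) + 2 * s) * (1 / (1 + ‖y‖) ^ ((N : ℝ) + 2 * s)) := by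
      rw [Real.rpow_neg hn.le, mul_one_div, inv_eq_one_div,
        div_le_div_iff₀ (by positivity) (by positivity), one_mul]
      exact h5
    have h7 : K (x - y) ≤ |Γ| * (a ^ ((N : ℝ) + 2 * s) * (1 / (1 + ‖y‖) ^ ((N : ℝ) + 2 * s))) :=
      (hK.bounds hz).2.trans (mul_le_mul (le_abs_self Γ) h6 (by positivity) (abs_nonneg _))
    rw [norm_mul, Real.norm_of_nonneg (hK.pos hγ hz).le, Real.norm_eq_abs]
    calc _ ≤ |u y| * (|Γ| * (a ^ ((N : ℝ) + 2 * s) * (1 / (1 + ‖y‖) ^ ((N : ℝ) + 2 * s)))) := by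
          gcongr
      _ = _ := by ring
  have h2 : IntegrableOn (fun y => K (x - y)) (Metric.ball x δ)ᶜ := by
    have h3 := integrableOn_kernel_compl_ball hN hs hγ hK hδ
    rw [← integrable_indicator_iff measurableSet_ball.compl] at h3 ⊢
    refine (h3.comp_sub_left x).congr (.of_forall fun y => ?_)
    have : dist y x = ‖x - y‖ := by rw [dist_comm, dist_eq_norm]
    simp [indicator, this]
  refine (h1.sub (h2.const_mul (u x))).congr (.of_forall fun y => ?_)
  simp only [Pi.sub_apply]; ring

/-- Comparison of the nonlocal operator evaluated on a function and on a touching test function. -/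
theorem pvOp_add_pvOp_le (hN : 1 ≤ N) (hs : 0 < s) (hs1 : s < 1) (hγ : 0 < γ)
    (hK : IsStableKernel s γ Γ K) {u φ : 𝔼 N → ℝ} (hu : MemL1Weight s u) (hφ : Integrable φ)
    {x : 𝔼 N} (hφx : ContDiffAt ℝ 2 φ x) {δ : ℝ} (hδ : 0 < δ)
    (hle : ∀ᵐ y, u y - u x ≤ φ y - φ x) :
    pvOp K (Metric.ball x δ) φ x + pvOp K (Metric.ball x δ)ᶜ u x ≤
      1 / 2 * ∫ z, secondDiff φ x z * K z := by
  have hint := integrable_secondDiff_mul hN hs hs1 hγ hK hφ hφx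
  have hset : (Metric.ball x δ)ᶜ = {y | y - x ∈ (Metric.ball (0 : 𝔼 N) δ)ᶜ} := by
    ext y
    simp [dist_eq_norm]
  obtain ⟨hi, he⟩ := setIntegral_sub_mul_kernel_eq hN hs hγ hK hφ x
    (measurableSet_ball (x := (0 : 𝔼 N)) (ε := δ)).compl (fun z => by simp) hδ Subset.rfl
  rw [← hset] at hi he
  have h1 : ∫ y in (Metric.ball x δ)ᶜ, (u y - u x) * K (x - y) ≤
      ∫ y in (Metric.ball x δ)ᶜ, (φ y - φ x) * K (x - y) := by
    refine setIntegral_mono_on_ae (integrableOn_sub_mul_kernel_of_memL1Weight hN hs hγ hK hu x hδ)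
      hi measurableSet_ball.compl ?_
    filter_upwards [hle] with y hy hyB
    refine mul_le_mul_of_nonneg_right hy (hK.pos hγ fun h => hyB ?_).le
    rw [sub_eq_zero.1 h]
    exact Metric.mem_ball_self hδ
  rw [pvOp_ball_eq hN hs hs1 hγ hK hφ hφx, pvOp_compl_ball_eq u x hδ,
    ← integral_add_compl (measurableSet_ball (x := (0 : 𝔼 N)) (ε := δ)) hint, mul_add]
  linarith

end

/-! ### Boundary behaviour and existence of a maximum -/

/-- A defining function is controlled by the distance to the boundary. -/
theorem IsQuantDefining.bdist_rpow_le {N : ℕ} {Ω : Set (𝔼 N)} {ρ : 𝔼 N → ℝ}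
    {L C H c₀ d₀ r₁ : ℝ} (h : IsQuantDefining Ω ρ L C H c₀ d₀ r₁) {s : ℝ} (hs1 : s < 1)
    (hne : (frontier Ω).Nonempty) {x : 𝔼 N} (hx : x ∈ Ω) :
    0 < bdist Ω x ∧ L ^ (s - 1) ≤ bdist Ω x ^ (1 - s) * ρ x ^ (s - 1) := by
  have hx0 := (h.mem_iff x).1 hx
  have hL := h.L_pos
  have h1 : ρ x / L ≤ bdist Ω x := by
    rw [bdist, Metric.le_infDist hne]
    intro y hy
    have := h.lipschitz x y
    rw [h.eq_zero y hy, sub_zero, abs_of_pos hx0, ← dist_eq_norm] at this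
    rw [div_le_iff₀ hL]
    linarith
  have h2 : 0 < ρ x / L := by positivity
  refine ⟨h2.trans_le h1, ?_⟩
  have h3 : (ρ x / L) ^ (1 - s) ≤ bdist Ω x ^ (1 - s) :=
    Real.rpow_le_rpow h2.le h1 (by linarith)
  calc L ^ (s - 1) = (ρ x / L) ^ (1 - s) * ρ x ^ (s - 1) := by
        rw [Real.div_rpow hx0.le hL.le, div_mul_eq_mul_div, ← Real.rpow_add hx0,
          show s - 1 = -(1 - s) by ring, Real.rpow_neg hL.le]
        simp
    _ ≤ _ := by gcongr

/-- Near the boundary a subsolution lies below any positive multiple of a barrier. -/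
theorem eventually_lt_barrier {N : ℕ} {Ω : Set (𝔼 N)} {ρ : 𝔼 N → ℝ}
    {L C H c₀ d₀ r₁ : ℝ} (h : IsQuantDefining Ω ρ L C H c₀ d₀ r₁) {s : ℝ} (hs1 : s < 1)
    {u w : 𝔼 N → ℝ} (hw : ∀ x ∈ Ω, ρ x ^ (s - 1) ≤ w x) {ε : ℝ} (hε : 0 < ε) {x : 𝔼 N}
    (hx : x ∈ frontier Ω)
    (hlim : limsup (fun z => ((bdist Ω z ^ (1 - s) * u z : ℝ) : EReal)) (𝓝[Ω] x) ≤ 0) :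
    ∀ᶠ z in 𝓝[Ω] x, u z < ε * w z := by
  have hL := h.L_pos
  have h1 : (0 : EReal) < ((ε * L ^ (s - 1) : ℝ) : EReal) := by
    exact_mod_cast (by positivity : 0 < ε * L ^ (s - 1))
  filter_upwards [eventually_lt_of_limsup_lt (hlim.trans_lt h1), self_mem_nhdsWithin] with z hz hzΩ
  have hz : bdist Ω z ^ (1 - s) * u z < ε * L ^ (s - 1) := by exact_mod_cast hz
  obtain ⟨hb, hb'⟩ := h.bdist_rpow_le hs1 ⟨x, hx⟩ hzΩ
  have hp : 0 < bdist Ω z ^ (1 - s) := by positivity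
  have h2 : bdist Ω z ^ (1 - s) * u z < bdist Ω z ^ (1 - s) * (ε * w z) := by
    calc _ < ε * L ^ (s - 1) := hz
      _ ≤ ε * (bdist Ω z ^ (1 - s) * ρ z ^ (s - 1)) := by gcongr
      _ ≤ ε * (bdist Ω z ^ (1 - s) * w z) := by gcongr; exact hw z hzΩ
      _ = _ := by ring
  exact lt_of_mul_lt_mul_left h2 hp.le

/-- A function on an open set which is upper semicontinuous, positive somewhere and negative near
the boundary attains its maximum. -/
theorem exists_isMaxOn_of_neg_near_frontier {N : ℕ} {Ω : Set (𝔼 N)} (hΩ : IsOpen Ω)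
    (hb : Bornology.IsBounded Ω) {g : 𝔼 N → ℝ} (hg : UpperSemicontinuousOn g Ω)
    (hneg : ∀ x ∈ frontier Ω, ∀ᶠ z in 𝓝[Ω] x, g z < 0) {x₁ : 𝔼 N} (hx₁ : x₁ ∈ Ω)
    (hpos : 0 < g x₁) : ∃ x₀ ∈ Ω, 0 < g x₀ ∧ IsMaxOn g Ω x₀ := by
  have h1 : ∀ x ∈ frontier Ω, ∃ V : Set (𝔼 N), IsOpen V ∧ x ∈ V ∧ ∀ z ∈ V ∩ Ω, g z < 0 := by
    intro x hx
    obtain ⟨V, hV, hxV, hVs⟩ := mem_nhdsWithin.1 (hneg x hx)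
    exact ⟨V, hV, hxV, fun z hz => hVs hz⟩
  choose! V hVo hxV hVneg using h1
  set W := ⋃ x ∈ frontier Ω, V x with hW
  have hWo : IsOpen W := isOpen_biUnion hVo
  set A := closure Ω \ W with hA
  have hAc : IsCompact A :=
    (Metric.isCompact_of_isClosed_isBounded isClosed_closure hb.closure).diff hWo
  have hAΩ : A ⊆ Ω := by
    intro x hx
    by_contra hn
    have hxf : x ∈ frontier Ω := ⟨hx.1, by rwa [hΩ.interior_eq]⟩
    exact hx.2 (mem_biUnion hxf (hxV x hxf))
  have hout : ∀ x ∈ Ω, x ∉ A → g x < 0 := by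
    intro x hx hxA
    have hxW : x ∈ W := by
      by_contra hn
      exact hxA ⟨subset_closure hx, hn⟩
    obtain ⟨y, hy, hxy⟩ := mem_iUnion₂.1 hxW
    exact hVneg y hy x ⟨hxy, hx⟩
  have hx₁A : x₁ ∈ A := by
    by_contra hn
    exact (hout x₁ hx₁ hn).not_gt hpos
  obtain ⟨x₀, hx₀, hmax⟩ := (hg.mono hAΩ).exists_isMaxOn ⟨x₁, hx₁A⟩ hAc
  have hx₀pos : 0 < g x₀ := hpos.trans_le (hmax hx₁A)
  refine ⟨x₀, hAΩ hx₀, hx₀pos, fun x hx => ?_⟩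
  by_cases hxA : x ∈ A
  · exact hmax hxA
  · exact ((hout x hx hxA).trans hx₀pos).le

end FracHarm

end

/-! ### Comparison with a multiple of the barrier -/

theorem proposition3p2 (N : ℕ) (hN : 1 ≤ N) (s γ Γ : ℝ) (hs0 : 0 < s) (hs1 : s < 1)
    (hγ : 0 < γ) (hγΓ : γ ≤ Γ) (I J : Type*) [Nonempty I] [Nonempty J]
    (K : I → J → EuclideanSpace ℝ (Fin N) → ℝ)
    (hK : ∀ i j, FracHarm.IsStableKernel s γ Γ (K i j))
    (Ω : Set (EuclideanSpace ℝ (Fin N))) (hΩ : FracHarm.IsBoundedC2Domain Ω)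
    (u : EuclideanSpace ℝ (Fin N) → ℝ)
    (hu : FracHarm.IsDirichletSubsolution s K Ω (fun _ => 0) (fun _ => 0) (fun _ => 0) u) :
    ∀ x ∈ Ω, u x ≤ 0 := by
  obtain ⟨ρ, L, C, H, c₀, d₀, r₁, h⟩ :=
    FracHarm.exists_isQuantDefining hΩ.isOpen hΩ.isBounded hΩ.boundary
  obtain ⟨w, hwi, hwd, hw0, hwρ, hwK⟩ := FracHarm.exists_barrier hN hs0 hs1 hγ hγΓ h
  intro x₁ hx₁
  by_contra hpos
  rw [not_le] at hpos
  have hw1 : ∀ x ∈ Ω, 0 < w x := fun x hx =>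
    lt_of_lt_of_le (Real.rpow_pos_of_pos ((h.mem_iff x).1 hx) _) (hwρ x hx)
  have hwx₁ := hw1 x₁ hx₁
  -- This choice leaves `u - ε w` equal to `u x₁ / 2 > 0` at `x₁`.
  set ε := u x₁ / (2 * w x₁) with hε
  have hε0 : 0 < ε := by positivity
  have hg1 : 0 < u x₁ + -(ε * w x₁) := by
    have : ε * w x₁ = u x₁ / 2 := by rw [hε]; field_simp
    rw [this]; linarith
  have husc : UpperSemicontinuousOn (fun x => u x + -(ε * w x)) Ω := by
    refine hu.subsolution.usc.add (ContinuousOn.upperSemicontinuousOn fun x hx => ?_)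
    exact ((continuousAt_const.mul (hwd x hx).continuousAt).neg).continuousWithinAt
  obtain ⟨x₀, hx₀, hx₀pos, hmax⟩ := FracHarm.exists_isMaxOn_of_neg_near_frontier hΩ.isOpen
    hΩ.isBounded husc (fun x hx => by
      filter_upwards [FracHarm.eventually_lt_barrier h hs1 hwρ hε0 hx
        (by simpa using hu.boundary x hx)] with z hz
      linarith) hx₁ hg1
  obtain ⟨δ, hδ, hball⟩ := Metric.isOpen_iff.1 hΩ.isOpen x₀ hx₀
  have hφi : MeasureTheory.Integrable fun y => ε * w y := hwi.const_mul ε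
  have hφd : ∀ x ∈ Ω, ContDiffAt ℝ 2 (fun y => ε * w y) x := fun x hx =>
    contDiffAt_const.mul (hwd x hx)
  have hvisc := hu.subsolution.viscosity x₀ hx₀ δ hδ hball (fun y => ε * w y)
    (fun y hy => (hφd y (hball hy)).contDiffWithinAt) hφi.integrableOn (fun y hy => by
      have : u y + -(ε * w y) ≤ u x₀ + -(ε * w x₀) := hmax (hball hy)
      show u y - ε * w y ≤ u x₀ - ε * w x₀
      linarith)
  -- Nothing is known about `u` on the frontier, which is null. Outside the closure `u ≤ 0 = w`, and
  -- the positivity of the maximum gives the inequality.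
  have hle : ∀ᵐ y, u y - u x₀ ≤ ε * w y - ε * w x₀ := by
    filter_upwards [MeasureTheory.measure_eq_zero_iff_ae_notMem.1 h.volume_frontier] with y hy
    by_cases hyΩ : y ∈ Ω
    · have : u y + -(ε * w y) ≤ u x₀ + -(ε * w x₀) := hmax hyΩ
      linarith
    · have hyc : y ∉ closure Ω := fun hc => hy ⟨hc, by rwa [hΩ.isOpen.interior_eq]⟩
      have h1 : u y ≤ 0 := hu.exterior y hyc
      rw [hw0 y hyΩ]
      linarith
  -- One index `i` suffices for the infimum, and the barrier bound is uniform in `j`. The factor `1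
  -- / 2` comes from the symmetrization.
  have hup : FracHarm.isaacsDelta K δ u (fun y => ε * w y) x₀ ≤ ((-(ε / 2) : ℝ) : EReal) := by
    obtain ⟨i⟩ := ‹Nonempty I›
    refine (iInf_le _ i).trans (iSup_le fun j => ?_)
    refine EReal.coe_le_coe_iff.2 ?_
    refine (FracHarm.pvOp_add_pvOp_le hN hs0 hs1 hγ (hK i j) hu.subsolution.memL1Weight hφi
      (hφd x₀ hx₀) hδ hle).trans ?_
    simp only [FracHarm.secondDiff_const_mul, mul_assoc]
    rw [MeasureTheory.integral_const_mul]
    have := mul_le_mul_of_nonneg_left (hwK (K i j) (hK i j) x₀ hx₀) hε0.le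
    linarith
  have hfin : (0 : ℝ) ≤ -(ε / 2) := EReal.coe_le_coe_iff.1 (hvisc.trans hup)
  linarith
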